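/- **Setting.** An *uncertainty space* is a set $X$ with an algebra $\Sigma_X$ of subsets; a map is *measurable* if preimages of measurable sets are measurable; $\mathbf{Unc}$ is the resulting category. For an uncertainty space $X$, the spaces $\Delta^*X,\ \Delta X,\ \Delta_{Pl}X,\ \Delta_{Ps}X$ consist respectively of - the upper probability measures: suprema $g(U)=\sup_{\mu\in\mathcal P}\mu(U)$ over nonempty families $\mathcal P$ of finitely additive probability measures on $\Sigma_X$; - the finitely additive probability measures on $\Sigma_X$; - the plausibility measures: $\gamma:\Sigma_X\to[0,1]$ with $\gamma(\emptyset)=0$, $\gamma(X)=1$ and $\gamma(\bigcap_{i\le n}U_i)\le\sum_{\emptyset\ne I\subseteq\{1,\dots,n\}}(-1)^{|I|+1}\gamma(\bigcup_{i\in I}U_i)$ for all $n\ge1$; - the possibility measures: $\pi:\Sigma_X\to[0,1]$ with $\pi(\emptyset)=0$, $\pi(X)=1$, $\pi(U\cup V)=\max\{\pi(U),\pi(V)\}$. On $\Delta X$ the algebra is generated by the sets $\beta^p(U)=\{\mu:\mu(U)\ge p\}$; on the other three by the sets $\beta^{p,q}(U)=\{g: g(U)\ge p,\ 1-g(U^c)\ge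 q\}$ ($p,q\in[0,1]$, $U\in\Sigma_X$). Morphisms act by push-forward. The *uncertainty polynomial functors* are the endofunctors of $\mathbf{Unc}$ built from $Id$ and constant functors $M$ by binary products, coproducts and composition with $\Delta^*,\Delta,\Delta_{Pl},\Delta_{Ps}$; they are handled as expressions. The ingredients $\mathsf{Ing}\,T$ are the subexpressions of $T$ together with $Id$. **Formulas.** Fix $T$. For each sort $S\in\mathsf{Ing}\,T$, the set $\mathsf{Form}_S$ is generated by: $\bot_S$; $\varphi\to\psi$; for $S=M$ constant, each measurable $A\subseteq M$ and each singleton $A=\{m\}$; $[\mathsf{pr}_j]\varphi$ for $S=S_1\times S_2$ and $[\mathsf{in}_j]\varphi$ for $S=S_1+S_2$ ($\varphi$ of sort $S_j$); $[\mathsf{next}]\varphi$ for $S=Id$ ($\varphi$ of sort $T$); $[(p,q)]\varphi$ for $S=\Delta^*S',\Delta_{Pl}S',\Delta_{Ps}S'$ and $P_{\ge p}\varphi$ for $S=\Delta S'$, where $\varphi$ is a *measurable* formula of sort $S'$ (all its constants $A$ are measurable sets). In a $T$-coalgebra $\alpha:X\to TX$ a formula of sort $S$ is interpreted as a subset of $SX$: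 $\bot,\to,A$ as usual, $[\mathsf{pr}_j]\varphi=\pi_j^{-1}(\varphi)$, $x\in[\mathsf{in}_j]\varphi$ iff ($x=in_j(y)$ implies $y\in\varphi$), $[\mathsf{next}]\varphi=\alpha^{-1}(\varphi)$, $[(p,q)]\varphi=\beta^{p,q}(\varphi)$, $P_{\ge p}\varphi=\beta^p(\varphi)$. Write $\Gamma\models^\alpha_S\varphi$ if every point of $SX$ satisfying all of $\Gamma$ satisfies $\varphi$, and $\Gamma\models_S\varphi$ if this holds for all $T$-coalgebras $\alpha$. Abbreviations: $U_{\ge p}\varphi=[(p,0)]\varphi$, $L_{\ge p}\varphi=[(0,p)]\varphi$, $U_{\le p}\varphi=[(0,1-p)]\neg\varphi$, $L_{\le p}\varphi=[(1-p,0)]\neg\varphi$, $U_{<p}\varphi=\neg U_{\ge p}\varphi$; $P_{\le p}\varphi=P_{\ge1-p}\neg\varphi$, $P_{<p}\varphi=\neg P_{\ge p}\varphi$. For formulas $\varphi_1,\dots,\varphi_m$ let $\Theta_k$ be $\bigvee_{|I|=k}\bigwedge_{i\in I}\varphi_i$. **Axioms.** (1) Boolean tautologies. (2) $\{c\}\to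 A$ if $c\in A$, $\{c\}\to\neg A$ if $c\notin A$. (3) $\neg[\kappa]\varphi\to[\kappa]\neg\varphi$ for $\kappa=\mathsf{pr}_j,\mathsf{in}_j,\mathsf{next}$; $\neg[\mathsf{pr}_j]\bot$; $\neg[\mathsf{next}]\bot$; $\neg[\mathsf{in}_1]\bot\leftrightarrow[\mathsf{in}_2]\bot$. (4) For $\Delta^*,\Delta_{Pl},\Delta_{Ps}$: $U_{\le p}\varphi\to U_{<q}\varphi$ ($p<q$); $U_{<p}\varphi\to U_{\le p}\varphi$; $L_{\ge1}(\varphi\to\psi)\to(U_{\ge p}\varphi\to U_{\ge p}\psi)$; $[(p,q)]\varphi\leftrightarrow(U_{\ge p}\varphi\wedge L_{\ge q}\varphi)$; $L_{\ge p}\varphi\leftrightarrow U_{\le1-p}\neg\varphi$. (5) For $\Delta_{Pl},\Delta_{Ps}$: $U_{\le p}\varphi\to L_{\le p}\varphi$. (6) For $\Delta_{Pl}$, $n\ge1$, $p_I\in[0,1]$ ($\emptyset\neq I\subseteq\{1,\dots,n\}$), $s=\sum_I(-1)^{|I|+1}p_I$, and $B=\bigwedge_I U_I$, where $U_I$ is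 $U_{\le p_I}\bigvee_{i\in I}\varphi_i$ for $|I|$ odd and $U_{\ge p_I}\bigvee_{i\in I}\varphi_i$ for $|I|$ even: $B\to U_{\le\min(s,1)}\bigwedge_{i=1}^n\varphi_i$ if $s\ge0$, and $\neg B$ if $s<0$. (7) For $\Delta_{Ps}$: $U_{\le0}\bot$ and $(U_{\le p}\varphi\wedge U_{\le q}\psi)\to U_{\le\max(p,q)}(\varphi\vee\psi)$. (8) For $\Delta$: $P_{\le p}\varphi\to P_{<q}\varphi$ ($p<q$); $P_{<p}\varphi\to P_{\le p}\varphi$; $P_{\ge1}(\varphi\to\psi)\to(P_{\ge p}\varphi\to P_{\ge p}\psi)$. **Deduction systems.** A *$T$-deduction system* is a family of relations $\vdash_S\subseteq\mathcal P(\mathsf{Form}_S)\times\mathsf{Form}_S$ ($S\in\mathsf{Ing}\,T$) closed under: *assumption* ($\Gamma\vdash_S\varphi$ if $\varphi\in\Gamma$ or $\varphi$ is an axiom); *modus ponens* ($\{\varphi,\varphi\to\psi\}\vdash_S\psi$); *cut*; the *deduction rule* ($\Gamma\cup\{\varphi\}\vdash_S\psi$ implies $\Gamma\vdash_S\varphi\to\psi$);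 the *constant rule* ($\{\neg\{c\}: c\in M\}\vdash_M\bot$); the *definite box rule* ($\Gamma\vdash\psi$ implies $[\kappa]\Gamma\vdash[\kappa]\psi$ for $\kappa=\mathsf{pr}_j,\mathsf{in}_j,\mathsf{next}$); *necessitation* ($\vdash_S\varphi$ implies $\vdash L_{\ge1}\varphi$, resp. $\vdash P_{\ge1}\varphi$, for $\varphi$ measurable); *Archimedean rules* ($\{R_{\ge q}\psi: q<p\}\vdash R_{\ge p}\psi$ for $R=U,L,P$); and for $\Delta^*S$ (with $R=U$) and $\Delta S$ (with $R=P$) the *cover rules*: if $n\ge1$, $\vdash_S\varphi\to\Theta_{n+k}$, $\vdash_S\Theta_k$, $p_i\in[0,1]$ and $p=\max(0,\min(1,(\sum_i p_i-k)/n))$, then $\vdash(\bigwedge_i R_{\le p_i}\varphi_i)\to R_{\le p}\varphi$; if $\vdash_S\Theta_k$ and $\sum_i p_i<k$, then $\vdash\neg\bigwedge_i R_{\le p_i}\varphi_i$. The system is *sound* if $\Gamma\vdash_S\varphi$ implies $\Gamma\models_S\varphi$. A set $x\subseteq\mathsf{Form}_S$ is *consistent* if $x\not\vdash_S\bot_S$,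 and *maximal* if it is consistent and, for every $\varphi$, contains exactly one of $\varphi,\neg\varphi$. The system is *Lindenbaum* if, for every $S$, each consistent subset of $\mathsf{Form}_S$ is included in a maximal one. Let $X_S$ be the set of maximal sets of sort $S$ with the algebra of all $|\varphi|=\{x:\varphi\in x\}$, $\varphi$ measurable of sort $S$. **Theorem.** Let $T$ be an uncertainty polynomial functor. 1. (Soundness.) The axioms and rules preserve validity: for every $T$-coalgebra $\alpha$ the relations $\models^\alpha_S$ form a $T$-deduction system. Consequently derivability from the axioms and rules (the least $T$-deduction system) is sound. The relations $\models_S$ form a (sound) Lindenbaum $T$-deduction system. 2. (Canonical coalgebra.) Let $D$ be a Lindenbaum $T$-deduction system. There are unique measurable maps $r_S:X_S\to S(X_{Id})$ ($S\in\mathsf{Ing}\,T$) and $\alpha^D:X_{Id}\to T(X_{Id})$ such that, with $[\kappa]^-x=\{\varphi:[\kappa]\varphi\in x\}$: $r_{Id}=\mathrm{id}$; $\{r_M(x)\}\in x$; $r_{S_1\times S_2}(x)=(r_{S_1}([\mathsf{pr}_1]^-x),r_{S_2}([\mathsf{pr}_2]^-x))$; $r_{S_1+S_2}(x)=in_j(r_{S_j}([\mathsf{in}_j]^-x))$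 where $\neg[\mathsf{in}_j]\bot\in x$; $r_{\Delta' S}(x)(A)=\sup\{q:R_{\ge q}\varphi\in x\}$ whenever $r_S^{-1}(A)=|\varphi|$, for $\Delta'=\Delta^*,\Delta_{Pl},\Delta_{Ps}$ ($R=U$) and $\Delta'=\Delta$ ($R=P$); and $\alpha^D(x)=r_T([\mathsf{next}]^-x)$. For all $S$, $\Gamma$, $\varphi$, $\Gamma\models^{\alpha^D}_S\varphi$ implies $\Gamma\vdash^D_S\varphi$. Every $T$-coalgebra $\beta$ such that $\Gamma\vdash^D_S\varphi$ always implies $\Gamma\models^\beta_S\varphi$ has exactly one coalgebra morphism to $(X_{Id},\alpha^D)$. 3. (Finality and completeness.) If moreover $D$ is sound, then $(X_{Id},\alpha^D)$ is the final $T$-coalgebra, and for all $S\in\mathsf{Ing}\,T$, $\Gamma\subseteq\mathsf{Form}_S$ and $\varphi\in\mathsf{Form}_S$ the following are equivalent: $\Gamma\models_S\varphi$; $\Gamma\models_S^{\alpha^D}\varphi$; $\Gamma\vdash_S^D\varphi$. -/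

import Mathlib

open CategoryTheory
open scoped unitInterval

universe u

noncomputable section

namespace UncLogic

/-! ### Uncertainty spaces and measurable functions -/

/-- An uncertainty space: a set with an algebra of subsets (its measurable sets). -/
structure Unc : Type (u + 1) where
  carrier : Type u
  alg : BooleanSubalgebra (Set carrier)

instance : CoeSort Unc.{u} (Type u) := ⟨Unc.carrier⟩

/-- Measurable functions: preimages of measurable sets are measurable. -/
@[ext]
structure Unc.Hom (X Y : Unc.{u}) : Type u where
  toFun : X → Y
  meas : ∀ U ∈ Y.alg, toFun ⁻¹' U ∈ X.alg

/-- The category of uncertainty spaces. -/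
instance : Category.{u} Unc.{u} where
  Hom := Unc.Hom
  id X := ⟨fun x => x, fun _ h => h⟩
  comp f g := ⟨fun x => g.toFun (f.toFun x), fun U h => f.meas _ (g.meas U h)⟩

/-- A function is measurable as soon as preimages of generators are. -/
theorem meas_of_gen {X : Unc.{u}} {Y : Type u} {G : Set (Set Y)} (f : X → Y)
    (h : ∀ U ∈ G, f ⁻¹' U ∈ X.alg) (U : Set Y) (hU : U ∈ BooleanSubalgebra.closure G) :
    f ⁻¹' U ∈ X.alg := by
  induction hU using BooleanSubalgebra.closure_bot_sup_induction with
  | mem U hU => exact h U hU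
  | bot => exact BooleanSubalgebra.bot_mem
  | sup U _ V _ h1 h2 => exact BooleanSubalgebra.sup_mem h1 h2
  | compl U _ h1 => exact BooleanSubalgebra.compl_mem h1

/-- Preimage along a measurable function, on measurable sets. -/
def pre {X Y : Unc.{u}} (f : X ⟶ Y) : BoundedLatticeHom Y.alg X.alg where
  toFun U := ⟨f.toFun ⁻¹' U.1, f.meas U.1 U.2⟩
  map_sup' _ _ := rfl
  map_inf' _ _ := rfl
  map_top' := rfl
  map_bot' := rfl

theorem pre_compl {X Y : Unc.{u}} (f : X ⟶ Y) (U : Y.alg) : pre f Uᶜ = (pre f U)ᶜ := rfl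

/-! ### The four representations of uncertainty -/

/-- Finitely additive probability measures on an uncertainty space. -/
structure IsProb (X : Unc.{u}) (μ : X.alg → ℝ) : Prop where
  nonneg : ∀ U, 0 ≤ μ U
  le_one : ∀ U, μ U ≤ 1
  empty : μ ⊥ = 0
  univ : μ ⊤ = 1
  add : ∀ U V, Disjoint U V → μ (U ⊔ V) = μ U + μ V

/-- Upper probability measures: upper envelopes of nonempty families of finitely additive
probability measures. -/
def IsUpper (X : Unc.{u}) (g : X.alg → ℝ) : Prop :=
  ∃ P : Set (X.alg → ℝ), P.Nonempty ∧ (∀ μ ∈ P, IsProb X μ) ∧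
    ∀ U, IsLUB ((fun μ => μ U) '' P) (g U)

/-- Plausibility measures. -/
structure IsPlaus (X : Unc.{u}) (g : X.alg → ℝ) : Prop where
  nonneg : ∀ U, 0 ≤ g U
  le_one : ∀ U, g U ≤ 1
  empty : g ⊥ = 0
  univ : g ⊤ = 1
  inter_le : ∀ n : ℕ, 1 ≤ n → ∀ U : Fin n → X.alg,
    g (Finset.univ.inf U) ≤
      ∑ J : Finset (Fin n) with J.Nonempty, (-1 : ℝ) ^ (J.card + 1) * g (J.sup U)

/-- Possibility measures. -/
structure IsPoss (X : Unc.{u}) (g : X.alg → ℝ) : Prop where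
  nonneg : ∀ U, 0 ≤ g U
  le_one : ∀ U, g U ≤ 1
  empty : g ⊥ = 0
  univ : g ⊤ = 1
  union : ∀ U V, g (U ⊔ V) = max (g U) (g V)

/-- The three representations of uncertainty whose modalities carry two bounds `(p, q)`. -/
inductive Kind : Type
  | upper
  | plaus
  | poss

/-- The measures of each kind. -/
def Kind.IsMeas : Kind → ∀ X : Unc.{u}, (X.alg → ℝ) → Prop
  | .upper => IsUpper
  | .plaus => IsPlaus
  | .poss => IsPoss

theorem IsProb.push {X Y : Unc.{u}} (f : X ⟶ Y) {μ : X.alg → ℝ} (h : IsProb X μ) :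
    IsProb Y (fun U => μ (pre f U)) where
  nonneg _ := h.nonneg _
  le_one _ := h.le_one _
  empty := by rw [map_bot]; exact h.empty
  univ := by rw [map_top]; exact h.univ
  add U V hUV := by rw [map_sup]; exact h.add _ _ (hUV.map (pre f))

theorem Kind.IsMeas.push (κ : Kind) {X Y : Unc.{u}} (f : X ⟶ Y) {g : X.alg → ℝ}
    (h : κ.IsMeas X g) : κ.IsMeas Y (fun U => g (pre f U)) := by
  cases κ with
  | upper =>
    obtain ⟨P, hne, hP, hg⟩ := h
    refine ⟨(fun μ U => μ (pre f U)) '' P, hne.image _, ?_, fun U => ?_⟩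
    · rintro _ ⟨μ, hμ, rfl⟩
      exact (hP μ hμ).push f
    · rw [Set.image_image]
      exact hg (pre f U)
  | plaus =>
    obtain ⟨h0, h1, he, hu, hi⟩ := h
    refine ⟨fun _ => h0 _, fun _ => h1 _, ?_, ?_, fun n hn U => ?_⟩
    · rw [map_bot]; exact he
    · rw [map_top]; exact hu
    · simp only [map_finset_inf, map_finset_sup]
      exact hi n hn _
  | poss =>
    obtain ⟨h0, h1, he, hu, hs⟩ := h
    refine ⟨fun _ => h0 _, fun _ => h1 _, ?_, ?_, fun U V => ?_⟩
    · rw [map_bot]; exact he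
    · rw [map_top]; exact hu
    · rw [map_sup]; exact hs _ _

/-- The measures of kind `κ` on `X`. -/
def Cap (κ : Kind) (X : Unc.{u}) : Type u := {g : X.alg → ℝ // κ.IsMeas X g}

/-- The finitely additive probability measures on `X`. -/
def Prb (X : Unc.{u}) : Type u := {μ : X.alg → ℝ // IsProb X μ}

/-- `β^{p,q}(U)`: the measures `g` with `g U ≥ p` and `1 - g Uᶜ ≥ q`, for `U` measurable
(the value at a non-measurable `U`, the empty set, plays no role). -/
def betaCap (κ : Kind) (X : Unc.{u}) (p q : I) (U : Set X) : Set (Cap κ X) :=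
  {g | ∃ h : U ∈ X.alg, (p : ℝ) ≤ g.1 ⟨U, h⟩ ∧ (q : ℝ) ≤ 1 - g.1 (⟨U, h⟩ : X.alg)ᶜ}

/-- `β^p(U)`: the probability measures `μ` with `μ U ≥ p`, for `U` measurable. -/
def betaPrb (X : Unc.{u}) (p : I) (U : Set X) : Set (Prb X) :=
  {μ | ∃ h : U ∈ X.alg, (p : ℝ) ≤ μ.1 ⟨U, h⟩}

/-- The uncertainty space of measures of kind `κ`. -/
def capSpace (κ : Kind) (X : Unc.{u}) : Unc.{u} where
  carrier := Cap κ X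
  alg := BooleanSubalgebra.closure {B | ∃ p q : I, ∃ U ∈ X.alg, B = betaCap κ X p q U}

/-- The uncertainty space of finitely additive probability measures. -/
def prbSpace (X : Unc.{u}) : Unc.{u} where
  carrier := Prb X
  alg := BooleanSubalgebra.closure {B | ∃ p : I, ∃ U ∈ X.alg, B = betaPrb X p U}

/-- The functors `Δ*`, `Δ_Pl` and `Δ_Ps`; morphisms act by push-forward. -/
def capFunctor (κ : Kind) : Unc.{u} ⥤ Unc.{u} where
  obj X := capSpace κ X
  map {X Y} f :=
    { toFun := fun g => ⟨fun U => g.1 (pre f U), Kind.IsMeas.push κ f g.2⟩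
      meas := by
        refine meas_of_gen (X := capSpace κ X) _ ?_
        rintro _ ⟨p, q, U, hU, rfl⟩
        refine BooleanSubalgebra.subset_closure ⟨p, q, f.toFun ⁻¹' U, f.meas U hU, ?_⟩
        ext g
        exact ⟨fun ⟨_, h⟩ => ⟨f.meas U hU, h⟩, fun ⟨_, h⟩ => ⟨hU, h⟩⟩ }

/-- The functor `Δ`; morphisms act by push-forward. -/
def prbFunctor : Unc.{u} ⥤ Unc.{u} where
  obj X := prbSpace X
  map {X Y} f :=
    { toFun := fun μ => ⟨fun U => μ.1 (pre f U), IsProb.push f μ.2⟩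
      meas := by
        refine meas_of_gen (X := prbSpace X) _ ?_
        rintro _ ⟨p, U, hU, rfl⟩
        refine BooleanSubalgebra.subset_closure ⟨p, f.toFun ⁻¹' U, f.meas U hU, ?_⟩
        ext g
        exact ⟨fun ⟨_, h⟩ => ⟨f.meas U hU, h⟩, fun ⟨_, h⟩ => ⟨hU, h⟩⟩ }

/-! ### Products and coproducts -/

/-- Product space, with the algebra generated by the measurable rectangles. -/
def prodSpace (X Y : Unc.{u}) : Unc.{u} where
  carrier := X × Y
  alg := BooleanSubalgebra.closure {B | ∃ U ∈ X.alg, ∃ V ∈ Y.alg, B = U ×ˢ V}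

/-- Coproduct space, with the algebra generated by the copies of measurable sets. -/
def sumSpace (X Y : Unc.{u}) : Unc.{u} where
  carrier := X ⊕ Y
  alg := BooleanSubalgebra.closure
    {B | (∃ U ∈ X.alg, B = Sum.inl '' U) ∨ ∃ V ∈ Y.alg, B = Sum.inr '' V}

def prodMap {X Y X' Y' : Unc.{u}} (f : X ⟶ X') (g : Y ⟶ Y') :
    prodSpace X Y ⟶ prodSpace X' Y' where
  toFun := Prod.map f.toFun g.toFun
  meas := by
    refine meas_of_gen (X := prodSpace X Y) _ ?_
    rintro _ ⟨U, hU, V, hV, rfl⟩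
    exact BooleanSubalgebra.subset_closure ⟨_, f.meas U hU, _, g.meas V hV, rfl⟩

def sumMap {X Y X' Y' : Unc.{u}} (f : X ⟶ X') (g : Y ⟶ Y') :
    sumSpace X Y ⟶ sumSpace X' Y' where
  toFun := Sum.map f.toFun g.toFun
  meas := by
    refine meas_of_gen (X := sumSpace X Y) _ ?_
    rintro _ (⟨U, hU, rfl⟩ | ⟨V, hV, rfl⟩)
    · refine BooleanSubalgebra.subset_closure (Or.inl ⟨_, f.meas U hU, ?_⟩)
      change Sum.map f.toFun g.toFun ⁻¹' _ = (_ : Set (X.carrier ⊕ Y.carrier))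
      ext (x | x) <;> simp
    · refine BooleanSubalgebra.subset_closure (Or.inr ⟨_, g.meas V hV, ?_⟩)
      change Sum.map f.toFun g.toFun ⁻¹' _ = (_ : Set (X.carrier ⊕ Y.carrier))
      ext (x | x) <;> simp

def prodFunctor (F G : Unc.{u} ⥤ Unc.{u}) : Unc.{u} ⥤ Unc.{u} where
  obj X := prodSpace (F.obj X) (G.obj X)
  map f := prodMap (F.map f) (G.map f)
  map_id X := by rw [F.map_id, G.map_id]; rfl
  map_comp f g := by rw [F.map_comp, G.map_comp]; rfl

def sumFunctor (F G : Unc.{u} ⥤ Unc.{u}) : Unc.{u} ⥤ Unc.{u} where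
  obj X := sumSpace (F.obj X) (G.obj X)
  map f := sumMap (F.map f) (G.map f)
  map_id X := by
    rw [F.map_id, G.map_id]; apply Unc.Hom.ext; funext x; cases x <;> rfl
  map_comp f g := by
    rw [F.map_comp, G.map_comp]; apply Unc.Hom.ext; funext x; cases x <;> rfl

/-! ### Uncertainty polynomial functors and their ingredients -/

/-- Expressions for uncertainty polynomial functors. The constant functors that may be used are
those at the members of a family of uncertainty spaces indexed by `K`. -/
inductive PF (K : Type u) : Type u
  | id : PF K
  | const (k : K) : PF K
  | prod (S₁ S₂ : PF K) : PF K
  | sum (S₁ S₂ : PF K) : PF K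
  | cap (κ : Kind) (S : PF K) : PF K
  | prob (S : PF K) : PF K

variable {K : Type u}

/-- The set of ingredients of a functor expression. -/
def PF.Ing : PF K → Set (PF K)
  | .id => {.id}
  | .const k => {.const k, .id}
  | .prod S₁ S₂ => insert (.prod S₁ S₂) (S₁.Ing ∪ S₂.Ing)
  | .sum S₁ S₂ => insert (.sum S₁ S₂) (S₁.Ing ∪ S₂.Ing)
  | .cap κ S => insert (.cap κ S) S.Ing
  | .prob S => insert (.prob S) S.Ing

theorem PF.self_mem (S : PF K) : S ∈ S.Ing := by cases S <;> simp [PF.Ing]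

theorem PF.id_mem (S : PF K) : PF.id ∈ S.Ing := by
  induction S <;> simp_all [PF.Ing]

/-- Being an ingredient is transitive (apart from the step from `Id` to `T`). -/
theorem PF.Ing_subset {S T : PF K} (h : S ∈ T.Ing) : S.Ing ⊆ T.Ing := by
  induction T with
  | id => obtain rfl : S = .id := h; exact subset_rfl
  | const k =>
    obtain rfl | rfl : S = .const k ∨ S = .id := h
    · exact subset_rfl
    · rintro R (rfl : R = .id); exact PF.id_mem _
  | prod S₁ S₂ ih₁ ih₂ =>
    obtain rfl | h | h := h
    · exact subset_rfl
    · exact (ih₁ h).trans fun R hR => Or.inr (Or.inl hR)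
    · exact (ih₂ h).trans fun R hR => Or.inr (Or.inr hR)
  | sum S₁ S₂ ih₁ ih₂ =>
    obtain rfl | h | h := h
    · exact subset_rfl
    · exact (ih₁ h).trans fun R hR => Or.inr (Or.inl hR)
    · exact (ih₂ h).trans fun R hR => Or.inr (Or.inr hR)
  | cap κ S ih =>
    obtain rfl | h := h
    · exact subset_rfl
    · exact (ih h).trans fun R hR => Or.inr hR
  | prob S ih =>
    obtain rfl | h := h
    · exact subset_rfl
    · exact (ih h).trans fun R hR => Or.inr hR

theorem PF.prod_left {S₁ S₂ T : PF K} (h : PF.prod S₁ S₂ ∈ T.Ing) : S₁ ∈ T.Ing :=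
  PF.Ing_subset h (Or.inr (Or.inl S₁.self_mem))
theorem PF.prod_right {S₁ S₂ T : PF K} (h : PF.prod S₁ S₂ ∈ T.Ing) : S₂ ∈ T.Ing :=
  PF.Ing_subset h (Or.inr (Or.inr S₂.self_mem))
theorem PF.sum_left {S₁ S₂ T : PF K} (h : PF.sum S₁ S₂ ∈ T.Ing) : S₁ ∈ T.Ing :=
  PF.Ing_subset h (Or.inr (Or.inl S₁.self_mem))
theorem PF.sum_right {S₁ S₂ T : PF K} (h : PF.sum S₁ S₂ ∈ T.Ing) : S₂ ∈ T.Ing :=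
  PF.Ing_subset h (Or.inr (Or.inr S₂.self_mem))
theorem PF.cap_arg {κ : Kind} {S T : PF K} (h : PF.cap κ S ∈ T.Ing) : S ∈ T.Ing :=
  PF.Ing_subset h (Or.inr S.self_mem)
theorem PF.prob_arg {S T : PF K} (h : PF.prob S ∈ T.Ing) : S ∈ T.Ing :=
  PF.Ing_subset h (Or.inr S.self_mem)

/-- The endofunctor of the category of uncertainty spaces that an expression denotes. -/
def PF.functor (M : K → Unc.{u}) : PF K → (Unc.{u} ⥤ Unc.{u})
  | .id => 𝟭 _
  | .const k => (Functor.const _).obj (M k)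
  | .prod S₁ S₂ => prodFunctor (S₁.functor M) (S₂.functor M)
  | .sum S₁ S₂ => sumFunctor (S₁.functor M) (S₂.functor M)
  | .cap κ S => S.functor M ⋙ capFunctor κ
  | .prob S => S.functor M ⋙ prbFunctor

/-- `T`-coalgebras. -/
abbrev Coalg (M : K → Unc.{u}) (T : PF K) := Endofunctor.Coalgebra (T.functor M)

/-! ### Formulas -/

/-- `Fml M T false S` is the set of formulas of sort `S` of the language of `T`;
`Fml M T true S` is the set of measurable ones, in which every constant is a measurable set.
Only measurable formulas may follow a modality for uncertainty. -/
inductive Fml (M : K → Unc.{u}) (T : PF K) : Bool → PF K → Type u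
  | bot {b : Bool} (S : PF K) : Fml M T b S
  | imp {b : Bool} {S : PF K} (φ ψ : Fml M T b S) : Fml M T b S
  | atom {b : Bool} (k : K) (A : Set (M k))
      (h : A ∈ (M k).alg ∨ (b = false ∧ ∃ m, A = {m})) : Fml M T b (.const k)
  | pr₁ {b : Bool} {S₁ S₂ : PF K} (φ : Fml M T b S₁) : Fml M T b (.prod S₁ S₂)
  | pr₂ {b : Bool} {S₁ S₂ : PF K} (φ : Fml M T b S₂) : Fml M T b (.prod S₁ S₂)
  | in₁ {b : Bool} {S₁ S₂ : PF K} (φ : Fml M T b S₁) : Fml M T b (.sum S₁ S₂)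
  | in₂ {b : Bool} {S₁ S₂ : PF K} (φ : Fml M T b S₂) : Fml M T b (.sum S₁ S₂)
  | next {b : Bool} (φ : Fml M T b T) : Fml M T b .id
  | box {b : Bool} (κ : Kind) {S : PF K} (p q : I) (φ : Fml M T true S) : Fml M T b (.cap κ S)
  | ge {b : Bool} {S : PF K} (p : I) (φ : Fml M T true S) : Fml M T b (.prob S)

variable {M : K → Unc.{u}} {T : PF K} {b : Bool} {S : PF K}

namespace Fml

/-- All formulas of sort `S`. -/
abbrev _root_.UncLogic.Form (M : K → Unc.{u}) (T S : PF K) : Type u := Fml M T false S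

/-- All measurable formulas of sort `S`. -/
abbrev _root_.UncLogic.MForm (M : K → Unc.{u}) (T S : PF K) : Type u := Fml M T true S

/-- Inclusion of the measurable formulas in all formulas. -/
def toForm : ∀ {b : Bool} {S : PF K}, Fml M T b S → Form M T S
  | _, _, bot S => bot S
  | _, _, imp φ ψ => imp φ.toForm ψ.toForm
  | true, _, atom k A h => atom k A (Or.inl (h.resolve_right (by simp)))
  | false, _, atom k A h => atom k A h
  | _, _, pr₁ φ => pr₁ φ.toForm
  | _, _, pr₂ φ => pr₂ φ.toForm
  | _, _, in₁ φ => in₁ φ.toForm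
  | _, _, in₂ φ => in₂ φ.toForm
  | _, _, next φ => next φ.toForm
  | _, _, box κ p q φ => box κ p q φ
  | _, _, ge p φ => ge p φ

def neg (φ : Fml M T b S) : Fml M T b S := imp φ (bot S)
def top (M : K → Unc.{u}) (T : PF K) (b : Bool) (S : PF K) : Fml M T b S := neg (bot S)
def or (φ ψ : Fml M T b S) : Fml M T b S := imp (neg φ) ψ
def and (φ ψ : Fml M T b S) : Fml M T b S := neg (or (neg φ) (neg ψ))
def iff (φ ψ : Fml M T b S) : Fml M T b S := and (imp φ ψ) (imp ψ φ)

/-- Finite disjunction (in some order). -/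
def bigOr {ι : Type*} (s : Finset ι) (φ : ι → Fml M T b S) : Fml M T b S :=
  (s.toList.map φ).foldr or (bot S)

/-- Finite conjunction (in some order). -/
def bigAnd {ι : Type*} (s : Finset ι) (φ : ι → Fml M T b S) : Fml M T b S :=
  (s.toList.map φ).foldr and (top M T b S)

/-- The formula "at least `k` of `φ₁, …, φₘ`": the disjunction over the `k`-element sets
`I` of indices of the conjunctions of the `φ_i` with `i ∈ I`. -/
def atLeast {m : ℕ} (k : ℕ) (φ : Fin m → Fml M T b S) : Fml M T b S :=
  bigOr ((Finset.univ : Finset (Fin m)).powersetCard k) fun J => bigAnd J φ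

/-- The singleton formula `{c}`. -/
def single (k : K) (c : M k) : Form M T (.const k) := atom k {c} (Or.inr ⟨rfl, c, rfl⟩)

/-! Abbreviations for bounds on the measure (`u`, upper) and on its dual (`l`, lower). -/

def uGe (κ : Kind) (p : I) (φ : MForm M T S) : Form M T (.cap κ S) := box κ p 0 φ
def lGe (κ : Kind) (p : I) (φ : MForm M T S) : Form M T (.cap κ S) := box κ 0 p φ
def uLe (κ : Kind) (p : I) (φ : MForm M T S) : Form M T (.cap κ S) := box κ 0 (σ p) (neg φ)
def lLe (κ : Kind) (p : I) (φ : MForm M T S) : Form M T (.cap κ S) := box κ (σ p) 0 (neg φ)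
def uLt (κ : Kind) (p : I) (φ : MForm M T S) : Form M T (.cap κ S) := neg (uGe κ p φ)

/-- `≤ p` for odd `i`, `≥ p` for even `i`. -/
def uAlt (κ : Kind) (i : ℕ) (p : I) (φ : MForm M T S) : Form M T (.cap κ S) :=
  if Odd i then uLe κ p φ else uGe κ p φ

/-! The corresponding abbreviations for probability measures. -/

def pGe (p : I) (φ : MForm M T S) : Form M T (.prob S) := ge p φ
def pLe (p : I) (φ : MForm M T S) : Form M T (.prob S) := ge (σ p) (neg φ)
def pLt (p : I) (φ : MForm M T S) : Form M T (.prob S) := neg (pGe p φ)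

/-! ### Semantics -/

/-- The interpretation of a formula of sort `S` in a `T`-coalgebra `(X, α)`: a subset of `S X`. -/
def interp (A : Coalg M T) : ∀ {b : Bool} {S : PF K}, Fml M T b S → Set ((S.functor M).obj A.V)
  | _, _, bot _ => ∅
  | _, _, imp φ ψ => (interp A φ)ᶜ ∪ interp A ψ
  | _, _, atom _ B _ => B
  | _, _, pr₁ φ => Prod.fst ⁻¹' interp A φ
  | _, _, pr₂ φ => Prod.snd ⁻¹' interp A φ
  | _, _, in₁ φ => Sum.inl '' interp A φ ∪ Set.range Sum.inr
  | _, _, in₂ φ => Set.range Sum.inl ∪ Sum.inr '' interp A φ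
  | _, _, next φ => A.str.toFun ⁻¹' interp A φ
  | _, _, box (S := S) κ p q φ => betaCap κ ((S.functor M).obj A.V) p q (interp A φ)
  | _, _, ge (S := S) p φ => betaPrb ((S.functor M).obj A.V) p (interp A φ)

/-- Boolean tautologies of sort `S`: true under all truth assignments to the formulas of sort `S`
that respect `⊥` and `→`. -/
def IsTaut (φ : Form M T S) : Prop :=
  ∀ v : Form M T S → Prop, ¬ v (bot S) → (∀ ψ χ, v (imp ψ χ) ↔ (v ψ → v χ)) → v φ

end Fml

open Fml

/-! ### Deduction systems -/

/-- Families of relations between sets of formulas and formulas, indexed by sorts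
(only the sorts in `T.Ing` matter). -/
abbrev Entailment (M : K → Unc.{u}) (T : PF K) :=
  ∀ S : PF K, Set (Form M T S) → Form M T S → Prop

/-- The consequence relations of a coalgebra. -/
def Cons (A : Coalg M T) : Entailment M T := fun _ Γ φ =>
  ∀ x, (∀ γ ∈ Γ, x ∈ interp A γ) → x ∈ interp A φ

/-- The semantic consequence relations: consequence in all `T`-coalgebras. -/
def SemCons (M : K → Unc.{u}) (T : PF K) : Entailment M T := fun S Γ φ =>
  ∀ A : Coalg M T, Cons A S Γ φ

/-- The axioms. -/
inductive Ax (M : K → Unc.{u}) (T : PF K) : ∀ S : PF K, Form M T S → Prop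
  | taut (S : PF K) (φ : Form M T S) : IsTaut φ → Ax M T S φ
  -- constants
  | const_mem (k : K) (c : M k) (A : Set (M k)) (h) :
      c ∈ A → Ax M T _ (imp (single k c) (atom k A h))
  | const_notMem (k : K) (c : M k) (A : Set (M k)) (h) :
      c ∉ A → Ax M T _ (imp (single k c) (neg (atom k A h)))
  -- products
  | pr₁_neg (S₁ S₂ : PF K) (φ : Form M T S₁) :
      Ax M T (.prod S₁ S₂) (imp (neg (pr₁ φ)) (pr₁ (neg φ)))
  | pr₂_neg (S₁ S₂ : PF K) (φ : Form M T S₂) :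
      Ax M T (.prod S₁ S₂) (imp (neg (pr₂ φ)) (pr₂ (neg φ)))
  | pr₁_bot (S₁ S₂ : PF K) : Ax M T (.prod S₁ S₂) (neg (pr₁ (bot S₁)))
  | pr₂_bot (S₁ S₂ : PF K) : Ax M T (.prod S₁ S₂) (neg (pr₂ (bot S₂)))
  -- coproducts
  | in₁_neg (S₁ S₂ : PF K) (φ : Form M T S₁) :
      Ax M T (.sum S₁ S₂) (imp (neg (in₁ φ)) (in₁ (neg φ)))
  | in₂_neg (S₁ S₂ : PF K) (φ : Form M T S₂) :
      Ax M T (.sum S₁ S₂) (imp (neg (in₂ φ)) (in₂ (neg φ)))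
  | in_bot (S₁ S₂ : PF K) : Ax M T (.sum S₁ S₂) (iff (neg (in₁ (bot S₁))) (in₂ (bot S₂)))
  -- identity
  | next_neg (φ : Form M T T) : Ax M T .id (imp (neg (next φ)) (next (neg φ)))
  | next_bot : Ax M T .id (neg (next (bot T)))
  -- upper probabilities, plausibilities and possibilities
  | le_lt (κ : Kind) (S : PF K) (p q : I) (φ : MForm M T S) :
      p < q → Ax M T (.cap κ S) (imp (uLe κ p φ) (uLt κ q φ))
  | lt_le (κ : Kind) (S : PF K) (p : I) (φ : MForm M T S) :
      Ax M T (.cap κ S) (imp (uLt κ p φ) (uLe κ p φ))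
  | mono (κ : Kind) (S : PF K) (p : I) (φ ψ : MForm M T S) :
      Ax M T (.cap κ S) (imp (lGe κ 1 (imp φ ψ)) (imp (uGe κ p φ) (uGe κ p ψ)))
  | split (κ : Kind) (S : PF K) (p q : I) (φ : MForm M T S) :
      Ax M T (.cap κ S) (iff (box κ p q φ) (and (uGe κ p φ) (lGe κ q φ)))
  -- "lower measure of `φ` at least `p`" and "measure of `¬φ` at most `1 - p`" mean the same
  | dual (κ : Kind) (S : PF K) (p : I) (φ : MForm M T S) :
      Ax M T (.cap κ S) (iff (lGe κ p φ) (uLe κ (σ p) (neg φ)))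
  -- plausibilities and possibilities
  | le_dual (κ : Kind) (S : PF K) (p : I) (φ : MForm M T S) :
      κ ≠ .upper → Ax M T (.cap κ S) (imp (uLe κ p φ) (lLe κ p φ))
  -- plausibilities
  | plaus_le (S : PF K) (n : ℕ) (φ : Fin n → MForm M T S) (P : Finset (Fin n) → I) (p : I) :
      1 ≤ n →
      0 ≤ ∑ J : Finset (Fin n) with J.Nonempty, (-1 : ℝ) ^ (J.card + 1) * (P J : ℝ) →
      (p : ℝ) = min
        (∑ J : Finset (Fin n) with J.Nonempty, (-1 : ℝ) ^ (J.card + 1) * (P J : ℝ)) 1 →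
      Ax M T (.cap .plaus S)
        (imp (bigAnd (Finset.univ.filter Finset.Nonempty)
              fun J => uAlt .plaus J.card (P J) (bigOr J φ))
          (uLe .plaus p (bigAnd Finset.univ φ)))
  | plaus_neg (S : PF K) (n : ℕ) (φ : Fin n → MForm M T S) (P : Finset (Fin n) → I) :
      1 ≤ n →
      ∑ J : Finset (Fin n) with J.Nonempty, (-1 : ℝ) ^ (J.card + 1) * (P J : ℝ) < 0 →
      Ax M T (.cap .plaus S)
        (neg (bigAnd (Finset.univ.filter Finset.Nonempty)
              fun J => uAlt .plaus J.card (P J) (bigOr J φ)))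
  -- possibilities
  | poss_bot (S : PF K) : Ax M T (.cap .poss S) (uLe .poss 0 (bot S))
  | poss_or (S : PF K) (p q : I) (φ ψ : MForm M T S) :
      Ax M T (.cap .poss S)
        (imp (and (uLe .poss p φ) (uLe .poss q ψ)) (uLe .poss (max p q) (or φ ψ)))
  -- probabilities
  | prob_le_lt (S : PF K) (p q : I) (φ : MForm M T S) :
      p < q → Ax M T (.prob S) (imp (pLe p φ) (pLt q φ))
  | prob_lt_le (S : PF K) (p : I) (φ : MForm M T S) :
      Ax M T (.prob S) (imp (pLt p φ) (pLe p φ))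
  | prob_mono (S : PF K) (p : I) (φ ψ : MForm M T S) :
      Ax M T (.prob S) (imp (pGe 1 (imp φ ψ)) (imp (pGe p φ) (pGe p ψ)))

/-- `T`-deduction systems: families of relations closed under the rules. -/
structure IsDeductionSystem (M : K → Unc.{u}) (T : PF K) (D : Entailment M T) : Prop where
  assumption : ∀ S ∈ T.Ing, ∀ Γ φ, (φ ∈ Γ ∨ Ax M T S φ) → D S Γ φ
  modusPonens : ∀ S ∈ T.Ing, ∀ φ ψ, D S {φ, imp φ ψ} ψ
  cut : ∀ S ∈ T.Ing, ∀ Γ Λ φ, (∀ lam ∈ Λ, D S Γ lam) → D S Λ φ → D S Γ φ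
  deduction : ∀ S ∈ T.Ing, ∀ Γ φ ψ, D S (Γ ∪ {φ}) ψ → D S Γ (imp φ ψ)
  constant : ∀ k : K, .const k ∈ T.Ing →
    D (.const k) {φ | ∃ c : M k, φ = neg (single k c)} (bot _)
  -- definite box rules
  box_pr₁ : ∀ S₁ S₂, .prod S₁ S₂ ∈ T.Ing → ∀ Γ ψ,
    D S₁ Γ ψ → D (.prod S₁ S₂) (pr₁ '' Γ) (pr₁ ψ)
  box_pr₂ : ∀ S₁ S₂, .prod S₁ S₂ ∈ T.Ing → ∀ Γ ψ,
    D S₂ Γ ψ → D (.prod S₁ S₂) (pr₂ '' Γ) (pr₂ ψ)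
  box_in₁ : ∀ S₁ S₂, .sum S₁ S₂ ∈ T.Ing → ∀ Γ ψ,
    D S₁ Γ ψ → D (.sum S₁ S₂) (in₁ '' Γ) (in₁ ψ)
  box_in₂ : ∀ S₁ S₂, .sum S₁ S₂ ∈ T.Ing → ∀ Γ ψ,
    D S₂ Γ ψ → D (.sum S₁ S₂) (in₂ '' Γ) (in₂ ψ)
  box_next : ∀ Γ ψ, D T Γ ψ → D .id (next '' Γ) (next ψ)
  -- upper probabilities, plausibilities and possibilities
  necessitation : ∀ κ S, .cap κ S ∈ T.Ing → ∀ φ : MForm M T S,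
    D S ∅ φ.toForm → D (.cap κ S) ∅ (lGe κ 1 φ)
  arch_u : ∀ κ S, .cap κ S ∈ T.Ing → ∀ (p : I) (ψ : MForm M T S),
    D (.cap κ S) {χ | ∃ q : I, q < p ∧ χ = uGe κ q ψ} (uGe κ p ψ)
  arch_l : ∀ κ S, .cap κ S ∈ T.Ing → ∀ (p : I) (ψ : MForm M T S),
    D (.cap κ S) {χ | ∃ q : I, q < p ∧ χ = lGe κ q ψ} (lGe κ p ψ)
  -- cover rules for upper probabilities
  cover : ∀ S, .cap .upper S ∈ T.Ing → ∀ (m n k : ℕ), 1 ≤ n →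
    ∀ (φ : MForm M T S) (Φ : Fin m → MForm M T S) (P : Fin m → I) (p : I),
    (p : ℝ) = max 0 (min 1 ((∑ i, (P i : ℝ) - k) / n)) →
    D S ∅ (imp φ (atLeast (n + k) Φ)).toForm → D S ∅ (atLeast k Φ).toForm →
    D (.cap .upper S) ∅
      (imp (bigAnd Finset.univ fun i => uLe .upper (P i) (Φ i)) (uLe .upper p φ))
  cover_neg : ∀ S, .cap .upper S ∈ T.Ing → ∀ (m k : ℕ)
    (Φ : Fin m → MForm M T S) (P : Fin m → I),
    ∑ i, (P i : ℝ) < k → D S ∅ (atLeast k Φ).toForm →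
    D (.cap .upper S) ∅ (neg (bigAnd Finset.univ fun i => uLe .upper (P i) (Φ i)))
  -- probabilities
  prob_necessitation : ∀ S, .prob S ∈ T.Ing → ∀ φ : MForm M T S,
    D S ∅ φ.toForm → D (.prob S) ∅ (pGe 1 φ)
  prob_arch : ∀ S, .prob S ∈ T.Ing → ∀ (p : I) (ψ : MForm M T S),
    D (.prob S) {χ | ∃ q : I, q < p ∧ χ = pGe q ψ} (pGe p ψ)
  prob_cover : ∀ S, .prob S ∈ T.Ing → ∀ (m n k : ℕ), 1 ≤ n →
    ∀ (φ : MForm M T S) (Φ : Fin m → MForm M T S) (P : Fin m → I) (p : I),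
    (p : ℝ) = max 0 (min 1 ((∑ i, (P i : ℝ) - k) / n)) →
    D S ∅ (imp φ (atLeast (n + k) Φ)).toForm → D S ∅ (atLeast k Φ).toForm →
    D (.prob S) ∅ (imp (bigAnd Finset.univ fun i => pLe (P i) (Φ i)) (pLe p φ))
  prob_cover_neg : ∀ S, .prob S ∈ T.Ing → ∀ (m k : ℕ)
    (Φ : Fin m → MForm M T S) (P : Fin m → I),
    ∑ i, (P i : ℝ) < k → D S ∅ (atLeast k Φ).toForm →
    D (.prob S) ∅ (neg (bigAnd Finset.univ fun i => pLe (P i) (Φ i)))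

/-- Derivability from the axioms by the rules: the least `T`-deduction system. -/
def Derivable (M : K → Unc.{u}) (T : PF K) : Entailment M T := fun S Γ φ =>
  ∀ D : Entailment M T, IsDeductionSystem M T D → D S Γ φ

/-- A system is sound if it is contained in semantic consequence. -/
def IsSound (D : Entailment M T) : Prop :=
  ∀ S ∈ T.Ing, ∀ Γ φ, D S Γ φ → SemCons M T S Γ φ

/-- `D`-maximal sets: negation complete and consistent. -/
structure IsMaximal (D : Entailment M T) (S : PF K) (x : Set (Form M T S)) : Prop where
  negComplete : ∀ φ, φ ∈ x ↔ neg φ ∉ x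
  consistent : ¬ D S x (bot S)

/-- A system is Lindenbaum if every consistent set of formulas is included in a maximal one. -/
def IsLindenbaum (D : Entailment M T) : Prop :=
  ∀ S ∈ T.Ing, ∀ Γ, ¬ D S Γ (bot S) → ∃ x, Γ ⊆ x ∧ IsMaximal D S x

/-! ### Canonical spaces -/

/-- Maximal sets are closed under deduction. -/
theorem IsMaximal.closed {D : Entailment M T} (hD : IsDeductionSystem M T D) (hS : S ∈ T.Ing)
    {x : Set (Form M T S)} (hx : IsMaximal D S x) {φ : Form M T S} (h : D S x φ) : φ ∈ x := by
  rw [hx.negComplete]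
  intro hn
  refine hx.consistent (hD.cut S hS x {φ, imp φ (bot S)} _ ?_ (hD.modusPonens S hS φ (bot S)))
  rintro ψ (rfl | rfl)
  · exact h
  · exact hD.assumption S hS _ _ (Or.inl hn)

theorem IsMaximal.mem_imp {D : Entailment M T} (hD : IsDeductionSystem M T D) (hS : S ∈ T.Ing)
    {x : Set (Form M T S)} (hx : IsMaximal D S x) (φ ψ : Form M T S) :
    imp φ ψ ∈ x ↔ (φ ∈ x → ψ ∈ x) := by
  have mp : ∀ α β : Form M T S, imp α β ∈ x → α ∈ x → β ∈ x := fun α β h1 h2 => by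
    refine hx.closed hD hS (hD.cut S hS x {α, imp α β} _ ?_ (hD.modusPonens S hS α β))
    rintro χ (rfl | rfl)
    · exact hD.assumption S hS _ _ (Or.inl h2)
    · exact hD.assumption S hS _ _ (Or.inl h1)
  have ax : ∀ α : Form M T S, IsTaut α → α ∈ x := fun α h =>
    hx.closed hD hS (hD.assumption S hS _ _ (Or.inr (Ax.taut _ α h)))
  refine ⟨mp φ ψ, fun h => ?_⟩
  by_cases hφ : φ ∈ x
  · refine mp ψ _ (ax _ fun v _ hv => ?_) (h hφ)
    simp only [hv]; tauto
  · have hn : neg φ ∈ x := by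
      by_contra hc
      exact hφ ((hx.negComplete φ).2 hc)
    refine mp (neg φ) _ (ax _ fun v h0 hv => ?_) hn
    simp only [neg, hv]; tauto

theorem IsMaximal.bot_notMem {D : Entailment M T} (hD : IsDeductionSystem M T D)
    (hS : S ∈ T.Ing) {x : Set (Form M T S)} (hx : IsMaximal D S x) : bot S ∉ x := fun h =>
  hx.consistent (hD.assumption S hS _ _ (Or.inl h))

/-- The set of maximal sets of sort `S`. -/
def MaxSet (D : Entailment M T) (S : PF K) : Type u := {x : Set (Form M T S) // IsMaximal D S x}

/-- The maximal sets that contain a given formula. -/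
def sat (D : Entailment M T) {S : PF K} (φ : Form M T S) : Set (MaxSet D S) := {x | φ ∈ x.1}

/-- The space of maximal sets of sort `S`; its measurable sets are the `sat D φ` for `φ`
a measurable formula. -/
def maxSpace {D : Entailment M T} (hD : IsDeductionSystem M T D) {S : PF K} (hS : S ∈ T.Ing) :
    Unc.{u} where
  carrier := MaxSet D S
  alg :=
    have him : ∀ φ ψ : MForm M T S,
        sat D (imp φ ψ).toForm = (sat D φ.toForm)ᶜ ∪ sat D ψ.toForm := fun φ ψ => by
      ext x
      simp only [sat, toForm, Set.mem_ofPred_eq, x.2.mem_imp hD hS, Set.mem_union,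
        Set.mem_compl_iff]
      tauto
    have hbot : sat D (bot (M := M) (T := T) (b := true) S).toForm = ∅ := by
      ext x
      simpa [sat, toForm] using x.2.bot_notMem hD hS
    have hneg : ∀ φ : MForm M T S, sat D (neg φ).toForm = (sat D φ.toForm)ᶜ := fun φ => by
      rw [neg, him, hbot, Set.union_empty]
    { carrier := {B | ∃ φ : MForm M T S, B = sat D φ.toForm}
      supClosed' := by
        rintro _ ⟨φ, rfl⟩ _ ⟨ψ, rfl⟩
        refine ⟨Fml.or φ ψ, ?_⟩
        rw [Fml.or, him, hneg, compl_compl]; rfl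
      infClosed' := by
        rintro _ ⟨φ, rfl⟩ _ ⟨ψ, rfl⟩
        refine ⟨Fml.and φ ψ, ?_⟩
        simp only [Fml.and, Fml.or, him, hneg, Set.compl_union, compl_compl]; rfl
      compl_mem' := by
        rintro _ ⟨φ, rfl⟩
        exact ⟨neg φ, (hneg φ).symm⟩
      bot_mem' := ⟨bot S, hbot.symm⟩ }

/-- The canonical coalgebra on the space of maximal sets of sort `Id`, together with the measurable
maps `r_S : X_S → S(X_Id)`, for the ingredients `S` of `T`, through which it is defined. -/
@[ext]
structure Canonical {D : Entailment M T} (hD : IsDeductionSystem M T D) where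
  /-- The map `r_S` from the space of maximal sets of sort `S` to `S(X_Id)`. -/
  r : ∀ (S : PF K) (hS : S ∈ T.Ing),
    maxSpace hD hS ⟶ (S.functor M).obj (maxSpace hD T.id_mem)
  /-- The structure map of the canonical coalgebra. -/
  str : maxSpace hD T.id_mem ⟶ (T.functor M).obj (maxSpace hD T.id_mem)
  r_id : ∀ x, (r .id T.id_mem).toFun x = x
  /-- `r_M x` is the point `c` of the constant space with `{c} ∈ x`. -/
  r_const : ∀ k hk x, single k ((r (.const k) hk).toFun x) ∈ x.1
  r_prod : ∀ S₁ S₂ (h : .prod S₁ S₂ ∈ T.Ing) (x : maxSpace hD h),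
    ∃ (y₁ : maxSpace hD (PF.prod_left h)) (y₂ : maxSpace hD (PF.prod_right h)),
      y₁.1 = pr₁ ⁻¹' x.1 ∧ y₂.1 = pr₂ ⁻¹' x.1 ∧
      (r (.prod S₁ S₂) h).toFun x =
        ((r S₁ (PF.prod_left h)).toFun y₁, (r S₂ (PF.prod_right h)).toFun y₂)
  r_sum : ∀ S₁ S₂ (h : .sum S₁ S₂ ∈ T.Ing) (x : maxSpace hD h),
    (neg (in₁ (bot S₁)) ∈ x.1 ∧ ∃ y : maxSpace hD (PF.sum_left h), y.1 = in₁ ⁻¹' x.1 ∧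
      (r (.sum S₁ S₂) h).toFun x = Sum.inl ((r S₁ (PF.sum_left h)).toFun y)) ∨
    (neg (in₂ (bot S₂)) ∈ x.1 ∧ ∃ y : maxSpace hD (PF.sum_right h), y.1 = in₂ ⁻¹' x.1 ∧
      (r (.sum S₁ S₂) h).toFun x = Sum.inr ((r S₂ (PF.sum_right h)).toFun y))
  /-- `r x` is the push-forward along `r_S` of the measure on `X_S` that sends `sat D φ` to the
  supremum of the `q` for which "the measure of `φ` is at least `q`" belongs to `x`. -/
  r_cap : ∀ κ S (h : .cap κ S ∈ T.Ing) (x : maxSpace hD h)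
    (U : ((S.functor M).obj (maxSpace hD T.id_mem)).alg) (φ : MForm M T S),
    (r S (PF.cap_arg h)).toFun ⁻¹' U.1 = sat D φ.toForm →
    IsLUB {t : ℝ | ∃ q : I, uGe κ q φ ∈ x.1 ∧ t = q} (((r (.cap κ S) h).toFun x).1 U)
  /-- The same for probability measures. -/
  r_prob : ∀ S (h : .prob S ∈ T.Ing) (x : maxSpace hD h)
    (U : ((S.functor M).obj (maxSpace hD T.id_mem)).alg) (φ : MForm M T S),
    (r S (PF.prob_arg h)).toFun ⁻¹' U.1 = sat D φ.toForm →
    IsLUB {t : ℝ | ∃ q : I, pGe q φ ∈ x.1 ∧ t = q} (((r (.prob S) h).toFun x).1 U)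
  str_eq : ∀ x : maxSpace hD T.id_mem, ∃ y : maxSpace hD T.self_mem, y.1 = next ⁻¹' x.1 ∧
    str.toFun x = (r T T.self_mem).toFun y

/-- The canonical coalgebra as a `T`-coalgebra. -/
def Canonical.coalg {D : Entailment M T} {hD : IsDeductionSystem M T D} (C : Canonical hD) :
    Coalg M T := ⟨maxSpace hD T.id_mem, C.str⟩

end UncLogic

end

open UncLogic

/-! Everything rests on the truth lemma `Canonical.truth`: the point r_S(x) of the canonical
coalgebra satisfies φ exactly when φ ∈ x. By the Lindenbaum property, a formula not derivable from Γ
is missing from some maximal set that includes Γ (`IsLindenbaum.derivable`), so validity in the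
canonical coalgebra implies derivability. Conversely, if D is valid in a coalgebra, the formulas
true at a point form a maximal set, and sending points to their theories is a coalgebra morphism
(`map_theoryMap`, `theoryHom`). It is the only one: morphisms preserve truth (`interp_hom`), and by
the truth lemma a point x of the canonical coalgebra has theory x.

The maps r_S are defined by recursion on S. Definite modalities pull maximal sets back to maximal
sets, and the constant rule supplies points of constant spaces. For a functor of measures, the
axioms comparing bounds and the Archimedean rules make {q : U_{≥q} φ ∈ x} a closed initial segment
of [0,1]; its supremum is the value of φ. Necessitation and the monotonicity axiom show that this
value depends only on the set |φ|, so x gives a function on the measurable sets.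

The main difficulty is that this function is a measure of the right kind. For plausibilities and
possibilities, the axioms with the values themselves as bounds are the defining inequalities. For Δ*
and Δ, the cover rules yield the cover inequalities (`CoverIneq`). If moreover g(Uᶜ) = 1 - g(U),
these force additivity. In general, a normalized g satisfying them is an upper envelope: for each V,
the Riesz extension theorem gives a positive functional on combinations of indicators that is
bounded by g and equals g(V) at V. Its positivity condition is the real form of the cover
inequalities (`CoverIneq.real`), obtained from the integer form by scaling and rounding.

Soundness of the cover rules is double counting: a probability measure integrates the number of sets
to which a point belongs, and the inequality passes to suprema. -/

noncomputable section

namespace UncLogic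

open Fml

/-! ### Boolean reasoning about formulas and their interpretation as measurable sets -/

section Formulas

variable {K : Type u} {M : K → Unc.{u}} {T : PF K} {b : Bool} {S : PF K}

/-! ### Boolean valuations of formulas -/

/-- Truth assignments that respect `⊥` and `→`. -/
structure IsVal (v : Fml M T b S → Prop) : Prop where
  bot : ¬ v (Fml.bot S)
  imp : ∀ φ ψ, v (Fml.imp φ ψ) ↔ (v φ → v ψ)

namespace IsVal

variable {v : Fml M T b S → Prop} (hv : IsVal v)
include hv

theorem neg (φ : Fml M T b S) : v (Fml.neg φ) ↔ ¬ v φ := by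
  simp [Fml.neg, hv.imp, hv.bot]

theorem top : v (Fml.top M T b S) := by
  simp [Fml.top, hv.neg, hv.bot]

theorem or (φ ψ : Fml M T b S) : v (Fml.or φ ψ) ↔ v φ ∨ v ψ := by
  rw [Fml.or, hv.imp, hv.neg]; tauto

theorem and (φ ψ : Fml M T b S) : v (Fml.and φ ψ) ↔ v φ ∧ v ψ := by
  rw [Fml.and, hv.neg, hv.or, hv.neg, hv.neg]; tauto

theorem iff (φ ψ : Fml M T b S) : v (Fml.iff φ ψ) ↔ (v φ ↔ v ψ) := by
  rw [Fml.iff, hv.and, hv.imp, hv.imp]; tauto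

theorem bigOr {ι : Type*} (s : Finset ι) (φ : ι → Fml M T b S) :
    v (Fml.bigOr s φ) ↔ ∃ i ∈ s, v (φ i) := by
  have key : ∀ l : List ι, v ((l.map φ).foldr Fml.or (Fml.bot S)) ↔ ∃ i ∈ l, v (φ i) := by
    intro l
    induction l with
    | nil => simp [hv.bot]
    | cons i l ih => simp [hv.or, ih]
  simp [Fml.bigOr, key]

theorem bigAnd {ι : Type*} (s : Finset ι) (φ : ι → Fml M T b S) :
    v (Fml.bigAnd s φ) ↔ ∀ i ∈ s, v (φ i) := by
  have key : ∀ l : List ι, v ((l.map φ).foldr Fml.and (Fml.top M T b S)) ↔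
      ∀ i ∈ l, v (φ i) := by
    intro l
    induction l with
    | nil => simp [hv.top]
    | cons i l ih => simp [hv.and, ih]
  simp [Fml.bigAnd, key]

-- This turns the syntactic disjunction over index sets into a count, the form in which the cover
-- rules are compared with `CoverIneq`.
open Classical in
theorem atLeast {m : ℕ} (k : ℕ) (φ : Fin m → Fml M T b S) :
    v (Fml.atLeast k φ) ↔ k ≤ (Finset.univ.filter fun i => v (φ i)).card := by
  rw [Fml.atLeast, hv.bigOr]
  constructor
  · rintro ⟨J, hJ, h⟩
    rw [← (Finset.mem_powersetCard.1 hJ).2]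
    refine Finset.card_le_card fun i hi => ?_
    simpa using (hv.bigAnd J φ).1 h i hi
  · intro h
    obtain ⟨J, hJ, hc⟩ := Finset.exists_subset_card_eq h
    refine ⟨J, Finset.mem_powersetCard.2 ⟨Finset.subset_univ _, hc⟩,
      (hv.bigAnd J φ).2 fun i hi => ?_⟩
    simpa using hJ hi

end IsVal

/-! ### Interpretation -/

theorem toForm_eq_self : ∀ {S : PF K} (φ : Fml M T false S), φ.toForm = φ
  | _, .bot _ => rfl
  | _, .imp φ ψ => by rw [toForm, toForm_eq_self φ, toForm_eq_self ψ]
  | _, .atom _ _ _ => rfl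
  | _, .pr₁ φ => by rw [toForm, toForm_eq_self φ]
  | _, .pr₂ φ => by rw [toForm, toForm_eq_self φ]
  | _, .in₁ φ => by rw [toForm, toForm_eq_self φ]
  | _, .in₂ φ => by rw [toForm, toForm_eq_self φ]
  | _, .next φ => by rw [toForm, toForm_eq_self φ]
  | _, .box _ _ _ _ => rfl
  | _, .ge _ _ => rfl

theorem interp_toForm (A : Coalg M T) (φ : Fml M T b S) : interp A φ.toForm = interp A φ := by
  induction φ with
  | bot => rfl
  | imp φ ψ h1 h2 => simp only [toForm, interp, h1, h2]
  | @atom b => cases b <;> rfl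
  | pr₁ φ h => simp only [toForm, interp, h]
  | pr₂ φ h => simp only [toForm, interp, h]
  | in₁ φ h => simp only [toForm, interp, h]
  | in₂ φ h => simp only [toForm, interp, h]
  | next φ h => simp only [toForm, interp, h]
  | box => rfl
  | ge => rfl

/-- Satisfaction at a point respects ⊥ and →. Hence the facts about derived connectives proved for
`IsVal` serve both for truth at a point and for membership in a maximal set. -/
theorem isVal_interp (A : Coalg M T) (x : (S.functor M).obj A.V) :
    IsVal fun φ : Fml M T b S => x ∈ interp A φ where
  bot := by simp [interp]
  imp φ ψ := by
    simp only [interp, Set.mem_union, Set.mem_compl_iff]; tauto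

theorem interp_neg (A : Coalg M T) (φ : Fml M T b S) : interp A (neg φ) = (interp A φ)ᶜ :=
  Set.ext fun x => (isVal_interp A x).neg φ

/-- The interpretations of measurable formulas are measurable. -/
theorem interp_mem_alg (A : Coalg M T) (φ : MForm M T S) :
    interp A φ ∈ ((S.functor M).obj A.V).alg := by
  -- Induction needs a variable index `b`, so `b = true` becomes a hypothesis. For the argument of a
  -- modality for uncertainty it holds by `rfl`.
  suffices h : ∀ {b : Bool} {S : PF K} (φ : Fml M T b S), b = true →
      interp A φ ∈ ((S.functor M).obj A.V).alg from h φ rfl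
  intro b S φ
  induction φ with
  | bot => intro _; exact BooleanSubalgebra.bot_mem
  | imp φ ψ h1 h2 =>
    intro hb
    exact BooleanSubalgebra.sup_mem (BooleanSubalgebra.compl_mem (h1 hb)) (h2 hb)
  | atom k B h => intro hb; exact h.resolve_right (by simp [hb])
  | @pr₁ b S₁ S₂ φ h =>
    intro hb
    refine BooleanSubalgebra.subset_closure ⟨_, h hb, Set.univ, BooleanSubalgebra.top_mem, ?_⟩
    rw [Set.prod_univ]; rfl
  | @pr₂ b S₁ S₂ φ h =>
    intro hb
    refine BooleanSubalgebra.subset_closure ⟨Set.univ, BooleanSubalgebra.top_mem, _, h hb, ?_⟩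
    rw [Set.univ_prod]; rfl
  | @in₁ b S₁ S₂ φ h =>
    intro hb
    refine BooleanSubalgebra.sup_mem (BooleanSubalgebra.subset_closure (Or.inl ⟨_, h hb, rfl⟩))
      (BooleanSubalgebra.subset_closure (Or.inr ⟨Set.univ, BooleanSubalgebra.top_mem, ?_⟩))
    rw [Set.image_univ]; rfl
  | @in₂ b S₁ S₂ φ h =>
    intro hb
    refine BooleanSubalgebra.sup_mem
      (BooleanSubalgebra.subset_closure (Or.inl ⟨Set.univ, BooleanSubalgebra.top_mem, ?_⟩))
      (BooleanSubalgebra.subset_closure (Or.inr ⟨_, h hb, rfl⟩))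
    rw [Set.image_univ]; rfl
  | next φ h => intro hb; exact A.str.meas _ (h hb)
  | box κ p q φ h =>
    intro _
    exact BooleanSubalgebra.subset_closure ⟨p, q, _, h rfl, rfl⟩
  | ge p φ h =>
    intro _
    exact BooleanSubalgebra.subset_closure ⟨p, _, h rfl, rfl⟩

/-- The measurable set that interprets a measurable formula. -/
def event (A : Coalg M T) (φ : MForm M T S) : ((S.functor M).obj A.V).alg :=
  ⟨interp A φ, interp_mem_alg A φ⟩

theorem mem_event {A : Coalg M T} {φ : MForm M T S} {x : (S.functor M).obj A.V} :
    x ∈ (event A φ).1 ↔ x ∈ interp A φ := Iff.rfl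

theorem event_neg (A : Coalg M T) (φ : MForm M T S) : event A (neg φ) = (event A φ)ᶜ :=
  Subtype.ext (interp_neg A φ)

theorem event_or (A : Coalg M T) (φ ψ : MForm M T S) :
    event A (or φ ψ) = event A φ ⊔ event A ψ :=
  Subtype.ext <| Set.ext fun x => (isVal_interp A x).or φ ψ

theorem event_bot (A : Coalg M T) : event A (bot (M := M) (T := T) (b := true) S) = ⊥ := rfl

theorem coe_finset_sup {X : Unc.{u}} {ι : Type*} (s : Finset ι) (U : ι → X.alg) :
    ((s.sup U : X.alg) : Set X) = ⋃ i ∈ s, (U i : Set X) := by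
  classical
  induction s using Finset.induction_on with
  | empty => simp
  | insert i s _ ih => simp [Finset.sup_insert, ih]

theorem coe_finset_inf {X : Unc.{u}} {ι : Type*} (s : Finset ι) (U : ι → X.alg) :
    ((s.inf U : X.alg) : Set X) = ⋂ i ∈ s, (U i : Set X) := by
  classical
  induction s using Finset.induction_on with
  | empty => simp
  | insert i s _ ih => simp [Finset.inf_insert, ih]

theorem event_bigOr (A : Coalg M T) {ι : Type*} (s : Finset ι) (φ : ι → MForm M T S) :
    event A (bigOr s φ) = s.sup fun i => event A (φ i) := by
  refine Subtype.ext <| Set.ext fun x => ?_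
  rw [mem_event, (isVal_interp A x).bigOr, coe_finset_sup]
  simp [event]

theorem event_bigAnd (A : Coalg M T) {ι : Type*} (s : Finset ι) (φ : ι → MForm M T S) :
    event A (bigAnd s φ) = s.inf fun i => event A (φ i) := by
  refine Subtype.ext <| Set.ext fun x => ?_
  rw [mem_event, (isVal_interp A x).bigAnd, coe_finset_inf]
  simp [event]

/-- The values of a measure that is a point of `Δ' S` applied to a space. -/
def capVal {κ : Kind} {Y : Unc.{u}} (g : ((PF.cap κ S).functor M).obj Y) :
    ((S.functor M).obj Y).alg → ℝ := fun U => Subtype.val g U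

theorem isMeas_capVal {κ : Kind} {Y : Unc.{u}} (g : ((PF.cap κ S).functor M).obj Y) :
    κ.IsMeas ((S.functor M).obj Y) (capVal g) := Subtype.property g

/-- The values of a probability measure that is a point of `Δ S` applied to a space. -/
def prbVal {Y : Unc.{u}} (μ : ((PF.prob S).functor M).obj Y) :
    ((S.functor M).obj Y).alg → ℝ := fun U => Subtype.val μ U

theorem isProb_prbVal {Y : Unc.{u}} (μ : ((PF.prob S).functor M).obj Y) :
    IsProb ((S.functor M).obj Y) (prbVal μ) := Subtype.property μ

/-- The measurability demanded in `betaCap` is automatic here, because the argument of the modality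
is a measurable formula. -/
theorem mem_interp_box {A : Coalg M T} {κ : Kind} {p q : I} {φ : MForm M T S}
    {g : ((PF.cap κ S).functor M).obj A.V} :
    g ∈ interp A (box (b := b) κ p q φ) ↔
      (p : ℝ) ≤ capVal g (event A φ) ∧ (q : ℝ) ≤ 1 - capVal g (event A φ)ᶜ :=
  ⟨fun ⟨_, h⟩ => h, fun h => ⟨interp_mem_alg A φ, h⟩⟩

theorem mem_interp_ge {A : Coalg M T} {p : I} {φ : MForm M T S}
    {μ : ((PF.prob S).functor M).obj A.V} :
    μ ∈ interp A (ge (b := b) p φ) ↔ (p : ℝ) ≤ prbVal μ (event A φ) :=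
  ⟨fun ⟨_, h⟩ => h, fun h => ⟨interp_mem_alg A φ, h⟩⟩

end Formulas

/-! ### Finitely additive probabilities, cover inequalities and upper envelopes -/

section MeasureTheory

variable {X : Unc.{u}}

/-! ### Finitely additive probability measures -/

namespace IsProb

variable {μ : X.alg → ℝ} (h : IsProb X μ)
include h

theorem inf_add_inf_compl (U V : X.alg) : μ (U ⊓ V) + μ (U ⊓ Vᶜ) = μ U := by
  rw [← h.add _ _ ((disjoint_compl_right (a := V)).mono inf_le_right inf_le_right),
    ← inf_sup_left, sup_compl_eq_top, inf_top_eq]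

theorem compl (U : X.alg) : μ Uᶜ = 1 - μ U := by
  have := h.inf_add_inf_compl ⊤ U
  rw [top_inf_eq, top_inf_eq, h.univ] at this
  linarith

theorem mono {U V : X.alg} (hUV : U ≤ V) : μ U ≤ μ V := by
  have := h.inf_add_inf_compl V U
  rw [inf_eq_right.2 hUV] at this
  linarith [h.nonneg (V ⊓ Uᶜ)]

theorem sup_le (U V : X.alg) : μ (U ⊔ V) ≤ μ U + μ V := by
  have h1 := h.inf_add_inf_compl (U ⊔ V) U
  rw [inf_eq_right.2 le_sup_left] at h1
  have h2 : μ ((U ⊔ V) ⊓ Uᶜ) ≤ μ V := h.mono <| by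
    rw [inf_sup_right, inf_compl_eq_bot, bot_sup_eq]; exact inf_le_left
  linarith

open Classical in
/-- If each point of `W` lies in at least `d` of the sets `U i`, then the measures of the sets
`U i ⊓ W` add up to at least `d` times the measure of `W`. -/
theorem mul_le_sum {ι : Type*} (s : Finset ι) (U : ι → X.alg) : ∀ (d : ℝ) (W : X.alg),
    (∀ x ∈ W.1, d ≤ ((s.filter fun i => x ∈ (U i).1).card : ℝ)) →
      d * μ W ≤ ∑ i ∈ s, μ (U i ⊓ W) := by
  induction s using Finset.induction_on with
  | empty =>
    intro d W hd
    -- No sets remain, so a point of `W` forces d ≤ 0.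
    rcases eq_or_ne W ⊥ with rfl | hW
    · simp [h.empty]
    · have hne : W.1.Nonempty := by
        rw [Set.nonempty_iff_ne_empty]
        exact fun h0 => hW (Subtype.ext h0)
      obtain ⟨x, hx⟩ := hne
      have := hd x hx
      simp only [Finset.filter_empty, Finset.card_empty, Nat.cast_zero] at this
      simpa using mul_nonpos_of_nonpos_of_nonneg this (h.nonneg W)
  | insert j s hj ih =>
    intro d W hd
    rw [Finset.sum_insert hj]
    -- `W` is split along `U j`: inside `U j` one of the d memberships is used up, outside it all d
    -- must come from the remaining sets. This is why d and `W` vary in the induction; d is real so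
    -- that it may become negative.
    have h1 := ih (d - 1) (W ⊓ U j) fun x hx => by
      have := hd x hx.1
      rw [Finset.filter_insert, if_pos hx.2, Finset.card_insert_of_notMem (by simp [hj])] at this
      push_cast at this
      linarith
    have h2 := ih d (W ⊓ (U j)ᶜ) fun x hx => by
      have := hd x hx.1
      rwa [Finset.filter_insert, if_neg hx.2] at this
    have h3 : ∑ i ∈ s, μ (U i ⊓ (W ⊓ U j)) + ∑ i ∈ s, μ (U i ⊓ (W ⊓ (U j)ᶜ)) =
        ∑ i ∈ s, μ (U i ⊓ W) := by
      rw [← Finset.sum_add_distrib]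
      refine Finset.sum_congr rfl fun i _ => ?_
      rw [← inf_assoc, ← inf_assoc, h.inf_add_inf_compl]
    rw [← h3, inf_comm (U j) W]
    have h4 := h.inf_add_inf_compl W (U j)
    rw [← h4]
    linarith

end IsProb

/-! ### Cover inequalities -/

open Classical in
/-- If every point lies in at least `k`, and every point of `U` in at least `n + k`, of finitely
many sets, then `n` times the value at `U`, plus `k`, is at most the sum of their values. -/
def CoverIneq (X : Unc.{u}) (g : X.alg → ℝ) : Prop :=
  ∀ (m n k : ℕ) (U : X.alg) (V : Fin m → X.alg),
    (∀ x, k ≤ (Finset.univ.filter fun i => x ∈ (V i).1).card) →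
    (∀ x ∈ U.1, n + k ≤ (Finset.univ.filter fun i => x ∈ (V i).1).card) →
    n * g U + k ≤ ∑ i, g (V i)

/-- Count separately on U, with multiplicity n + k, and on its complement, with multiplicity k, and
add: (n + k) μ(U) + k (1 - μ(U)) = n μ(U) + k. -/
theorem IsProb.coverIneq {μ : X.alg → ℝ} (h : IsProb X μ) : CoverIneq X μ := by
  intro m n k U V hk hn
  have h1 := h.mul_le_sum Finset.univ V (n + k) U fun x hx => by exact_mod_cast hn x hx
  have h2 := h.mul_le_sum Finset.univ V k Uᶜ fun x _ => by exact_mod_cast hk x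
  have h3 : ∑ i, μ (V i ⊓ U) + ∑ i, μ (V i ⊓ Uᶜ) = ∑ i, μ (V i) := by
    rw [← Finset.sum_add_distrib]
    exact Finset.sum_congr rfl fun i _ => h.inf_add_inf_compl _ _
  rw [h.compl] at h2
  linarith

/-- The inequality holds for each member of the family with g on the right-hand side, and the
supremum can then be taken on the left. For n = 0 there is no supremum to take; nonemptiness of the
family suffices. -/
theorem IsUpper.coverIneq {g : X.alg → ℝ} (h : IsUpper X g) : CoverIneq X g := by
  obtain ⟨P, ⟨μ₀, hμ₀⟩, hP, hg⟩ := h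
  intro m n k U V hk hn
  have hle : ∀ μ ∈ P, n * μ U + k ≤ ∑ i, g (V i) := fun μ hμ =>
    ((hP μ hμ).coverIneq m n k U V hk hn).trans
      (Finset.sum_le_sum fun i _ => (hg (V i)).1 ⟨μ, hμ, rfl⟩)
  rcases Nat.eq_zero_or_pos n with rfl | hn0
  · simpa using hle μ₀ hμ₀
  · have hn' : (0 : ℝ) < n := by exact_mod_cast hn0
    have : g U ≤ (∑ i, g (V i) - k) / n := by
      refine (hg U).2 ?_
      rintro _ ⟨μ, hμ, rfl⟩
      change μ U ≤ _
      rw [le_div_iff₀ hn']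
      linarith [hle μ hμ]
    rw [le_div_iff₀ hn'] at this
    linarith

open Classical in
/-- Functions with cover inequalities that are additive under complements are additive. -/
theorem CoverIneq.isProb {μ : X.alg → ℝ} (h : CoverIneq X μ) (h0 : ∀ U, 0 ≤ μ U)
    (hc : ∀ U, μ Uᶜ = 1 - μ U) : IsProb X μ := by
  have hb : μ ⊥ = 0 := by
    -- The empty family covers ⊥ as often as desired.
    have := h 0 1 0 ⊥ Fin.elim0 (by simp) (fun x hx => hx.elim)
    simp only [Nat.cast_one, one_mul, Nat.cast_zero, add_zero, Finset.univ_eq_empty,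
      Finset.sum_empty] at this
    exact le_antisymm this (h0 _)
  refine ⟨h0, fun U => by linarith [h0 Uᶜ, hc U], hb, ?_, fun U V hUV => le_antisymm ?_ ?_⟩
  · rw [← compl_bot, hc, hb, sub_zero]
  -- Subadditivity: U and V together cover their union once.
  · have := h 2 1 0 (U ⊔ V) ![U, V] (by simp) fun x hx => by
      rw [Nat.add_zero, Nat.succ_le_iff, Finset.card_pos]
      rcases hx with hx | hx
      · exact ⟨0, by simpa using hx⟩
      · exact ⟨1, by simpa using hx⟩
    simpa using this
  -- Superadditivity: U ⊔ V and Vᶜ cover everything once and, by disjointness, U twice, so μ(U) + 1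
  -- ≤ μ(U ⊔ V) + 1 - μ(V).
  · have := h 2 1 1 U ![U ⊔ V, Vᶜ] (fun x => by
        rw [Nat.succ_le_iff, Finset.card_pos]
        by_cases hx : x ∈ V.1
        · exact ⟨0, (Finset.mem_filter_univ _).2 (Or.inr hx)⟩
        · exact ⟨1, (Finset.mem_filter_univ _).2 hx⟩) fun x hx => by
      have hxV : x ∉ V.1 := fun hV => by
        have h2 : (U ⊓ V : X.alg) = ⊥ := hUV.eq_bot
        have h3 : x ∈ (U ⊓ V : X.alg).1 := ⟨hx, hV⟩
        rw [h2] at h3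
        exact h3
      rw [Finset.filter_true_of_mem]
      · simp
      · intro i _
        fin_cases i
        · exact Or.inl hx
        · exact hxV
    simp only [Nat.cast_one, one_mul, Fin.sum_univ_two, Matrix.cons_val_zero,
      Matrix.cons_val_one, hc V] at this
    linarith

/-- The indicator function of a measurable set. -/
def ind (U : X.alg) (x : X) : ℝ := Set.indicator U.1 1 x

open Classical in
theorem ind_eq (U : X.alg) (x : X) : ind U x = if x ∈ U.1 then 1 else 0 := by
  simp [ind, Set.indicator_apply]

theorem ind_nonneg (U : X.alg) (x : X) : 0 ≤ ind U x := by
  classical rw [ind_eq]; split_ifs <;> norm_num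

theorem ind_le_one (U : X.alg) (x : X) : ind U x ≤ 1 := by
  classical rw [ind_eq]; split_ifs <;> norm_num

/-- Natural weights are multiplicities: repeat each V i exactly w i times, indexing the copies by a
sigma type. The pointwise hypothesis then counts memberships. -/
theorem CoverIneq.weighted {g : X.alg → ℝ} (hg : CoverIneq X g) {ι : Type*} (s : Finset ι)
    (w : ι → ℕ) (V : ι → X.alg) (n k : ℕ) (U : X.alg)
    (hp : ∀ x, n * ind U x + k ≤ ∑ i ∈ s, w i * ind (V i) x) :
    n * g U + k ≤ ∑ i ∈ s, w i * g (V i) := by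
  classical
  let J := Σ i : s, Fin (w i)
  let e : Fin (Fintype.card J) ≃ J := (Fintype.equivFin J).symm
  have hsum : ∀ f : X.alg → ℝ, ∑ j, f (V (e j).1) = ∑ i ∈ s, w i * f (V i) := fun f => by
    rw [e.sum_comp (fun j : J => f (V j.1)), Fintype.sum_sigma,
      ← Finset.sum_coe_sort s (fun i => (w i : ℝ) * f (V i))]
    simp
  have hcard : ∀ x, ((Finset.univ.filter fun j => x ∈ (V (e j).1).1).card : ℝ) =
      ∑ i ∈ s, w i * ind (V i) x := fun x => by
    rw [← hsum fun W => ind W x, Finset.card_filter]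
    push_cast
    simp only [ind_eq]
  rw [← hsum g]
  refine hg _ n k U (fun j => V (e j).1) (fun x => ?_) fun x hx => ?_
  · have := hp x
    rw [← hcard] at this
    have h2 : (0 : ℝ) ≤ n * ind U x := mul_nonneg n.cast_nonneg (ind_nonneg U x)
    exact_mod_cast (by linarith : (k : ℝ) ≤
      ((Finset.univ.filter fun j => x ∈ (V (e j).1).1).card : ℝ))
  · have := hp x
    rw [← hcard, ind_eq, if_pos hx, mul_one] at this
    exact_mod_cast this

/-- The cover inequalities with real coefficients. -/
theorem CoverIneq.real {g : X.alg → ℝ} (hg : CoverIneq X g) (h1 : g ⊤ = 1)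
    (s : Finset X.alg) (h : X.alg → ℝ) (hh : ∀ U, 0 ≤ h U) (c : ℝ) (hc : 0 ≤ c) (V : X.alg) (t : ℝ)
    (hp : ∀ x, ∑ U ∈ s, h U * (g U - ind U x) + c * (ind V x - g V) ≤ t) : 0 ≤ t := by
  have g0 : ∀ U, 0 ≤ g U := fun U => by
    simpa using hg 1 0 0 ⊥ (fun _ => U) (by simp) (by simp)
  have g1 : ∀ U, g U ≤ 1 := fun U => by
    simpa [h1] using hg 1 1 0 U (fun _ => ⊤) (by simp) (by simp)
  by_contra! ht
  -- If t < 0, scaling by a large N makes the slack -N t exceed the total rounding error, which is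
  -- at most `s.card + 2`.
  obtain ⟨N, hN⟩ := exists_nat_gt ((s.card + 2) / (-t))
  rw [div_lt_iff₀ (by linarith)] at hN
  -- The scaled hypothesis reads N c 1_V + a ≤ N ∑ h U 1_U. As a may be negative, e copies of the
  -- whole space are added to both sides to obtain a nonnegative constant. Coefficients on the
  -- larger side are rounded up, those on the smaller side down.
  set a : ℝ := N * (∑ U ∈ s, h U * g U - c * g V - t) with ha
  obtain ⟨e, he⟩ := exists_nat_ge (-a)
  have hNc : 0 ≤ N * c := mul_nonneg N.cast_nonneg hc
  have key := hg.weighted (Finset.insertNone s)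
    (fun o => o.elim e fun U => ⌈N * h U⌉₊) (fun o => o.elim ⊤ fun U => U)
    ⌊N * c⌋₊ ⌊a + e⌋₊ V fun x => by
      rw [Finset.sum_insertNone]
      simp only [Option.elim_none, Option.elim_some]
      have e1 : ind (⊤ : X.alg) x = 1 := by classical rw [ind_eq]; simp
      have e2 : (⌊N * c⌋₊ : ℝ) * ind V x ≤ N * c * ind V x :=
        mul_le_mul_of_nonneg_right (Nat.floor_le hNc) (ind_nonneg V x)
      have e3 : (⌊a + e⌋₊ : ℝ) ≤ a + e := Nat.floor_le (by linarith)
      have e4 : ∑ U ∈ s, N * (h U * ind U x) ≤ ∑ U ∈ s, (⌈N * h U⌉₊ : ℝ) * ind U x :=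
        Finset.sum_le_sum fun U _ => by
          rw [← mul_assoc]
          exact mul_le_mul_of_nonneg_right (Nat.le_ceil _) (ind_nonneg U x)
      have e5 := mul_le_mul_of_nonneg_left (hp x) (N.cast_nonneg (α := ℝ))
      simp only [mul_sub, Finset.sum_sub_distrib] at e5
      rw [← Finset.mul_sum] at e4
      rw [e1]
      have e6 : N * c * ind V x + a ≤ N * ∑ U ∈ s, h U * ind U x := by
        rw [ha]; linarith
      linarith
  rw [Finset.sum_insertNone] at key
  simp only [Option.elim_none, Option.elim_some, h1] at key
  -- Each rounded-up coefficient costs at most 1, since 0 ≤ g ≤ 1. The two floors account for the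
  -- other 2.
  have k1 : ∑ U ∈ s, (⌈N * h U⌉₊ : ℝ) * g U ≤ ∑ U ∈ s, (N * (h U * g U) + 1) :=
    Finset.sum_le_sum fun U _ => by
      have := Nat.ceil_lt_add_one (mul_nonneg N.cast_nonneg (hh U) : 0 ≤ (N : ℝ) * h U)
      calc (⌈N * h U⌉₊ : ℝ) * g U ≤ (N * h U + 1) * g U :=
            mul_le_mul_of_nonneg_right this.le (g0 U)
        _ ≤ N * (h U * g U) + 1 := by linarith [g1 U]
  rw [Finset.sum_add_distrib, ← Finset.mul_sum, Finset.sum_const, nsmul_eq_mul, mul_one] at k1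
  have k2 : (N * c - 1) * g V ≤ (⌊N * c⌋₊ : ℝ) * g V :=
    mul_le_mul_of_nonneg_right (Nat.sub_one_lt_floor _).le (g0 V)
  have k3 := Nat.sub_one_lt_floor (a + e)
  rw [ha] at k3
  linarith [g1 V]

/-- The cone of the formal combinations of measurable sets that dominate, pointwise, a
nonnegative combination of the functions `g U - 1_U` and `1_V - g V`. -/
def coverCone (g : X.alg → ℝ) (V : X.alg) : PointedCone ℝ (X.alg →₀ ℝ) where
  carrier := {f | ∃ (h : X.alg →₀ ℝ) (c : ℝ), (∀ U, 0 ≤ h U) ∧ 0 ≤ c ∧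
    ∀ x, Finsupp.linearCombination ℝ (fun U => g U - ind U x) h + c * (ind V x - g V) ≤
      Finsupp.linearCombination ℝ (fun U => ind U x) f}
  add_mem' := by
    rintro f f' ⟨h, c, hh, hc, hf⟩ ⟨h', c', hh', hc', hf'⟩
    refine ⟨h + h', c + c', fun U => add_nonneg (hh U) (hh' U), add_nonneg hc hc', fun x => ?_⟩
    rw [map_add, map_add]
    linarith [hf x, hf' x]
  zero_mem' := ⟨0, 0, fun _ => le_rfl, le_rfl, fun x => by simp⟩
  smul_mem' := by
    rintro ⟨r, hr⟩ f ⟨h, c, hh, hc, hf⟩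
    refine ⟨r • h, r * c, fun U => mul_nonneg hr (hh U), mul_nonneg hr hc, fun x => ?_⟩
    change _ ≤ Finsupp.linearCombination ℝ (fun U => ind U x) (r • f)
    rw [map_smul, map_smul, smul_eq_mul, smul_eq_mul]
    have := mul_le_mul_of_nonneg_left (hf x) hr
    linarith

theorem mem_coverCone_of_nonneg {g : X.alg → ℝ} {V : X.alg} {f : X.alg →₀ ℝ}
    (hf : ∀ x, 0 ≤ Finsupp.linearCombination ℝ (fun U => ind U x) f) : f ∈ coverCone g V :=
  ⟨0, 0, fun _ => le_rfl, le_rfl, fun x => by simpa using hf x⟩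

theorem ind_top (x : X) : ind (⊤ : X.alg) x = 1 := by classical rw [ind_eq]; simp

/-- A normalized function with the cover inequalities dominates a finitely additive probability
measure that agrees with it at a given set. -/
theorem CoverIneq.exists_isProb {g : X.alg → ℝ} (hg : CoverIneq X g) (h1 : g ⊤ = 1)
    (V : X.alg) : ∃ μ, IsProb X μ ∧ (∀ U, μ U ≤ g U) ∧ μ V = g V := by
  -- The functional is built on formal combinations of measurable sets; `hzero` below shows that it
  -- depends only on the functions they denote.
  let e : X.alg → X.alg →₀ ℝ := fun U => Finsupp.single U 1
  have hlc : ∀ x U, Finsupp.linearCombination ℝ (fun U => ind U x) (e U) = ind U x := by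
    intro x U; simp [e]
  let f₀ : (X.alg →₀ ℝ) →ₗ.[ℝ] ℝ :=
    LinearPMap.mkSpanSingleton (e ⊤) (1 : ℝ) (by simp [e])
  have hf₀ : ∀ t hy, f₀ ⟨t • e ⊤, hy⟩ = t := fun t hy =>
    (LinearPMap.mkSpanSingleton'_apply (e ⊤) (1 : ℝ) _ t hy).trans (mul_one t)
  -- The functional t • ⊤ ↦ t on constants is to be extended positively. Its nonnegativity on the
  -- cone is exactly the real form of the cover inequalities.
  obtain ⟨L, hL, hpos⟩ := riesz_extension (coverCone g V) f₀ (by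
      rintro ⟨y, hy⟩ hs
      obtain ⟨t, rfl⟩ := Submodule.mem_span_singleton.1 hy
      rw [hf₀]
      obtain ⟨h, c, hh, hc, hf⟩ := hs
      refine hg.real h1 h.support h hh c hc V t fun x => ?_
      have := hf x
      simp only [map_smul, hlc, ind_top, smul_eq_mul, mul_one] at this
      simpa [Finsupp.linearCombination_apply, Finsupp.sum] using this)
    (by
      -- Constants are cofinal for the cone: adding ∑ |y U| makes the combination y nonnegative as a
      -- function.
      intro y
      refine ⟨⟨(∑ U ∈ y.support, |y U|) • e ⊤, Submodule.smul_mem _ _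
        (Submodule.mem_span_singleton_self _)⟩, mem_coverCone_of_nonneg fun x => ?_⟩
      simp only [map_add, map_smul, hlc, ind_top, smul_eq_mul, mul_one]
      rw [Finsupp.linearCombination_apply, Finsupp.sum, ← Finset.sum_add_distrib]
      refine Finset.sum_nonneg fun U _ => ?_
      have h2 : |y U| * ind U x ≤ |y U| :=
        mul_le_of_le_one_right (abs_nonneg _) (ind_le_one U x)
      have h3 : -(|y U| * ind U x) ≤ y U * ind U x := by
        rw [← neg_mul]
        exact mul_le_mul_of_nonneg_right (neg_abs_le _) (ind_nonneg U x)
      rw [smul_eq_mul]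
      linarith)
  have hLtop : L (e ⊤) = 1 := by
    have h2 := hL ⟨(1 : ℝ) • e ⊤, Submodule.smul_mem _ _ (Submodule.mem_span_singleton_self _)⟩
    rw [hf₀] at h2
    simpa only [one_smul] using h2
  -- A combination that vanishes as a function lies in the cone together with its negative. This
  -- gives the value at ⊥ and additivity.
  have hzero : ∀ f : X.alg →₀ ℝ,
      (∀ x, Finsupp.linearCombination ℝ (fun U => ind U x) f = 0) → L f = 0 := fun f hf =>
    le_antisymm (by
      have := hpos (-f) (mem_coverCone_of_nonneg fun x => by rw [map_neg, hf, neg_zero])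
      rw [map_neg] at this
      linarith) (hpos f (mem_coverCone_of_nonneg fun x => (hf x).ge))
  have hle : ∀ U, L (e U) ≤ g U := fun U => by
    have := hpos (g U • e ⊤ - e U) ⟨e U, 0, fun W => by
        classical
        rw [Finsupp.single_apply]; split_ifs <;> norm_num, le_rfl, fun x => by
      simp [e, ind_top]⟩
    rw [map_sub, map_smul, hLtop, smul_eq_mul, mul_one] at this
    linarith
  refine ⟨fun U => L (e U), ⟨fun U => hpos _ (mem_coverCone_of_nonneg fun x => ?_), fun U => ?_,
    hzero _ fun x => ?_, hLtop, fun U W hUW => ?_⟩, hle, le_antisymm (hle V) ?_⟩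
  · rw [hlc]; exact ind_nonneg U x
  · have := hpos (e ⊤ - e U) (mem_coverCone_of_nonneg fun x => by
      rw [map_sub, hlc, hlc, ind_top]; linarith [ind_le_one U x])
    rw [map_sub, hLtop] at this
    linarith
  · classical
    rw [hlc, ind_eq]; simp
  · have := hzero (e (U ⊔ W) - e U - e W) fun x => by
      classical
      rw [map_sub, map_sub, hlc, hlc, hlc, ind_eq, ind_eq, ind_eq]
      have hd : ¬ (x ∈ U.1 ∧ x ∈ W.1) := fun hx => by
        have h3 : x ∈ (U ⊓ W : X.alg).1 := hx
        rw [hUW.eq_bot] at h3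
        exact h3
      have hs : x ∈ (U ⊔ W : X.alg).1 ↔ x ∈ U.1 ∨ x ∈ W.1 := Iff.rfl
      rw [hs]
      by_cases hU : x ∈ U.1 <;> by_cases hW : x ∈ W.1 <;> simp [hU, hW]
      exact hd ⟨hU, hW⟩
    rw [map_sub, map_sub] at this
    linarith
  -- The generator 1_V - g V was put into the cone for this inequality, which turns domination at V
  -- into equality.
  · have := hpos (e V - g V • e ⊤) ⟨0, 1, fun _ => le_rfl, zero_le_one, fun x => by
      simp [e, ind_top]⟩
    rw [map_sub, map_smul, hLtop, smul_eq_mul, mul_one] at this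
    linarith

/-- Normalized functions with the cover inequalities are upper probability measures. -/
theorem CoverIneq.isUpper {g : X.alg → ℝ} (hg : CoverIneq X g) (h1 : g ⊤ = 1) :
    IsUpper X g := by
  -- The family is the largest candidate, all probability measures below g; at each set one of them
  -- attains the value of g.
  refine ⟨{μ | IsProb X μ ∧ ∀ U, μ U ≤ g U}, ?_, fun μ hμ => hμ.1, fun U => ⟨?_, fun c hc => ?_⟩⟩
  · obtain ⟨μ, h, hle, -⟩ := hg.exists_isProb h1 ⊤
    exact ⟨μ, h, hle⟩
  · rintro _ ⟨μ, hμ, rfl⟩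
    exact hμ.2 U
  · obtain ⟨μ, h, hle, he⟩ := hg.exists_isProb h1 U
    exact hc ⟨μ, ⟨h, hle⟩, he⟩

/-! ### Common properties of the measures of all kinds -/

/-- The case n = 2 of the defining inequality; monotonicity and subadditivity of plausibilities need
no more. -/
theorem IsPlaus.two {g : X.alg → ℝ} (h : IsPlaus X g) (U V : X.alg) :
    g (U ⊓ V) ≤ g U + g V - g (U ⊔ V) := by
  have h2 := h.inter_le 2 (by norm_num) ![U, V]
  have e : (Finset.univ.filter Finset.Nonempty : Finset (Finset (Fin 2))) =
      {{0}, {1}, {0, 1}} := by decide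
  rw [e, Finset.sum_insert (by decide), Finset.sum_insert (by decide),
    Finset.sum_singleton] at h2
  have e2 : (Finset.univ : Finset (Fin 2)) = {0, 1} := by decide
  have e3 : ({0, 1} : Finset (Fin 2)).card = 2 := by decide
  rw [e2, e3] at h2
  simp only [Finset.inf_insert, Finset.inf_singleton, Finset.sup_insert, Finset.sup_singleton,
    Finset.card_singleton, Matrix.cons_val_zero, Matrix.cons_val_one] at h2
  norm_num at h2
  linarith

/-- Apply the two-set inequality to V and U ⊔ Vᶜ: their meet is U and their join is ⊤, so g(U) ≤
g(V) + g(U ⊔ Vᶜ) - 1 ≤ g(V). -/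
theorem IsPlaus.mono {g : X.alg → ℝ} (h : IsPlaus X g) {U V : X.alg} (hUV : U ≤ V) :
    g U ≤ g V := by
  have h2 := h.two V (U ⊔ Vᶜ)
  rw [inf_sup_left, inf_compl_eq_bot, sup_bot_eq, inf_eq_right.2 hUV, sup_left_comm,
    sup_compl_eq_top, sup_top_eq, h.univ] at h2
  linarith [h.le_one (U ⊔ Vᶜ)]

namespace Kind.IsMeas

variable {κ : Kind} {g : X.alg → ℝ} (h : κ.IsMeas X g)
include h

theorem nonneg (U : X.alg) : 0 ≤ g U := by
  cases κ with
  | upper =>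
    obtain ⟨P, ⟨μ, hμ⟩, hP, hg⟩ := h
    exact ((hP μ hμ).nonneg U).trans ((hg U).1 ⟨μ, hμ, rfl⟩)
  | plaus => exact IsPlaus.nonneg h U
  | poss => exact IsPoss.nonneg h U

theorem le_one (U : X.alg) : g U ≤ 1 := by
  cases κ with
  | upper =>
    obtain ⟨P, -, hP, hg⟩ := h
    refine (hg U).2 ?_
    rintro _ ⟨μ, hμ, rfl⟩
    exact (hP μ hμ).le_one U
  | plaus => exact IsPlaus.le_one h U
  | poss => exact IsPoss.le_one h U

theorem empty : g ⊥ = 0 := by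
  cases κ with
  | upper =>
    refine le_antisymm ?_ (nonneg (κ := .upper) h ⊥)
    obtain ⟨P, -, hP, hg⟩ := h
    refine (hg ⊥).2 ?_
    rintro _ ⟨μ, hμ, rfl⟩
    exact (hP μ hμ).empty.le
  | plaus => exact IsPlaus.empty h
  | poss => exact IsPoss.empty h

theorem mono {U V : X.alg} (hUV : U ≤ V) : g U ≤ g V := by
  cases κ with
  | upper =>
    obtain ⟨P, -, hP, hg⟩ := h
    refine (hg U).2 ?_
    rintro _ ⟨μ, hμ, rfl⟩
    exact ((hP μ hμ).mono hUV).trans ((hg V).1 ⟨μ, hμ, rfl⟩)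
  | plaus => exact IsPlaus.mono h hUV
  | poss =>
    have := IsPoss.union h U V
    rw [sup_eq_right.2 hUV] at this
    rw [this]
    exact le_max_left _ _

theorem sup_le (U V : X.alg) : g (U ⊔ V) ≤ g U + g V := by
  have hU := nonneg h U
  have hV := nonneg h V
  cases κ with
  | upper =>
    obtain ⟨P, -, hP, hg⟩ := h
    refine (hg _).2 ?_
    rintro _ ⟨μ, hμ, rfl⟩
    exact ((hP μ hμ).sup_le U V).trans
      (add_le_add ((hg U).1 ⟨μ, hμ, rfl⟩) ((hg V).1 ⟨μ, hμ, rfl⟩))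
  | plaus => linarith [IsPlaus.two h U V, IsPlaus.nonneg h (U ⊓ V)]
  | poss =>
    rw [IsPoss.union h U V]
    exact max_le (by linarith) (by linarith)

theorem one_le_add_compl (hκ : κ ≠ .upper) (U : X.alg) : 1 ≤ g U + g Uᶜ := by
  have := sup_le h U Uᶜ
  rw [sup_compl_eq_top] at this
  cases κ with
  | upper => exact absurd rfl hκ
  | plaus => rwa [IsPlaus.univ h] at this
  | poss => rwa [IsPoss.univ h] at this

end Kind.IsMeas

end MeasureTheory

/-! ### Validity of the axioms and rules in every coalgebra -/

section Soundness

variable {K : Type u} {M : K → Unc.{u}} {T : PF K} {S : PF K}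

/-! ### Meaning of the bounds on measures -/

section Bounds

variable {A : Coalg M T} {κ : Kind} {p : I} {φ : MForm M T S}
  {g : ((PF.cap κ S).functor M).obj A.V} {μ : ((PF.prob S).functor M).obj A.V}

/-- The second bound of the modality is 0 and holds because measures are at most 1. -/
theorem mem_interp_uGe : g ∈ interp A (uGe κ p φ) ↔ (p : ℝ) ≤ capVal g (event A φ) := by
  rw [uGe, mem_interp_box]
  have := (isMeas_capVal g).le_one (event A φ)ᶜ
  exact and_iff_left (by simpa using this)

theorem mem_interp_lGe : g ∈ interp A (lGe κ p φ) ↔ (p : ℝ) ≤ 1 - capVal g (event A φ)ᶜ := by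
  rw [lGe, mem_interp_box]
  exact and_iff_right (by simpa using (isMeas_capVal g).nonneg (event A φ))

theorem mem_interp_uLe : g ∈ interp A (uLe κ p φ) ↔ capVal g (event A φ) ≤ p := by
  change g ∈ interp A (lGe κ (σ p) (neg φ)) ↔ _
  rw [mem_interp_lGe, event_neg, compl_compl, unitInterval.coe_symm_eq]
  exact sub_le_sub_iff_left 1

theorem mem_interp_lLe : g ∈ interp A (lLe κ p φ) ↔ 1 - capVal g (event A φ)ᶜ ≤ p := by
  change g ∈ interp A (uGe κ (σ p) (neg φ)) ↔ _
  rw [mem_interp_uGe, event_neg, unitInterval.coe_symm_eq]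
  exact sub_le_comm

theorem mem_interp_uLt : g ∈ interp A (uLt κ p φ) ↔ capVal g (event A φ) < p := by
  rw [uLt, (isVal_interp A g).neg, mem_interp_uGe, not_le]

theorem mem_interp_pGe : μ ∈ interp A (pGe p φ) ↔ (p : ℝ) ≤ prbVal μ (event A φ) :=
  mem_interp_ge

theorem mem_interp_pLe : μ ∈ interp A (pLe p φ) ↔ prbVal μ (event A φ) ≤ p := by
  rw [pLe, mem_interp_ge, event_neg, (isProb_prbVal μ).compl, unitInterval.coe_symm_eq]
  exact sub_le_sub_iff_left 1

theorem mem_interp_pLt : μ ∈ interp A (pLt p φ) ↔ prbVal μ (event A φ) < p := by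
  rw [pLt, (isVal_interp A μ).neg, mem_interp_pGe, not_le]

end Bounds

/-! ### Soundness -/

/-- The alternation of ≤ and ≥ in `uAlt` matches the sign of the inclusion-exclusion term, so every
term is bounded in the same direction. -/
theorem neg_one_pow_mul_le_of_uAlt {A : Coalg M T} {κ : Kind} {i : ℕ} {p : I} {φ : MForm M T S}
    {g : ((PF.cap κ S).functor M).obj A.V} (h : g ∈ interp A (uAlt κ i p φ)) :
    (-1 : ℝ) ^ (i + 1) * capVal g (event A φ) ≤ (-1 : ℝ) ^ (i + 1) * p := by
  rw [uAlt] at h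
  split_ifs at h with hi
  · rw [mem_interp_uLe] at h
    rw [hi.add_one.neg_one_pow]
    linarith
  · rw [mem_interp_uGe] at h
    rw [(Nat.not_odd_iff_even.1 hi).add_one.neg_one_pow]
    linarith

/-- Shared by both plausibility axioms: a nonnegative alternating sum is an upper bound, and a
negative one contradicts the nonnegativity of the measure. -/
theorem plaus_le_of_uAlt {A : Coalg M T} {n : ℕ} (hn : 1 ≤ n) {φ : Fin n → MForm M T S}
    {P : Finset (Fin n) → I} {g : ((PF.cap .plaus S).functor M).obj A.V}
    (h : g ∈ interp A (bigAnd (Finset.univ.filter Finset.Nonempty)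
      fun J => uAlt .plaus J.card (P J) (bigOr J φ))) :
    capVal g (event A (bigAnd Finset.univ φ)) ≤
      ∑ J : Finset (Fin n) with J.Nonempty, (-1 : ℝ) ^ (J.card + 1) * (P J : ℝ) := by
  rw [(isVal_interp A g).bigAnd] at h
  rw [event_bigAnd]
  refine (IsPlaus.inter_le (isMeas_capVal g) n hn _).trans (Finset.sum_le_sum fun J hJ => ?_)
  rw [← event_bigOr]
  exact neg_one_pow_mul_le_of_uAlt (h J hJ)

/-- The axioms are valid. -/
theorem Ax.valid {φ : Form M T S} (h : Ax M T S φ) (A : Coalg M T)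
    (x : (S.functor M).obj A.V) : x ∈ interp A φ := by
  cases h with
  | taut _ _ h =>
    exact h (fun φ => x ∈ interp A φ) (isVal_interp A x).bot (isVal_interp A x).imp
  | const_mem k c B h hc =>
    rw [(isVal_interp A x).imp]
    rintro (rfl : x = c)
    exact hc
  | const_notMem k c B h hc =>
    rw [(isVal_interp A x).imp, (isVal_interp A x).neg]
    rintro (rfl : x = c)
    exact hc
  | pr₁_neg S₁ S₂ φ =>
    rw [(isVal_interp A x).imp, (isVal_interp A x).neg]
    exact ((isVal_interp A (S := S₁) x.1).neg φ).2
  | pr₂_neg S₁ S₂ φ =>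
    rw [(isVal_interp A x).imp, (isVal_interp A x).neg]
    exact ((isVal_interp A (S := S₂) x.2).neg φ).2
  | pr₁_bot S₁ S₂ =>
    rw [(isVal_interp A x).neg]
    exact id
  | pr₂_bot S₁ S₂ =>
    rw [(isVal_interp A x).neg]
    exact id
  | in₁_neg S₁ S₂ φ =>
    rw [(isVal_interp A x).imp, (isVal_interp A x).neg]
    simp only [interp]
    rcases x with x | x
    · intro h
      exact Or.inl ⟨x, ((isVal_interp A x).neg φ).2 fun hx => h (Or.inl ⟨x, hx, rfl⟩), rfl⟩
    · exact fun _ => Or.inr ⟨x, rfl⟩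
  | in₂_neg S₁ S₂ φ =>
    rw [(isVal_interp A x).imp, (isVal_interp A x).neg]
    simp only [interp]
    rcases x with x | x
    · exact fun _ => Or.inl ⟨x, rfl⟩
    · intro h
      exact Or.inr ⟨x, ((isVal_interp A x).neg φ).2 fun hx => h (Or.inr ⟨x, hx, rfl⟩), rfl⟩
  | in_bot S₁ S₂ =>
    rw [(isVal_interp A x).iff, (isVal_interp A x).neg]
    simp only [interp]
    rcases x with x | x
    · refine iff_of_true ?_ (Or.inl ⟨x, rfl⟩)
      rintro (⟨y, hy, -⟩ | ⟨y, hy⟩)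
      · exact hy
      · cases hy
    · refine iff_of_false (fun h => h (Or.inr ⟨x, rfl⟩)) ?_
      rintro (⟨y, hy⟩ | ⟨y, hy, -⟩)
      · cases hy
      · exact hy
  | next_neg φ =>
    rw [(isVal_interp A x).imp, (isVal_interp A x).neg]
    exact ((isVal_interp A (S := T) (A.str.toFun x)).neg φ).2
  | next_bot =>
    rw [(isVal_interp A x).neg]
    exact id
  | le_lt κ S p q φ hpq =>
    rw [(isVal_interp A x).imp, mem_interp_uLe, mem_interp_uLt]
    exact fun h => h.trans_lt hpq
  | lt_le κ S p φ =>
    rw [(isVal_interp A x).imp, mem_interp_uLe, mem_interp_uLt]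
    exact le_of_lt
  | mono κ S p φ ψ =>
    rw [(isVal_interp A x).imp, (isVal_interp A x).imp, mem_interp_lGe, mem_interp_uGe,
      mem_interp_uGe]
    intro h hp
    -- The premise says that the complement of φ → ψ has measure 0, so subadditivity bounds the
    -- measure of φ by that of ψ.
    have h1 : event A φ ≤ event A ψ ⊔ (event A (imp φ ψ))ᶜ := fun y hy => by
      by_cases hψ : y ∈ interp A ψ
      · exact Or.inl hψ
      · exact Or.inr fun h => hψ (((isVal_interp A y).imp φ ψ).1 h hy)
    have h2 := ((isMeas_capVal x).mono h1).trans ((isMeas_capVal x).sup_le _ _)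
    rw [Set.Icc.coe_one] at h
    linarith
  | split κ S p q φ =>
    rw [(isVal_interp A x).iff, (isVal_interp A x).and, mem_interp_lGe, mem_interp_uGe,
      mem_interp_box]
  | dual κ S p φ =>
    rw [(isVal_interp A x).iff, mem_interp_lGe, mem_interp_uLe, event_neg,
      unitInterval.coe_symm_eq]
    exact le_sub_comm
  | le_dual κ S p φ hκ =>
    rw [(isVal_interp A x).imp, mem_interp_lLe, mem_interp_uLe]
    intro h
    linarith [(isMeas_capVal x).one_le_add_compl hκ (event A φ)]
  | plaus_le S n φ P p hn hs hp =>
    rw [(isVal_interp A x).imp, mem_interp_uLe]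
    intro h
    rw [hp]
    exact le_min (plaus_le_of_uAlt hn h) ((isMeas_capVal x).le_one _)
  | plaus_neg S n φ P hn hs =>
    rw [(isVal_interp A x).neg]
    intro h
    exact absurd (plaus_le_of_uAlt hn h) (not_le.2 (hs.trans_le ((isMeas_capVal x).nonneg _)))
  | poss_bot S =>
    rw [mem_interp_uLe, event_bot, (isMeas_capVal x).empty]
    exact le_rfl
  | poss_or S p q φ ψ =>
    rw [(isVal_interp A x).imp, (isVal_interp A x).and, mem_interp_uLe, mem_interp_uLe,
      mem_interp_uLe, event_or, IsPoss.union (isMeas_capVal x)]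
    rintro ⟨h1, h2⟩
    rw [Monotone.map_max (f := ((↑) : I → ℝ)) fun _ _ h => h]
    exact max_le_max h1 h2
  | prob_le_lt S p q φ hpq =>
    rw [(isVal_interp A x).imp, mem_interp_pLe, mem_interp_pLt]
    exact fun h => h.trans_lt hpq
  | prob_lt_le S p φ =>
    rw [(isVal_interp A x).imp, mem_interp_pLe, mem_interp_pLt]
    exact le_of_lt
  | prob_mono S p φ ψ =>
    rw [(isVal_interp A x).imp, (isVal_interp A x).imp, mem_interp_pGe, mem_interp_pGe,
      mem_interp_pGe]
    intro h hp
    have h1 : event A φ ≤ event A ψ ⊔ (event A (imp φ ψ))ᶜ := fun y hy => by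
      by_cases hψ : y ∈ interp A ψ
      · exact Or.inl hψ
      · exact Or.inr fun h => hψ (((isVal_interp A y).imp φ ψ).1 h hy)
    have h2 := ((isProb_prbVal x).mono h1).trans ((isProb_prbVal x).sup_le _ _)
    rw [(isProb_prbVal x).compl] at h2
    rw [Set.Icc.coe_one] at h
    linarith

/-- The cover rules for a function that satisfies the cover inequalities. -/
theorem CoverIneq.le_of_atLeast {A : Coalg M T} {g : ((S.functor M).obj A.V).alg → ℝ}
    (hg : CoverIneq _ g) {m n k : ℕ} {φ : MForm M T S} {Φ : Fin m → MForm M T S}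
    {P : Fin m → I} (h1 : Cons A S ∅ (imp φ (atLeast (n + k) Φ)).toForm)
    (h2 : Cons A S ∅ (atLeast k Φ).toForm) (hP : ∀ i, g (event A (Φ i)) ≤ P i) :
    n * g (event A φ) + k ≤ ∑ i, (P i : ℝ) := by
  refine (hg m n k (event A φ) (fun i => event A (Φ i)) (fun x => ?_) fun x hx => ?_).trans
    (Finset.sum_le_sum fun i _ => hP i)
  · have := h2 x (by simp)
    rw [interp_toForm, (isVal_interp A x).atLeast] at this
    exact this
  · have := h1 x (by simp)
    rw [interp_toForm, (isVal_interp A x).imp, (isVal_interp A x).atLeast] at this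
    exact this hx

/-- Clipping to [0,1] does no harm: values are at most 1, and the outer maximum only weakens the
bound. -/
theorem le_clip {a s : ℝ} {n k : ℕ} {p : I} (hn : 1 ≤ n) (ha : a ≤ 1) (h : n * a + k ≤ s)
    (hp : (p : ℝ) = max 0 (min 1 ((s - k) / n))) : a ≤ p := by
  have hn' : (0 : ℝ) < n := by exact_mod_cast hn
  rw [hp]
  refine le_max_of_le_right (le_min ha ?_)
  rw [le_div_iff₀ hn']
  linarith

/-- It lets the refutation form of the cover rule be treated as the case n = 0, φ = ⊥ of the cover
inequality. -/
theorem cons_atLeast_zero (A : Coalg M T) {m : ℕ} (Φ : Fin m → MForm M T S) {k : ℕ}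
    (h : Cons A S ∅ (atLeast k Φ).toForm) :
    Cons A S ∅ (imp (bot S) (atLeast (0 + k) Φ)).toForm := fun x hx => by
  rw [interp_toForm, (isVal_interp A x).imp, zero_add]
  have := h x hx
  rw [interp_toForm] at this
  exact fun _ => this

/-- The consequence relations of a coalgebra form a deduction system. -/
theorem isDeductionSystem_cons (A : Coalg M T) : IsDeductionSystem M T (Cons A) where
  assumption S _ Γ φ h x hx := h.elim (hx φ) fun h => h.valid A x
  modusPonens S _ φ ψ x hx :=
    ((isVal_interp A x).imp φ ψ).1 (hx (imp φ ψ) (by simp)) (hx φ (by simp))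
  cut S _ Γ Λ φ h1 h2 x hx := h2 x fun γ hγ => h1 γ hγ x hx
  deduction S _ Γ φ ψ h x hx := ((isVal_interp A x).imp φ ψ).2 fun hφ => h x <| by
    rintro γ (hγ | rfl)
    · exact hx γ hγ
    · exact hφ
  -- The point x itself satisfies {x}, whose negation is among the premises.
  constant k _ x hx :=
    absurd rfl (((isVal_interp A (S := .const k) x).neg _).1 (hx (neg (single k x)) ⟨x, rfl⟩))
  box_pr₁ S₁ S₂ _ Γ ψ h x hx := h x.1 fun γ hγ => hx (pr₁ γ) ⟨γ, hγ, rfl⟩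
  box_pr₂ S₁ S₂ _ Γ ψ h x hx := h x.2 fun γ hγ => hx (pr₂ γ) ⟨γ, hγ, rfl⟩
  box_in₁ S₁ S₂ _ Γ ψ h x hx := by
    rcases x with x | x
    · refine Or.inl ⟨x, h x fun γ hγ => ?_, rfl⟩
      rcases hx (in₁ γ) ⟨γ, hγ, rfl⟩ with ⟨y, hy, he⟩ | ⟨y, he⟩
      · cases he; exact hy
      · cases he
    · exact Or.inr ⟨x, rfl⟩
  box_in₂ S₁ S₂ _ Γ ψ h x hx := by
    rcases x with x | x
    · exact Or.inl ⟨x, rfl⟩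
    · refine Or.inr ⟨x, h x fun γ hγ => ?_, rfl⟩
      rcases hx (in₂ γ) ⟨γ, hγ, rfl⟩ with ⟨y, he⟩ | ⟨y, hy, he⟩
      · cases he
      · cases he; exact hy
  box_next Γ ψ h x hx := h (A.str.toFun x) fun γ hγ => hx (next γ) ⟨γ, hγ, rfl⟩
  necessitation κ S _ φ h x _ := by
    rw [mem_interp_lGe]
    have : event A φ = ⊤ := Subtype.ext <| Set.eq_univ_of_forall fun y => by
      have := h y (by simp)
      rwa [interp_toForm] at this
    rw [this, compl_top, (isMeas_capVal x).empty]
    simp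
  arch_u κ S _ p ψ x hx := by
    rw [mem_interp_uGe]
    -- Only bounds in [0,1] occur in formulas, so negative c is treated apart; otherwise a bound
    -- strictly between c and p lies in [0,1].
    refine le_of_forall_lt fun c hc => ?_
    rcases lt_or_ge c 0 with h0 | h0
    · exact h0.trans_le ((isMeas_capVal x).nonneg _)
    · obtain ⟨d, h1, h2⟩ := exists_between hc
      have := hx (uGe κ ⟨d, h0.trans h1.le, h2.le.trans p.2.2⟩ ψ) ⟨_, h2, rfl⟩
      rw [mem_interp_uGe] at this
      exact h1.trans_le this
  arch_l κ S _ p ψ x hx := by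
    rw [mem_interp_lGe]
    refine le_of_forall_lt fun c hc => ?_
    rcases lt_or_ge c 0 with h0 | h0
    · linarith [(isMeas_capVal x).le_one (event A ψ)ᶜ]
    · obtain ⟨d, h1, h2⟩ := exists_between hc
      have := hx (lGe κ ⟨d, h0.trans h1.le, h2.le.trans p.2.2⟩ ψ) ⟨_, h2, rfl⟩
      rw [mem_interp_lGe] at this
      exact h1.trans_le this
  cover S _ m n k hn φ Φ P p hp h1 h2 x _ := by
    rw [(isVal_interp A x).imp, (isVal_interp A x).bigAnd, mem_interp_uLe]
    intro h
    refine le_clip hn ((isMeas_capVal x).le_one _) ?_ hp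
    exact (IsUpper.coverIneq (isMeas_capVal x)).le_of_atLeast h1 h2 fun i => mem_interp_uLe.1 (h i (by simp))
  cover_neg S _ m k Φ P hP h2 x _ := by
    rw [(isVal_interp A x).neg, (isVal_interp A x).bigAnd]
    intro h
    have := (IsUpper.coverIneq (isMeas_capVal x)).le_of_atLeast (cons_atLeast_zero A Φ h2) h2
      fun i => mem_interp_uLe.1 (h i (by simp))
    simp only [Nat.cast_zero, zero_mul, zero_add] at this
    linarith
  prob_necessitation S _ φ h x _ := by
    rw [mem_interp_pGe]
    have : event A φ = ⊤ := Subtype.ext <| Set.eq_univ_of_forall fun y => by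
      have := h y (by simp)
      rwa [interp_toForm] at this
    rw [this, (isProb_prbVal x).univ]
    simp
  prob_arch S _ p ψ x hx := by
    rw [mem_interp_pGe]
    refine le_of_forall_lt fun c hc => ?_
    rcases lt_or_ge c 0 with h0 | h0
    · exact h0.trans_le ((isProb_prbVal x).nonneg _)
    · obtain ⟨d, h1, h2⟩ := exists_between hc
      have := hx (pGe ⟨d, h0.trans h1.le, h2.le.trans p.2.2⟩ ψ) ⟨_, h2, rfl⟩
      rw [mem_interp_pGe] at this
      exact h1.trans_le this
  prob_cover S _ m n k hn φ Φ P p hp h1 h2 x _ := by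
    rw [(isVal_interp A x).imp, (isVal_interp A x).bigAnd, mem_interp_pLe]
    intro h
    refine le_clip hn ((isProb_prbVal x).le_one _) ?_ hp
    exact (isProb_prbVal x).coverIneq.le_of_atLeast h1 h2 fun i => mem_interp_pLe.1 (h i (by simp))
  prob_cover_neg S _ m k Φ P hP h2 x _ := by
    rw [(isVal_interp A x).neg, (isVal_interp A x).bigAnd]
    intro h
    have := (isProb_prbVal x).coverIneq.le_of_atLeast (cons_atLeast_zero A Φ h2) h2
      fun i => mem_interp_pLe.1 (h i (by simp))
    simp only [Nat.cast_zero, zero_mul, zero_add] at this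
    linarith

/-- Intersections of deduction systems are deduction systems. -/
theorem isDeductionSystem_iInter {ι : Type*} {D : ι → Entailment M T}
    (h : ∀ i, IsDeductionSystem M T (D i)) :
    IsDeductionSystem M T fun S Γ φ => ∀ i, D i S Γ φ where
  assumption S hS Γ φ hφ i := (h i).assumption S hS Γ φ hφ
  modusPonens S hS φ ψ i := (h i).modusPonens S hS φ ψ
  cut S hS Γ Λ φ h1 h2 i := (h i).cut S hS Γ Λ φ (fun l hl => h1 l hl i) (h2 i)
  deduction S hS Γ φ ψ h1 i := (h i).deduction S hS Γ φ ψ (h1 i)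
  constant k hk i := (h i).constant k hk
  box_pr₁ S₁ S₂ hS Γ ψ h1 i := (h i).box_pr₁ S₁ S₂ hS Γ ψ (h1 i)
  box_pr₂ S₁ S₂ hS Γ ψ h1 i := (h i).box_pr₂ S₁ S₂ hS Γ ψ (h1 i)
  box_in₁ S₁ S₂ hS Γ ψ h1 i := (h i).box_in₁ S₁ S₂ hS Γ ψ (h1 i)
  box_in₂ S₁ S₂ hS Γ ψ h1 i := (h i).box_in₂ S₁ S₂ hS Γ ψ (h1 i)
  box_next Γ ψ h1 i := (h i).box_next Γ ψ (h1 i)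
  necessitation κ S hS φ h1 i := (h i).necessitation κ S hS φ (h1 i)
  arch_u κ S hS p ψ i := (h i).arch_u κ S hS p ψ
  arch_l κ S hS p ψ i := (h i).arch_l κ S hS p ψ
  cover S hS m n k hn φ Φ P p hp h1 h2 i :=
    (h i).cover S hS m n k hn φ Φ P p hp (h1 i) (h2 i)
  cover_neg S hS m k Φ P hP h1 i := (h i).cover_neg S hS m k Φ P hP (h1 i)
  prob_necessitation S hS φ h1 i := (h i).prob_necessitation S hS φ (h1 i)
  prob_arch S hS p ψ i := (h i).prob_arch S hS p ψ
  prob_cover S hS m n k hn φ Φ P p hp h1 h2 i :=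
    (h i).prob_cover S hS m n k hn φ Φ P p hp (h1 i) (h2 i)
  prob_cover_neg S hS m k Φ P hP h1 i := (h i).prob_cover_neg S hS m k Φ P hP (h1 i)

variable (M T) in
theorem isDeductionSystem_semCons : IsDeductionSystem M T (SemCons M T) :=
  isDeductionSystem_iInter isDeductionSystem_cons

variable (M T) in
theorem isDeductionSystem_derivable : IsDeductionSystem M T (Derivable M T) := by
  have : Derivable M T = fun S Γ φ =>
      ∀ D : {D : Entailment M T // IsDeductionSystem M T D}, D.1 S Γ φ := by
    funext S Γ φ
    exact propext ⟨fun h D => h D.1 D.2, fun h D hD => h ⟨D, hD⟩⟩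
  rw [this]
  exact isDeductionSystem_iInter fun D => D.2

-- Semantic consequence is itself one of the systems over which `Derivable` quantifies.
variable (M T) in
theorem isSound_derivable : IsSound (Derivable M T) := fun _ _ _ _ h =>
  h _ (isDeductionSystem_semCons M T)

/-- The formulas that a point satisfies. -/
def theory (A : Coalg M T) (x : (S.functor M).obj A.V) : Set (Form M T S) :=
  {φ | x ∈ interp A φ}

/-- The theory of a point of a coalgebra is maximal for each system that is sound there. -/
theorem isMaximal_theory {D : Entailment M T} {A : Coalg M T}
    (h : ∀ Γ φ, D S Γ φ → Cons A S Γ φ) (x : (S.functor M).obj A.V) :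
    IsMaximal D S (theory A x) where
  negComplete φ := by
    change x ∈ interp A φ ↔ ¬ x ∈ interp A (neg φ)
    rw [(isVal_interp A x).neg, not_not]
  consistent hD := (isVal_interp A x).bot (h _ _ hD x fun _ hγ => hγ)

-- A set consistent for semantic consequence holds at some point of some coalgebra, and the theory
-- of that point is a maximal set including it.
variable (M T) in
theorem isLindenbaum_semCons : IsLindenbaum (SemCons M T) := by
  intro S _ Γ h
  simp only [SemCons, Cons, not_forall] at h
  obtain ⟨A, x, hx, -⟩ := h
  exact ⟨theory A x, hx, isMaximal_theory (fun _ _ h => h A) x⟩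

end Soundness

/-! ### Maximal sets and the measures that they determine -/

section MaximalSets

variable {K : Type u} {M : K → Unc.{u}} {T : PF K} {b : Bool} {S : PF K} {D : Entailment M T}

/-! ### Maximal sets -/

namespace IsMaximal

theorem isVal (hD : IsDeductionSystem M T D) (hS : S ∈ T.Ing) {x : Set (Form M T S)}
    (hx : IsMaximal D S x) : IsVal fun φ : Form M T S => φ ∈ x :=
  ⟨hx.bot_notMem hD hS, hx.mem_imp hD hS⟩

theorem isVal_toForm (hD : IsDeductionSystem M T D) (hS : S ∈ T.Ing) {x : Set (Form M T S)}
    (hx : IsMaximal D S x) : IsVal fun φ : Fml M T b S => φ.toForm ∈ x :=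
  ⟨hx.bot_notMem hD hS, fun φ ψ => hx.mem_imp hD hS φ.toForm ψ.toForm⟩

theorem mem_of_derivable (hD : IsDeductionSystem M T D) (hS : S ∈ T.Ing) {x : Set (Form M T S)}
    (hx : IsMaximal D S x) {Γ : Set (Form M T S)} (hΓ : Γ ⊆ x) {φ : Form M T S}
    (h : D S Γ φ) : φ ∈ x :=
  hx.closed hD hS (hD.cut S hS x Γ φ (fun γ hγ => hD.assumption S hS x γ (Or.inl (hΓ hγ))) h)

theorem mem_of_ax (hD : IsDeductionSystem M T D) (hS : S ∈ T.Ing) {x : Set (Form M T S)}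
    (hx : IsMaximal D S x) {φ : Form M T S} (h : Ax M T S φ) : φ ∈ x :=
  hx.closed hD hS (hD.assumption S hS x φ (Or.inr h))

/-- Preimages of maximal sets under definite modalities are maximal. -/
theorem preimage (hD : IsDeductionSystem M T D) (hS : S ∈ T.Ing) {x : Set (Form M T S)}
    (hx : IsMaximal D S x) {S' : PF K} (hS' : S' ∈ T.Ing) {box : Form M T S' → Form M T S}
    (hbox : ∀ Γ ψ, D S' Γ ψ → D S (box '' Γ) (box ψ))
    (hneg : ∀ φ, Ax M T S (imp (neg (box φ)) (box (neg φ)))) (hbot : box (bot S') ∉ x) :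
    IsMaximal D S' (box ⁻¹' x) where
  consistent h := hbot (hx.mem_of_derivable hD hS (Set.image_preimage_subset box x) (hbox _ _ h))
  negComplete φ := by
    refine ⟨fun h1 h2 => hbot ?_, fun h => ?_⟩
    -- If both φ and ¬φ were in the preimage, the boxed instance of modus ponens would put the boxed
    -- ⊥ into x.
    · refine hx.mem_of_derivable hD hS ?_ (hbox _ _ (hD.modusPonens S' hS' φ (bot S')))
      rintro _ ⟨ψ, rfl | rfl, rfl⟩
      · exact h1
      · exact h2
    · by_contra hφ
      exact h (((hx.isVal hD hS).imp _ _).1 (hx.mem_of_ax hD hS (hneg φ))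
        (((hx.isVal hD hS).neg _).2 hφ))

end IsMaximal

/-- In a Lindenbaum system a formula is derivable from a set of formulas if it belongs to all
maximal sets that include the latter. -/
theorem IsLindenbaum.derivable (hL : IsLindenbaum D) (hD : IsDeductionSystem M T D)
    (hS : S ∈ T.Ing) {Γ : Set (Form M T S)} {φ : Form M T S}
    (h : ∀ x, IsMaximal D S x → Γ ⊆ x → φ ∈ x) : D S Γ φ := by
  by_contra hφ
  -- If φ is not derivable, Γ with ¬φ is consistent: otherwise the deduction rule and double
  -- negation would derive φ.
  have hcons : ¬ D S (Γ ∪ {neg φ}) (bot S) := fun h0 => by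
    have h1 := hD.deduction S hS Γ (neg φ) (bot S) h0
    have h2 : D S Γ (imp (neg (neg φ)) φ) := hD.assumption S hS _ _ <| Or.inr <|
      Ax.taut _ _ fun v hb hi => by simp only [neg, hi]; tauto
    refine hφ (hD.cut S hS Γ {neg (neg φ), imp (neg (neg φ)) φ} φ ?_ (hD.modusPonens S hS _ _))
    rintro ψ (rfl | rfl)
    · exact h1
    · exact h2
  obtain ⟨x, hx, hm⟩ := hL S hS _ hcons
  exact ((hm.isVal hD hS).neg φ).1 (hx (Or.inr rfl))
    (h x hm fun γ hγ => hx (Or.inl hγ))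

/-! ### Cuts in the unit interval -/

/-- The supremum of a set of points of the unit interval. -/
def cutVal (R : I → Prop) : ℝ := sSup {t : ℝ | ∃ q : I, R q ∧ t = q}

section Cut

variable {R L : I → Prop}

theorem isLUB_cutVal (h0 : R 0) : IsLUB {t : ℝ | ∃ q : I, R q ∧ t = q} (cutVal R) := by
  refine isLUB_csSup ⟨0, 0, h0, rfl⟩ ⟨1, ?_⟩
  rintro _ ⟨q, -, rfl⟩
  exact q.2.2

theorem cutVal_nonneg (h0 : R 0) : 0 ≤ cutVal R := (isLUB_cutVal h0).1 ⟨0, h0, rfl⟩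

theorem cutVal_le_one (h0 : R 0) : cutVal R ≤ 1 := by
  refine (isLUB_cutVal h0).2 ?_
  rintro _ ⟨q, -, rfl⟩
  exact q.2.2

theorem cutVal_mono {R' : I → Prop} (h0 : R 0) (h : ∀ q, R q → R' q) :
    cutVal R ≤ cutVal R' := by
  refine (isLUB_cutVal h0).2 ?_
  rintro _ ⟨q, hq, rfl⟩
  exact (isLUB_cutVal (h 0 h0)).1 ⟨q, h q hq, rfl⟩

variable (h1 : ∀ p q, p < q → L p → ¬ R q) (h2 : ∀ p, ¬ R p → L p)
  (h3 : ∀ p, (∀ q < p, R q) → R p)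
include h1 h2 h3

/-- Here R plays "≥" and L plays "≤". The first two hypotheses let R pass from a bound to any
smaller one; the Archimedean third says that the supremum is attained, and gives R 0 vacuously. -/
theorem le_cutVal_iff (p : I) : R p ↔ (p : ℝ) ≤ cutVal R := by
  have h0 : R 0 := h3 0 fun q hq => absurd hq (not_lt.2 q.2.1)
  refine ⟨fun h => (isLUB_cutVal h0).1 ⟨p, h, rfl⟩, fun h => h3 p fun q hq => ?_⟩
  obtain ⟨_, ⟨r, hr, rfl⟩, hqr, -⟩ := (isLUB_cutVal h0).exists_between
    (lt_of_lt_of_le (show (q : ℝ) < p from hq) h)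
  by_contra hR
  exact h1 q r hqr (h2 q hR) hr

theorem cutVal_le_iff (h4 : ∀ p, (∀ q, p < q → L q) → L p) (p : I) :
    L p ↔ cutVal R ≤ p := by
  refine ⟨fun h => ?_, fun h => h4 p fun q hq => h2 q fun hR => ?_⟩
  · by_contra! hlt
    have h0 : R 0 := h3 0 fun q hq => absurd hq (not_lt.2 q.2.1)
    obtain ⟨_, ⟨r, hr, rfl⟩, hpr, -⟩ := (isLUB_cutVal h0).exists_between hlt
    exact h1 p r hpr h hr
  · rw [le_cutVal_iff h1 h2 h3] at hR
    exact absurd (hR.trans h) (not_le.2 hq)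

end Cut

/-! ### The measures given by maximal sets -/

/-- The measure of a formula according to a set of formulas. -/
def uVal {κ : Kind} (x : Set (Form M T (.cap κ S))) (φ : MForm M T S) : ℝ :=
  cutVal fun q => uGe κ q φ ∈ x

/-- The probability of a formula according to a set of formulas. -/
def pVal (x : Set (Form M T (.prob S))) (φ : MForm M T S) : ℝ :=
  cutVal fun q => pGe q φ ∈ x

section Values

variable (hD : IsDeductionSystem M T D) {κ : Kind}

namespace IsMaximal

section Cap

variable (hS : .cap κ S ∈ T.Ing) {x : Set (Form M T (.cap κ S))} (hx : IsMaximal D (.cap κ S) x)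
include hD hS hx

theorem uLe_uGe {p q : I} (hpq : p < q) {φ : MForm M T S} (h : uLe κ p φ ∈ x) :
    uGe κ q φ ∉ x :=
  ((hx.isVal hD hS).neg _).1
    (((hx.isVal hD hS).imp _ _).1 (hx.mem_of_ax hD hS (Ax.le_lt κ S p q φ hpq)) h)

theorem uLe_of_uGe_notMem {p : I} {φ : MForm M T S} (h : uGe κ p φ ∉ x) : uLe κ p φ ∈ x :=
  ((hx.isVal hD hS).imp _ _).1 (hx.mem_of_ax hD hS (Ax.lt_le κ S p φ))
    (((hx.isVal hD hS).neg _).2 h)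

theorem uGe_of_forall {p : I} {φ : MForm M T S} (h : ∀ q < p, uGe κ q φ ∈ x) :
    uGe κ p φ ∈ x := by
  refine hx.mem_of_derivable hD hS ?_ (hD.arch_u κ S hS p φ)
  rintro _ ⟨q, hq, rfl⟩
  exact h q hq

theorem uLe_of_forall {p : I} {φ : MForm M T S} (h : ∀ q, p < q → uLe κ q φ ∈ x) :
    uLe κ p φ ∈ x := by
  -- `uLe κ p φ` is by definition `lGe κ (σ p) (neg φ)`, so upper bounds are closed downwards by the
  -- Archimedean rule for L, read through q ↦ 1 - q.
  refine hx.mem_of_derivable hD hS ?_ (hD.arch_l κ S hS (σ p) (neg φ))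
  rintro _ ⟨q, hq, rfl⟩
  have := h (σ q) (by rwa [← unitInterval.symm_lt_symm, unitInterval.symm_symm])
  rwa [uLe, unitInterval.symm_symm] at this

theorem uGe_zero (φ : MForm M T S) : uGe κ 0 φ ∈ x :=
  hx.uGe_of_forall hD hS fun q hq => absurd hq (not_lt.2 q.2.1)

theorem uGe_iff (p : I) (φ : MForm M T S) : uGe κ p φ ∈ x ↔ (p : ℝ) ≤ uVal x φ :=
  le_cutVal_iff (L := fun p => uLe κ p φ ∈ x) (fun _ _ h => hx.uLe_uGe hD hS h)
    (fun _ => hx.uLe_of_uGe_notMem hD hS) (fun _ => hx.uGe_of_forall hD hS) p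

theorem uLe_iff (p : I) (φ : MForm M T S) : uLe κ p φ ∈ x ↔ uVal x φ ≤ p :=
  cutVal_le_iff (L := fun p => uLe κ p φ ∈ x) (fun _ _ h => hx.uLe_uGe hD hS h)
    (fun _ => hx.uLe_of_uGe_notMem hD hS) (fun _ => hx.uGe_of_forall hD hS)
    (fun _ => hx.uLe_of_forall hD hS) p

/-- `uLe κ (σ p) (neg φ)` unfolds to a lower bound for ¬¬φ rather than φ; the duality axiom bridges
the two. -/
theorem lGe_iff (p : I) (φ : MForm M T S) : lGe κ p φ ∈ x ↔ (p : ℝ) ≤ 1 - uVal x (neg φ) := by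
  rw [((hx.isVal hD hS).iff _ _).1 (hx.mem_of_ax hD hS (Ax.dual κ S p φ)), hx.uLe_iff hD hS,
    unitInterval.coe_symm_eq]
  exact le_sub_comm

theorem box_iff (p q : I) (φ : MForm M T S) :
    box κ p q φ ∈ x ↔ (p : ℝ) ≤ uVal x φ ∧ (q : ℝ) ≤ 1 - uVal x (neg φ) := by
  rw [((hx.isVal hD hS).iff _ _).1 (hx.mem_of_ax hD hS (Ax.split κ S p q φ)),
    (hx.isVal hD hS).and, hx.uGe_iff hD hS, hx.lGe_iff hD hS]

theorem isLUB_uVal (φ : MForm M T S) :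
    IsLUB {t : ℝ | ∃ q : I, uGe κ q φ ∈ x ∧ t = q} (uVal x φ) :=
  isLUB_cutVal (hx.uGe_zero hD hS φ)

theorem uVal_nonneg (φ : MForm M T S) : 0 ≤ uVal x φ := cutVal_nonneg (hx.uGe_zero hD hS φ)

theorem uVal_le_one (φ : MForm M T S) : uVal x φ ≤ 1 := cutVal_le_one (hx.uGe_zero hD hS φ)

/-- Inclusion of |φ| in |ψ| makes φ → ψ derivable, by the Lindenbaum property; necessitation and the
monotonicity axiom then transfer every lower bound. In particular the value of φ depends only on
|φ|. -/
theorem uVal_mono (hL : IsLindenbaum D) {φ ψ : MForm M T S}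
    (h : sat D φ.toForm ⊆ sat D ψ.toForm) : uVal x φ ≤ uVal x ψ := by
  refine cutVal_mono (hx.uGe_zero hD hS φ) fun q => ?_
  have h1 : D S ∅ (imp φ ψ).toForm := hL.derivable hD (PF.cap_arg hS) fun y hy _ =>
    ((hy.isVal_toForm hD (PF.cap_arg hS)).imp φ ψ).2 fun hφ => h (a := ⟨y, hy⟩) hφ
  have h2 := hx.mem_of_derivable hD hS (Set.empty_subset x)
    (hD.necessitation κ S hS (imp φ ψ) h1)
  exact ((hx.isVal hD hS).imp _ _).1
    (((hx.isVal hD hS).imp _ _).1 (hx.mem_of_ax hD hS (Ax.mono κ S q φ ψ)) h2)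

end Cap

section Prob

variable (hS : .prob S ∈ T.Ing) {x : Set (Form M T (.prob S))} (hx : IsMaximal D (.prob S) x)
include hD hS hx

theorem pLe_pGe {p q : I} (hpq : p < q) {φ : MForm M T S} (h : pLe p φ ∈ x) :
    pGe q φ ∉ x :=
  ((hx.isVal hD hS).neg _).1
    (((hx.isVal hD hS).imp _ _).1 (hx.mem_of_ax hD hS (Ax.prob_le_lt S p q φ hpq)) h)

theorem pLe_of_pGe_notMem {p : I} {φ : MForm M T S} (h : pGe p φ ∉ x) : pLe p φ ∈ x :=
  ((hx.isVal hD hS).imp _ _).1 (hx.mem_of_ax hD hS (Ax.prob_lt_le S p φ))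
    (((hx.isVal hD hS).neg _).2 h)

theorem pGe_of_forall {p : I} {φ : MForm M T S} (h : ∀ q < p, pGe q φ ∈ x) :
    pGe p φ ∈ x := by
  refine hx.mem_of_derivable hD hS ?_ (hD.prob_arch S hS p φ)
  rintro _ ⟨q, hq, rfl⟩
  exact h q hq

theorem pLe_of_forall {p : I} {φ : MForm M T S} (h : ∀ q, p < q → pLe q φ ∈ x) :
    pLe p φ ∈ x := by
  refine hx.pGe_of_forall hD hS fun q hq => ?_
  have := h (σ q) (by rwa [← unitInterval.symm_lt_symm, unitInterval.symm_symm])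
  rwa [pLe, unitInterval.symm_symm] at this

theorem pGe_zero (φ : MForm M T S) : pGe 0 φ ∈ x :=
  hx.pGe_of_forall hD hS fun q hq => absurd hq (not_lt.2 q.2.1)

theorem pGe_iff (p : I) (φ : MForm M T S) : pGe p φ ∈ x ↔ (p : ℝ) ≤ pVal x φ :=
  le_cutVal_iff (L := fun p => pLe p φ ∈ x) (fun _ _ h => hx.pLe_pGe hD hS h)
    (fun _ => hx.pLe_of_pGe_notMem hD hS) (fun _ => hx.pGe_of_forall hD hS) p

theorem pLe_iff (p : I) (φ : MForm M T S) : pLe p φ ∈ x ↔ pVal x φ ≤ p :=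
  cutVal_le_iff (L := fun p => pLe p φ ∈ x) (fun _ _ h => hx.pLe_pGe hD hS h)
    (fun _ => hx.pLe_of_pGe_notMem hD hS) (fun _ => hx.pGe_of_forall hD hS)
    (fun _ => hx.pLe_of_forall hD hS) p

theorem isLUB_pVal (φ : MForm M T S) :
    IsLUB {t : ℝ | ∃ q : I, pGe q φ ∈ x ∧ t = q} (pVal x φ) :=
  isLUB_cutVal (hx.pGe_zero hD hS φ)

theorem pVal_nonneg (φ : MForm M T S) : 0 ≤ pVal x φ := cutVal_nonneg (hx.pGe_zero hD hS φ)

theorem pVal_le_one (φ : MForm M T S) : pVal x φ ≤ 1 := cutVal_le_one (hx.pGe_zero hD hS φ)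

/-- As P_{≤p} φ abbreviates P_{≥1-p} ¬φ, the conditions 1 - p ≤ P(¬φ) and P(φ) ≤ p are equivalent.
Taking p = 1 - P(¬φ) and p = P(φ) gives the two inequalities. -/
theorem pVal_neg (φ : MForm M T S) : pVal x (neg φ) = 1 - pVal x φ := by
  have key : ∀ p : I, ((σ p : I) : ℝ) ≤ pVal x (neg φ) ↔ pVal x φ ≤ p := fun p =>
    (hx.pGe_iff hD hS (σ p) (neg φ)).symm.trans (hx.pLe_iff hD hS p φ)
  have h0 := hx.pVal_nonneg hD hS
  have h1 := hx.pVal_le_one hD hS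
  refine le_antisymm ?_ ?_
  · have := (key (σ ⟨pVal x (neg φ), h0 _, h1 _⟩)).1 (by rw [unitInterval.symm_symm])
    rw [unitInterval.coe_symm_eq] at this
    change pVal x φ ≤ 1 - pVal x (neg φ) at this
    linarith
  · exact (key ⟨pVal x φ, h0 _, h1 _⟩).2 le_rfl

theorem pVal_mono (hL : IsLindenbaum D) {φ ψ : MForm M T S}
    (h : sat D φ.toForm ⊆ sat D ψ.toForm) : pVal x φ ≤ pVal x ψ := by
  refine cutVal_mono (hx.pGe_zero hD hS φ) fun q => ?_
  have h1 : D S ∅ (imp φ ψ).toForm := hL.derivable hD (PF.prob_arg hS) fun y hy _ =>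
    ((hy.isVal_toForm hD (PF.prob_arg hS)).imp φ ψ).2 fun hφ => h (a := ⟨y, hy⟩) hφ
  have h2 := hx.mem_of_derivable hD hS (Set.empty_subset x)
    (hD.prob_necessitation S hS (imp φ ψ) h1)
  exact ((hx.isVal hD hS).imp _ _).1
    (((hx.isVal hD hS).imp _ _).1 (hx.mem_of_ax hD hS (Ax.prob_mono S q φ ψ)) h2)

end Prob

end IsMaximal

end Values

/-! ### The measurable sets of maximal sets -/

section SatAlg

variable (hD : IsDeductionSystem M T D) (hS : S ∈ T.Ing)

/-- The measurable set of the maximal sets that contain a measurable formula. -/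
def satAlg (φ : MForm M T S) : (maxSpace hD hS).alg := ⟨sat D φ.toForm, φ, rfl⟩

theorem exists_eq_satAlg (U : (maxSpace hD hS).alg) : ∃ φ, U = satAlg hD hS φ := by
  obtain ⟨φ, h⟩ := U.2
  exact ⟨φ, Subtype.ext h⟩

theorem satAlg_neg (φ : MForm M T S) : satAlg hD hS (neg φ) = (satAlg hD hS φ)ᶜ :=
  Subtype.ext <| Set.ext fun x => (x.2.isVal_toForm hD hS).neg φ

theorem satAlg_bot : satAlg hD hS (bot S) = ⊥ :=
  Subtype.ext <| Set.ext fun x => iff_of_false (x.2.isVal_toForm (b := true) hD hS).bot id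

theorem satAlg_or (φ ψ : MForm M T S) :
    satAlg hD hS (or φ ψ) = satAlg hD hS φ ⊔ satAlg hD hS ψ :=
  Subtype.ext <| Set.ext fun x => (x.2.isVal_toForm hD hS).or φ ψ

theorem satAlg_bigOr {ι : Type*} (s : Finset ι) (φ : ι → MForm M T S) :
    satAlg hD hS (bigOr s φ) = s.sup fun i => satAlg hD hS (φ i) := by
  refine Subtype.ext <| Set.ext fun x => ((x.2.isVal_toForm hD hS).bigOr s φ).trans ?_
  rw [coe_finset_sup, Set.mem_iUnion₂]
  exact ⟨fun ⟨i, hi, h⟩ => ⟨i, hi, h⟩, fun ⟨i, hi, h⟩ => ⟨i, hi, h⟩⟩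

theorem satAlg_bigAnd {ι : Type*} (s : Finset ι) (φ : ι → MForm M T S) :
    satAlg hD hS (bigAnd s φ) = s.inf fun i => satAlg hD hS (φ i) := by
  refine Subtype.ext <| Set.ext fun x => ((x.2.isVal_toForm hD hS).bigAnd s φ).trans ?_
  rw [coe_finset_inf, Set.mem_iInter₂]
  exact Iff.rfl

/-- The cover inequalities follow from the cover rules. -/
theorem coverIneq_of_rules (hL : IsLindenbaum D) {g : (maxSpace hD hS).alg → ℝ}
    (h0 : ∀ U, 0 ≤ g U) (h1 : ∀ U, g U ≤ 1)
    (hc : ∀ (m n k : ℕ), 1 ≤ n → ∀ (φ : MForm M T S) (Φ : Fin m → MForm M T S) (P : Fin m → I)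
      (p : I), (p : ℝ) = max 0 (min 1 ((∑ i, (P i : ℝ) - k) / n)) →
      D S ∅ (imp φ (atLeast (n + k) Φ)).toForm → D S ∅ (atLeast k Φ).toForm →
      (∀ i, g (satAlg hD hS (Φ i)) ≤ P i) → g (satAlg hD hS φ) ≤ p)
    (hn : ∀ (m k : ℕ) (Φ : Fin m → MForm M T S) (P : Fin m → I),
      ∑ i, (P i : ℝ) < k → D S ∅ (atLeast k Φ).toForm →
      ¬ ∀ i, g (satAlg hD hS (Φ i)) ≤ P i) :
    CoverIneq (maxSpace hD hS) g := by
  intro m n k U V hk hU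
  obtain ⟨φ, rfl⟩ := exists_eq_satAlg hD hS U
  choose Φ hΦ using fun i => exists_eq_satAlg hD hS (V i)
  obtain rfl : V = fun i => satAlg hD hS (Φ i) := funext hΦ
  have d1 : D S ∅ (atLeast k Φ).toForm := hL.derivable hD hS fun y hy _ =>
    ((hy.isVal_toForm hD hS).atLeast k Φ).2 (hk ⟨y, hy⟩)
  have d2 : D S ∅ (imp φ (atLeast (n + k) Φ)).toForm := hL.derivable hD hS fun y hy _ =>
    ((hy.isVal_toForm hD hS).imp _ _).2 fun h =>
      ((hy.isVal_toForm hD hS).atLeast _ Φ).2 (hU ⟨y, hy⟩ h)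
  -- The bounds in the rules are taken to be the values themselves, so the premises hold with
  -- equality.
  let P : Fin m → I := fun i => ⟨g (satAlg hD hS (Φ i)), h0 _, h1 _⟩
  -- The refutation rule excludes a sum below k. This settles n = 0 and, for n ≥ 1, makes the
  -- clipping at 0 inactive.
  have hs : (k : ℝ) ≤ ∑ i, (P i : ℝ) := by
    by_contra! hlt
    exact hn m k Φ P hlt d1 fun i => le_rfl
  rcases Nat.eq_zero_or_pos n with rfl | hn0
  · simpa using hs
  · have hn' : (0 : ℝ) < n := by exact_mod_cast hn0
    have h2 := hc m n k hn0 φ Φ P ⟨max 0 (min 1 ((∑ i, (P i : ℝ) - k) / n)), le_max_left _ _,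
      max_le zero_le_one (min_le_left _ _)⟩ rfl d2 d1 fun i => le_rfl
    have h3 : g (satAlg hD hS φ) ≤ (∑ i, (P i : ℝ) - k) / n :=
      h2.trans (max_le (div_nonneg (by linarith) hn'.le) (min_le_right _ _))
    rw [le_div_iff₀ hn'] at h3
    change _ ≤ ∑ i, (P i : ℝ)
    linarith

end SatAlg

/-! ### Measures on the spaces of maximal sets -/

section Measures

variable (hD : IsDeductionSystem M T D) (hL : IsLindenbaum D) {κ : Kind}

section Cap

variable (hS : .cap κ S ∈ T.Ing) (x : MaxSet D (.cap κ S))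

/-- The function on measurable sets of maximal sets that a maximal set of sort `cap κ S` gives. -/
def maxCapFun (U : (maxSpace hD (PF.cap_arg hS)).alg) : ℝ :=
  uVal x.1 (exists_eq_satAlg hD (PF.cap_arg hS) U).choose

theorem maxCapFun_nonneg (U) : 0 ≤ maxCapFun hD hS x U := x.2.uVal_nonneg hD hS _

theorem maxCapFun_le_one (U) : maxCapFun hD hS x U ≤ 1 := x.2.uVal_le_one hD hS _

-- The formula chosen to represent |φ| may differ from φ, but it has the same maximal sets, and
-- `uVal_mono` applies both ways.
include hL in
theorem maxCapFun_satAlg (φ : MForm M T S) :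
    maxCapFun hD hS x (satAlg hD (PF.cap_arg hS) φ) = uVal x.1 φ := by
  have h := congrArg Subtype.val
    (exists_eq_satAlg hD (PF.cap_arg hS) (satAlg hD (PF.cap_arg hS) φ)).choose_spec
  exact le_antisymm (x.2.uVal_mono hD hS hL h.ge) (x.2.uVal_mono hD hS hL h.le)

include hL

/-- Necessitation gives L_{≥1} ¬⊥, which says that ¬¬⊥ has value 0; monotonicity passes this to ⊥.
-/
theorem maxCapFun_bot : maxCapFun hD hS x ⊥ = 0 := by
  have hS' := PF.cap_arg hS
  rw [← satAlg_bot hD hS', maxCapFun_satAlg hD hL hS]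
  refine le_antisymm ?_ (x.2.uVal_nonneg hD hS _)
  have h1 : D S ∅ (neg (bot (M := M) (T := T) (b := true) S)).toForm :=
    hL.derivable hD hS' fun y hy _ =>
      ((hy.isVal_toForm (b := true) hD hS').neg _).2 (hy.isVal_toForm (b := true) hD hS').bot
  have h2 := (x.2.lGe_iff hD hS _ _).1 (x.2.mem_of_derivable hD hS (Set.empty_subset _)
    (hD.necessitation κ S hS _ h1))
  have h3 := x.2.uVal_mono hD hS hL (φ := bot S) (ψ := neg (neg (bot S))) fun y hy =>
    absurd hy (y.2.isVal_toForm (b := true) hD hS').bot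
  rw [Set.Icc.coe_one] at h2
  linarith

/-- The axiom U_{≤p} φ → L_{≤p} φ at p = 0, φ = ⊥ yields L_{≤0} ⊥, which unfolds to U_{≥1} ¬⊥. For
upper probabilities, where this axiom is absent, normalization comes from the cover inequalities. -/
theorem maxCapFun_top (hκ : κ ≠ .upper) : maxCapFun hD hS x ⊤ = 1 := by
  have hS' := PF.cap_arg hS
  refine le_antisymm (maxCapFun_le_one hD hS x _) ?_
  have h0 := maxCapFun_bot hD hL hS x
  rw [← compl_bot, ← satAlg_bot hD hS', ← satAlg_neg, maxCapFun_satAlg hD hL hS]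
  rw [← satAlg_bot hD hS', maxCapFun_satAlg hD hL hS] at h0
  have h1 : uLe κ 0 (bot S) ∈ x.1 := (x.2.uLe_iff hD hS _ _).2 h0.le
  have h2 : lLe κ 0 (bot S) ∈ x.1 := ((x.2.isVal hD hS).imp _ _).1
    (x.2.mem_of_ax hD hS (Ax.le_dual κ S 0 _ hκ)) h1
  have h3 := (x.2.uGe_iff hD hS (σ 0) (neg (bot S))).1 h2
  rwa [unitInterval.symm_zero, Set.Icc.coe_one] at h3

end Cap

include hL in
theorem isUpper_maxCapFun (hS : .cap .upper S ∈ T.Ing) (x : MaxSet D (.cap .upper S)) :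
    IsUpper (maxSpace hD (PF.cap_arg hS)) (maxCapFun hD hS x) := by
  have hS' := PF.cap_arg hS
  have hc : CoverIneq (maxSpace hD hS') (maxCapFun hD hS x) := by
    refine coverIneq_of_rules hD hS' hL (maxCapFun_nonneg hD hS x)
      (maxCapFun_le_one hD hS x) ?_ ?_
    · intro m n k hn φ Φ P p hp d1 d2 h
      simp only [maxCapFun_satAlg hD hL hS] at h ⊢
      refine (x.2.uLe_iff hD hS p φ).1 (((x.2.isVal hD hS).imp _ _).1
        (x.2.mem_of_derivable hD hS (Set.empty_subset _)
          (hD.cover S hS m n k hn φ Φ P p hp d1 d2)) ?_)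
      exact ((x.2.isVal hD hS).bigAnd _ _).2 fun i _ => (x.2.uLe_iff hD hS _ _).2 (h i)
    · intro m k Φ P hP d1 h
      simp only [maxCapFun_satAlg hD hL hS] at h
      refine ((x.2.isVal hD hS).neg _).1 (x.2.mem_of_derivable hD hS (Set.empty_subset _)
        (hD.cover_neg S hS m k Φ P hP d1)) ?_
      exact ((x.2.isVal hD hS).bigAnd _ _).2 fun i _ => (x.2.uLe_iff hD hS _ _).2 (h i)
  refine hc.isUpper (le_antisymm (maxCapFun_le_one hD hS x _) ?_)
  -- The single set ⊤ covers every point once, so 1 ≤ g ⊤.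
  simpa using hc 1 0 1 ⊥ (fun _ => ⊤) (by simp) (by simp)

include hL in
theorem isPlaus_maxCapFun (hS : .cap .plaus S ∈ T.Ing) (x : MaxSet D (.cap .plaus S)) :
    IsPlaus (maxSpace hD (PF.cap_arg hS)) (maxCapFun hD hS x) where
  nonneg := maxCapFun_nonneg hD hS x
  le_one := maxCapFun_le_one hD hS x
  empty := maxCapFun_bot hD hL hS x
  univ := maxCapFun_top hD hL hS x (by simp)
  inter_le n hn U := by
    have hS' := PF.cap_arg hS
    choose φ hφ using fun i => exists_eq_satAlg hD hS' (U i)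
    obtain rfl : U = fun i => satAlg hD hS' (φ i) := funext hφ
    rw [← satAlg_bigAnd, maxCapFun_satAlg hD hL hS]
    -- With the exact values of the joins as bounds, the premise of the plausibility axioms belongs
    -- to x; a negative alternating sum would then make x inconsistent.
    let P : Finset (Fin n) → I := fun J =>
      ⟨uVal x.1 (bigOr J φ), x.2.uVal_nonneg hD hS _, x.2.uVal_le_one hD hS _⟩
    have hB : bigAnd (Finset.univ.filter Finset.Nonempty)
        (fun J => uAlt .plaus J.card (P J) (bigOr J φ)) ∈ x.1 := by
      refine ((x.2.isVal hD hS).bigAnd _ _).2 fun J _ => ?_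
      rw [uAlt]
      split_ifs
      · exact (x.2.uLe_iff hD hS _ _).2 le_rfl
      · exact (x.2.uGe_iff hD hS _ _).2 le_rfl
    have hsum : ∑ J : Finset (Fin n) with J.Nonempty, (-1 : ℝ) ^ (J.card + 1) *
          maxCapFun hD hS x (J.sup fun i => satAlg hD hS' (φ i)) =
        ∑ J : Finset (Fin n) with J.Nonempty, (-1 : ℝ) ^ (J.card + 1) * (P J : ℝ) :=
      Finset.sum_congr rfl fun J _ => by
        rw [← satAlg_bigOr, maxCapFun_satAlg hD hL hS]
    rw [hsum]
    rcases lt_or_ge (∑ J : Finset (Fin n) with J.Nonempty,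
      (-1 : ℝ) ^ (J.card + 1) * (P J : ℝ)) 0 with h | h
    · exact absurd hB (((x.2.isVal hD hS).neg _).1
        (x.2.mem_of_ax hD hS (Ax.plaus_neg S n φ P hn h)))
    · have h1 := (x.2.uLe_iff hD hS _ _).1 (((x.2.isVal hD hS).imp _ _).1
        (x.2.mem_of_ax hD hS (Ax.plaus_le S n φ P
          ⟨_, le_min h zero_le_one, min_le_right _ _⟩ hn h rfl)) hB)
      exact h1.trans (min_le_left _ _)

include hL in
theorem isPoss_maxCapFun (hS : .cap .poss S ∈ T.Ing) (x : MaxSet D (.cap .poss S)) :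
    IsPoss (maxSpace hD (PF.cap_arg hS)) (maxCapFun hD hS x) where
  nonneg := maxCapFun_nonneg hD hS x
  le_one := maxCapFun_le_one hD hS x
  empty := maxCapFun_bot hD hL hS x
  univ := maxCapFun_top hD hL hS x (by simp)
  union U V := by
    have hS' := PF.cap_arg hS
    obtain ⟨φ, rfl⟩ := exists_eq_satAlg hD hS' U
    obtain ⟨ψ, rfl⟩ := exists_eq_satAlg hD hS' V
    rw [← satAlg_or, maxCapFun_satAlg hD hL hS, maxCapFun_satAlg hD hL hS,
      maxCapFun_satAlg hD hL hS]
    refine le_antisymm ?_ (max_le ?_ ?_)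
    · let p : I := ⟨uVal x.1 φ, x.2.uVal_nonneg hD hS _, x.2.uVal_le_one hD hS _⟩
      let q : I := ⟨uVal x.1 ψ, x.2.uVal_nonneg hD hS _, x.2.uVal_le_one hD hS _⟩
      have h1 := (x.2.uLe_iff hD hS _ _).1 (((x.2.isVal hD hS).imp _ _).1
        (x.2.mem_of_ax hD hS (Ax.poss_or S p q φ ψ)) (((x.2.isVal hD hS).and _ _).2
          ⟨(x.2.uLe_iff hD hS _ _).2 le_rfl, (x.2.uLe_iff hD hS _ _).2 le_rfl⟩))
      rwa [Monotone.map_max (f := ((↑) : I → ℝ)) fun _ _ h => h] at h1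
    · exact x.2.uVal_mono hD hS hL fun y hy => ((y.2.isVal_toForm hD hS').or φ ψ).2 (Or.inl hy)
    · exact x.2.uVal_mono hD hS hL fun y hy => ((y.2.isVal_toForm hD hS').or φ ψ).2 (Or.inr hy)

include hL in
theorem isMeas_maxCapFun (hS : .cap κ S ∈ T.Ing) (x : MaxSet D (.cap κ S)) :
    κ.IsMeas (maxSpace hD (PF.cap_arg hS)) (maxCapFun hD hS x) := by
  cases κ with
  | upper => exact isUpper_maxCapFun hD hL hS x
  | plaus => exact isPlaus_maxCapFun hD hL hS x
  | poss => exact isPoss_maxCapFun hD hL hS x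

section Prob

variable (hS : .prob S ∈ T.Ing) (x : MaxSet D (.prob S))

/-- The function on measurable sets of maximal sets that a maximal set of sort `prob S` gives. -/
def maxPrbFun (U : (maxSpace hD (PF.prob_arg hS)).alg) : ℝ :=
  pVal x.1 (exists_eq_satAlg hD (PF.prob_arg hS) U).choose

include hL

theorem maxPrbFun_satAlg (φ : MForm M T S) :
    maxPrbFun hD hS x (satAlg hD (PF.prob_arg hS) φ) = pVal x.1 φ := by
  have h := congrArg Subtype.val
    (exists_eq_satAlg hD (PF.prob_arg hS) (satAlg hD (PF.prob_arg hS) φ)).choose_spec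
  exact le_antisymm (x.2.pVal_mono hD hS hL h.ge) (x.2.pVal_mono hD hS hL h.le)

/-- The cover rules give subadditivity and superadditivity once the measure of a complement is
known, so no additivity axiom is needed. -/
theorem isProb_maxPrbFun : IsProb (maxSpace hD (PF.prob_arg hS)) (maxPrbFun hD hS x) := by
  have hS' := PF.prob_arg hS
  refine CoverIneq.isProb ?_ (fun U => x.2.pVal_nonneg hD hS _) fun U => ?_
  · refine coverIneq_of_rules hD hS' hL (fun U => x.2.pVal_nonneg hD hS _)
      (fun U => x.2.pVal_le_one hD hS _) ?_ ?_
    · intro m n k hn φ Φ P p hp d1 d2 h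
      simp only [maxPrbFun_satAlg hD hL hS] at h ⊢
      refine (x.2.pLe_iff hD hS p φ).1 (((x.2.isVal hD hS).imp _ _).1
        (x.2.mem_of_derivable hD hS (Set.empty_subset _)
          (hD.prob_cover S hS m n k hn φ Φ P p hp d1 d2)) ?_)
      exact ((x.2.isVal hD hS).bigAnd _ _).2 fun i _ => (x.2.pLe_iff hD hS _ _).2 (h i)
    · intro m k Φ P hP d1 h
      simp only [maxPrbFun_satAlg hD hL hS] at h
      refine ((x.2.isVal hD hS).neg _).1 (x.2.mem_of_derivable hD hS (Set.empty_subset _)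
        (hD.prob_cover_neg S hS m k Φ P hP d1)) ?_
      exact ((x.2.isVal hD hS).bigAnd _ _).2 fun i _ => (x.2.pLe_iff hD hS _ _).2 (h i)
  · obtain ⟨φ, rfl⟩ := exists_eq_satAlg hD hS' U
    rw [← satAlg_neg, maxPrbFun_satAlg hD hL hS, maxPrbFun_satAlg hD hL hS,
      x.2.pVal_neg hD hS]

end Prob

end Measures

end MaximalSets

/-! ### The canonical coalgebra: construction, uniqueness, truth and finality -/

section CanonicalCoalgebra

variable {K : Type u} {M : K → Unc.{u}} {T : PF K} {b : Bool} {S S₁ S₂ : PF K}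
  {D : Entailment M T}

/-! ### Maps between spaces of maximal sets -/

namespace IsMaximal

variable (hD : IsDeductionSystem M T D)
include hD

theorem preimage_next {x : Set (Form M T .id)} (hx : IsMaximal D .id x) :
    IsMaximal D T (next ⁻¹' x) :=
  hx.preimage hD T.id_mem T.self_mem hD.box_next Ax.next_neg
    (((hx.isVal hD T.id_mem).neg _).1 (hx.mem_of_ax hD T.id_mem Ax.next_bot))

theorem preimage_pr₁ (h : .prod S₁ S₂ ∈ T.Ing) {x : Set (Form M T (.prod S₁ S₂))}
    (hx : IsMaximal D (.prod S₁ S₂) x) : IsMaximal D S₁ (pr₁ ⁻¹' x) :=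
  hx.preimage hD h (PF.prod_left h) (hD.box_pr₁ S₁ S₂ h) (Ax.pr₁_neg S₁ S₂)
    (((hx.isVal hD h).neg _).1 (hx.mem_of_ax hD h (Ax.pr₁_bot S₁ S₂)))

theorem preimage_pr₂ (h : .prod S₁ S₂ ∈ T.Ing) {x : Set (Form M T (.prod S₁ S₂))}
    (hx : IsMaximal D (.prod S₁ S₂) x) : IsMaximal D S₂ (pr₂ ⁻¹' x) :=
  hx.preimage hD h (PF.prod_right h) (hD.box_pr₂ S₁ S₂ h) (Ax.pr₂_neg S₁ S₂)
    (((hx.isVal hD h).neg _).1 (hx.mem_of_ax hD h (Ax.pr₂_bot S₁ S₂)))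

theorem preimage_in₁ (h : .sum S₁ S₂ ∈ T.Ing) {x : Set (Form M T (.sum S₁ S₂))}
    (hx : IsMaximal D (.sum S₁ S₂) x) (hb : in₁ (bot S₁) ∉ x) : IsMaximal D S₁ (in₁ ⁻¹' x) :=
  hx.preimage hD h (PF.sum_left h) (hD.box_in₁ S₁ S₂ h) (Ax.in₁_neg S₁ S₂) hb

theorem preimage_in₂ (h : .sum S₁ S₂ ∈ T.Ing) {x : Set (Form M T (.sum S₁ S₂))}
    (hx : IsMaximal D (.sum S₁ S₂) x) (hb : in₂ (bot S₂) ∉ x) : IsMaximal D S₂ (in₂ ⁻¹' x) :=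
  hx.preimage hD h (PF.sum_right h) (hD.box_in₂ S₁ S₂ h) (Ax.in₂_neg S₁ S₂) hb

theorem in_bot_iff (h : .sum S₁ S₂ ∈ T.Ing) {x : Set (Form M T (.sum S₁ S₂))}
    (hx : IsMaximal D (.sum S₁ S₂) x) : in₁ (bot S₁) ∉ x ↔ in₂ (bot S₂) ∈ x := by
  have := ((hx.isVal hD h).iff _ _).1 (hx.mem_of_ax hD h (Ax.in_bot S₁ S₂))
  rwa [(hx.isVal hD h).neg] at this

/-- When [in₁]⊥ ∈ x, the set x describes a point of the right summand, where [in₁]φ holds vacuously;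
the box rule applied to ⊥ ⊢ φ reflects this. -/
theorem in₁_mem (h : .sum S₁ S₂ ∈ T.Ing) {x : Set (Form M T (.sum S₁ S₂))}
    (hx : IsMaximal D (.sum S₁ S₂) x) (hb : in₁ (bot S₁) ∈ x) (φ : Form M T S₁) :
    in₁ φ ∈ x := by
  refine hx.mem_of_derivable hD h (Γ := in₁ '' {bot S₁}) ?_
    (hD.box_in₁ S₁ S₂ h {bot S₁} φ ?_)
  · rintro _ ⟨_, rfl, rfl⟩
    exact hb
  · refine hD.cut S₁ (PF.sum_left h) _ {bot S₁, imp (bot S₁) φ} φ ?_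
      (hD.modusPonens S₁ (PF.sum_left h) _ _)
    rintro _ (rfl | rfl)
    · exact hD.assumption S₁ (PF.sum_left h) _ _ (Or.inl rfl)
    · exact hD.assumption S₁ (PF.sum_left h) _ _ (Or.inr (Ax.taut _ _ fun v h0 hv => by
        rw [hv]; exact fun h => absurd h h0))

theorem in₂_mem (h : .sum S₁ S₂ ∈ T.Ing) {x : Set (Form M T (.sum S₁ S₂))}
    (hx : IsMaximal D (.sum S₁ S₂) x) (hb : in₂ (bot S₂) ∈ x) (φ : Form M T S₂) :
    in₂ φ ∈ x := by
  refine hx.mem_of_derivable hD h (Γ := in₂ '' {bot S₂}) ?_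
    (hD.box_in₂ S₁ S₂ h {bot S₂} φ ?_)
  · rintro _ ⟨_, rfl, rfl⟩
    exact hb
  · refine hD.cut S₂ (PF.sum_right h) _ {bot S₂, imp (bot S₂) φ} φ ?_
      (hD.modusPonens S₂ (PF.sum_right h) _ _)
    rintro _ (rfl | rfl)
    · exact hD.assumption S₂ (PF.sum_right h) _ _ (Or.inl rfl)
    · exact hD.assumption S₂ (PF.sum_right h) _ _ (Or.inr (Ax.taut _ _ fun v h0 hv => by
        rw [hv]; exact fun h => absurd h h0))

/-- Otherwise x would contain all premises ¬{c} of the constant rule. -/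
theorem exists_single_mem {k : K} (h : .const k ∈ T.Ing) {x : Set (Form M T (.const k))}
    (hx : IsMaximal D (.const k) x) : ∃ c : M k, single k c ∈ x := by
  by_contra! hc
  refine hx.bot_notMem hD h (hx.mem_of_derivable hD h ?_ (hD.constant k h))
  rintro _ ⟨c, rfl⟩
  exact ((hx.isVal hD h).neg _).2 (hc c)

theorem atom_mem_iff {k : K} (h : .const k ∈ T.Ing) {x : Set (Form M T (.const k))}
    (hx : IsMaximal D (.const k) x) {c : M k} (hc : single k c ∈ x) (A : Set (M k)) (hA) :
    atom k A hA ∈ x ↔ c ∈ A := by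
  refine ⟨fun hm => ?_, fun hm => ((hx.isVal hD h).imp _ _).1
    (hx.mem_of_ax hD h (Ax.const_mem k c A hA hm)) hc⟩
  by_contra hn
  exact ((hx.isVal hD h).neg _).1 (((hx.isVal hD h).imp _ _).1
    (hx.mem_of_ax hD h (Ax.const_notMem k c A hA hn)) hc) hm

end IsMaximal

section Maps

variable (hD : IsDeductionSystem M T D)

/-- The map `x ↦ [next]⁻ x`. -/
def maxNext : maxSpace hD T.id_mem ⟶ maxSpace hD T.self_mem where
  toFun x := ⟨next ⁻¹' x.1, x.2.preimage_next hD⟩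
  meas := by
    rintro _ ⟨φ, rfl⟩
    exact ⟨next φ, rfl⟩

/-- The map `x ↦ ([pr₁]⁻ x, [pr₂]⁻ x)`. -/
def maxProd (h : .prod S₁ S₂ ∈ T.Ing) : maxSpace hD h ⟶
    prodSpace (maxSpace hD (PF.prod_left h)) (maxSpace hD (PF.prod_right h)) where
  toFun x := (⟨pr₁ ⁻¹' x.1, x.2.preimage_pr₁ hD h⟩, ⟨pr₂ ⁻¹' x.1, x.2.preimage_pr₂ hD h⟩)
  meas := by
    refine meas_of_gen _ ?_
    rintro _ ⟨_, ⟨φ, rfl⟩, _, ⟨ψ, rfl⟩, rfl⟩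
    exact BooleanSubalgebra.inf_mem (L := (maxSpace hD h).alg)
      (a := sat D (pr₁ φ.toForm)) (b := sat D (pr₂ ψ.toForm)) ⟨pr₁ φ, rfl⟩ ⟨pr₂ ψ, rfl⟩

open Classical in
/-- The map `x ↦ in_j ([in_j]⁻ x)`, where `[in_j] ⊥` does not belong to `x`. -/
def maxSumFun (h : .sum S₁ S₂ ∈ T.Ing) (x : MaxSet D (.sum S₁ S₂)) :
    MaxSet D S₁ ⊕ MaxSet D S₂ :=
  if hb : in₂ (bot S₂) ∈ x.1 then
    Sum.inl ⟨in₁ ⁻¹' x.1, x.2.preimage_in₁ hD h ((x.2.in_bot_iff hD h).2 hb)⟩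
  else Sum.inr ⟨in₂ ⁻¹' x.1, x.2.preimage_in₂ hD h hb⟩

theorem maxSumFun_inl (h : .sum S₁ S₂ ∈ T.Ing) (x : MaxSet D (.sum S₁ S₂))
    (hb : in₂ (bot S₂) ∈ x.1) : maxSumFun hD h x =
      Sum.inl ⟨in₁ ⁻¹' x.1, x.2.preimage_in₁ hD h ((x.2.in_bot_iff hD h).2 hb)⟩ :=
  dif_pos hb

theorem maxSumFun_inr (h : .sum S₁ S₂ ∈ T.Ing) (x : MaxSet D (.sum S₁ S₂))
    (hb : in₂ (bot S₂) ∉ x.1) : maxSumFun hD h x =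
      Sum.inr ⟨in₂ ⁻¹' x.1, x.2.preimage_in₂ hD h hb⟩ :=
  dif_neg hb

/-- The map `maxSumFun` is measurable. -/
def maxSum (h : .sum S₁ S₂ ∈ T.Ing) : maxSpace hD h ⟶
    sumSpace (maxSpace hD (PF.sum_left h)) (maxSpace hD (PF.sum_right h)) where
  toFun := maxSumFun hD h
  meas := by
    refine meas_of_gen (X := maxSpace hD h) (Y := MaxSet D S₁ ⊕ MaxSet D S₂) _ ?_
    rintro _ (⟨_, ⟨φ, rfl⟩, rfl⟩ | ⟨_, ⟨φ, rfl⟩, rfl⟩)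
    -- [in₁]φ alone also holds throughout the right summand; the conjunct [in₂]⊥ cuts that part off.
    · refine ⟨Fml.and (in₁ φ) (in₂ (bot S₂)), Set.ext fun (x : MaxSet D (.sum S₁ S₂)) =>
        Iff.trans ?_ ((x.2.isVal_toForm hD h).and _ _).symm⟩
      refine Iff.trans (b := maxSumFun hD h x ∈ Sum.inl '' sat D φ.toForm) Iff.rfl ?_
      by_cases hb : in₂ (bot S₂) ∈ x.1
      · rw [maxSumFun_inl hD h x hb]
        refine ⟨?_, fun hx => ⟨_, hx.1, rfl⟩⟩
        rintro ⟨y, hy, he⟩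
        cases he
        exact ⟨hy, hb⟩
      · rw [maxSumFun_inr hD h x hb]
        refine ⟨?_, fun hx => absurd hx.2 hb⟩
        rintro ⟨y, hy, he⟩
        cases he
    · refine ⟨Fml.and (in₂ φ) (neg (in₂ (bot S₂))), Set.ext fun (x : MaxSet D (.sum S₁ S₂)) =>
        Iff.trans ?_ (((x.2.isVal_toForm hD h).and _ _).trans
          (and_congr_right' ((x.2.isVal_toForm hD h).neg _))).symm⟩
      refine Iff.trans (b := maxSumFun hD h x ∈ Sum.inr '' sat D φ.toForm) Iff.rfl ?_
      by_cases hb : in₂ (bot S₂) ∈ x.1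
      · rw [maxSumFun_inl hD h x hb]
        refine ⟨?_, fun hx => absurd hb hx.2⟩
        rintro ⟨y, hy, he⟩
        cases he
      · rw [maxSumFun_inr hD h x hb]
        refine ⟨?_, fun hx => ⟨_, hx.1, rfl⟩⟩
        rintro ⟨y, hy, he⟩
        cases he
        exact ⟨hy, hb⟩

/-- The map that sends `x` to the point `c` with `{c} ∈ x`. -/
def maxConst {k : K} (h : .const k ∈ T.Ing) : maxSpace hD h ⟶ M k where
  toFun x := (x.2.exists_single_mem hD h).choose
  meas U hU := ⟨atom k U (Or.inl hU), Set.ext fun x =>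
    (x.2.atom_mem_iff hD h (x.2.exists_single_mem hD h).choose_spec U (Or.inl hU)).symm⟩

variable (hL : IsLindenbaum D)

/-- The map that sends a maximal set to the measure that it gives. -/
def maxCap {κ : Kind} (h : .cap κ S ∈ T.Ing) :
    maxSpace hD h ⟶ (capFunctor κ).obj (maxSpace hD (PF.cap_arg h)) where
  toFun x := ⟨maxCapFun hD h x, isMeas_maxCapFun hD hL h x⟩
  meas := by
    refine meas_of_gen (Y := Cap κ _) _ ?_
    rintro _ ⟨p, q, _, ⟨φ, rfl⟩, rfl⟩
    -- The preimage of the generator β^{p,q}(|φ|) is |[(p,q)]φ|, the value at the complement being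
    -- that of ¬φ.
    refine ⟨box κ p q φ, Set.ext fun (x : MaxSet D (.cap κ S)) => Iff.trans ?_ (x.2.box_iff hD h p q φ).symm⟩
    rw [← maxCapFun_satAlg hD hL h x, ← maxCapFun_satAlg hD hL h x, satAlg_neg]
    exact ⟨fun ⟨_, hx⟩ => hx, fun hx => ⟨⟨φ, rfl⟩, hx⟩⟩

/-- The map that sends a maximal set to the probability measure that it gives. -/
def maxPrb (h : .prob S ∈ T.Ing) :
    maxSpace hD h ⟶ prbFunctor.obj (maxSpace hD (PF.prob_arg h)) where
  toFun x := ⟨maxPrbFun hD h x, isProb_maxPrbFun hD hL h x⟩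
  meas := by
    refine meas_of_gen (Y := Prb _) _ ?_
    rintro _ ⟨p, _, ⟨φ, rfl⟩, rfl⟩
    refine ⟨ge p φ, Set.ext fun (x : MaxSet D (.prob S)) => Iff.trans ?_ (x.2.pGe_iff hD h p φ).symm⟩
    rw [← maxPrbFun_satAlg hD hL h x]
    exact ⟨fun ⟨_, hx⟩ => hx, fun hx => ⟨⟨φ, rfl⟩, hx⟩⟩

/-! ### The canonical coalgebra -/

/-- The maps `r_S`. -/
def canonicalMap : ∀ (S : PF K) (hS : S ∈ T.Ing),
    maxSpace hD hS ⟶ (S.functor M).obj (maxSpace hD T.id_mem)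
  | .id, _ => 𝟙 (maxSpace hD T.id_mem)
  | .const _, h => maxConst hD h
  | .prod S₁ S₂, h => maxProd hD h ≫
      prodMap (canonicalMap S₁ (PF.prod_left h)) (canonicalMap S₂ (PF.prod_right h))
  | .sum S₁ S₂, h => maxSum hD h ≫
      sumMap (canonicalMap S₁ (PF.sum_left h)) (canonicalMap S₂ (PF.sum_right h))
  | .cap κ S, h => maxCap hD hL h ≫ (capFunctor κ).map (canonicalMap S (PF.cap_arg h))
  | .prob S, h => maxPrb hD hL h ≫ prbFunctor.map (canonicalMap S (PF.prob_arg h))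

/-- The canonical coalgebra. -/
def canonical : Canonical hD where
  r := canonicalMap hD hL
  str := maxNext hD ≫ canonicalMap hD hL T T.self_mem
  r_id _ := rfl
  r_const k hk x := (x.2.exists_single_mem hD hk).choose_spec
  r_prod S₁ S₂ h x := ⟨⟨pr₁ ⁻¹' x.1, x.2.preimage_pr₁ hD h⟩,
    ⟨pr₂ ⁻¹' x.1, x.2.preimage_pr₂ hD h⟩, rfl, rfl, rfl⟩
  r_sum S₁ S₂ h x := by
    by_cases hb : in₂ (bot S₂) ∈ x.1
    · have hb' := (x.2.in_bot_iff hD h).2 hb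
      refine Or.inl ⟨((x.2.isVal hD h).neg _).2 hb',
        ⟨in₁ ⁻¹' x.1, x.2.preimage_in₁ hD h hb'⟩, rfl, ?_⟩
      exact congrArg (Sum.map _ _) (maxSumFun_inl hD h x hb)
    · refine Or.inr ⟨((x.2.isVal hD h).neg _).2 hb,
        ⟨in₂ ⁻¹' x.1, x.2.preimage_in₂ hD h hb⟩, rfl, ?_⟩
      exact congrArg (Sum.map _ _) (maxSumFun_inr hD h x hb)
  r_cap κ S h x U φ hU := by
    have h1 := x.2.isLUB_uVal hD h φ
    rw [← maxCapFun_satAlg hD hL h x] at h1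
    have h2 : satAlg hD (PF.cap_arg h) φ = pre (canonicalMap hD hL S (PF.cap_arg h)) U :=
      Subtype.ext hU.symm
    rw [h2] at h1
    exact h1
  r_prob S h x U φ hU := by
    have h1 := x.2.isLUB_pVal hD h φ
    rw [← maxPrbFun_satAlg hD hL h x] at h1
    have h2 : satAlg hD (PF.prob_arg h) φ = pre (canonicalMap hD hL S (PF.prob_arg h)) U :=
      Subtype.ext hU.symm
    rw [h2] at h1
    exact h1
  str_eq x := ⟨⟨next ⁻¹' x.1, x.2.preimage_next hD⟩, rfl, rfl⟩

end Maps

section Unique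

variable {hD : IsDeductionSystem M T D}

/-- By induction on S, each clause determines its map. For measures, measurability of r_S represents
every preimage as some |φ|, and the clause then fixes the value as a supremum. -/
theorem Canonical.r_unique (C C' : Canonical hD) (S : PF K) (hS : S ∈ T.Ing) :
    C.r S hS = C'.r S hS := by
  induction S with
  | id => exact Unc.Hom.ext (funext fun x => (C.r_id x).trans (C'.r_id x).symm)
  | const k =>
    exact Unc.Hom.ext <| funext fun x =>
      (x.2.atom_mem_iff hD hS (C'.r_const k hS x) _ _).1 (C.r_const k hS x) |>.symm
  | prod S₁ S₂ h1 h2 =>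
    refine Unc.Hom.ext <| funext fun x => ?_
    obtain ⟨y₁, y₂, e1, e2, e⟩ := C.r_prod S₁ S₂ hS x
    obtain ⟨y₁', y₂', e1', e2', e'⟩ := C'.r_prod S₁ S₂ hS x
    obtain rfl : y₁ = y₁' := Subtype.ext (e1.trans e1'.symm)
    obtain rfl : y₂ = y₂' := Subtype.ext (e2.trans e2'.symm)
    rw [e, e', h1, h2]
  | sum S₁ S₂ h1 h2 =>
    refine Unc.Hom.ext <| funext fun x => ?_
    -- The two systems cannot choose different summands, since exactly one of [in₁]⊥ and [in₂]⊥ is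
    -- in x.
    have hno : ¬ (neg (in₁ (bot S₁)) ∈ x.1 ∧ neg (in₂ (bot S₂)) ∈ x.1) := fun h => by
      rw [(x.2.isVal hD hS).neg, (x.2.isVal hD hS).neg, x.2.in_bot_iff hD hS] at h
      exact h.2 h.1
    rcases C.r_sum S₁ S₂ hS x with ⟨hb, y, ey, e⟩ | ⟨hb, y, ey, e⟩ <;>
    rcases C'.r_sum S₁ S₂ hS x with ⟨hb', y', ey', e'⟩ | ⟨hb', y', ey', e'⟩
    · obtain rfl : y = y' := Subtype.ext (ey.trans ey'.symm)
      rw [e, e', h1]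
    · exact absurd ⟨hb, hb'⟩ hno
    · exact absurd ⟨hb', hb⟩ hno
    · obtain rfl : y = y' := Subtype.ext (ey.trans ey'.symm)
      rw [e, e', h2]
  | cap κ S h =>
    refine Unc.Hom.ext <| funext fun x => Subtype.ext <| funext fun U => ?_
    obtain ⟨φ, hφ⟩ := (C.r S (PF.cap_arg hS)).meas U.1 U.2
    have hφ' := hφ
    rw [h] at hφ'
    exact (C.r_cap κ S hS x U φ hφ).unique (C'.r_cap κ S hS x U φ hφ')
  | prob S h =>
    refine Unc.Hom.ext <| funext fun x => Subtype.ext <| funext fun U => ?_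
    obtain ⟨φ, hφ⟩ := (C.r S (PF.prob_arg hS)).meas U.1 U.2
    have hφ' := hφ
    rw [h] at hφ'
    exact (C.r_prob S hS x U φ hφ).unique (C'.r_prob S hS x U φ hφ')

theorem Canonical.unique (C C' : Canonical hD) : C = C' := by
  refine Canonical.ext (funext fun S => funext fun hS => C.r_unique C' S hS) ?_
  refine Unc.Hom.ext <| funext fun x => ?_
  obtain ⟨y, ey, e⟩ := C.str_eq x
  obtain ⟨y', ey', e'⟩ := C'.str_eq x
  obtain rfl : y = y' := Subtype.ext (ey.trans ey'.symm)
  rw [e, e', C.r_unique C']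

end Unique

/-! ### Truth in the canonical coalgebra -/

section Truth

variable {hD : IsDeductionSystem M T D} (C : Canonical hD)

/-- The point of `S` applied to the canonical coalgebra that a maximal set of sort `S` gives. -/
def Canonical.point (hS : S ∈ T.Ing) (x : maxSpace hD hS) : (S.functor M).obj C.coalg.V :=
  (C.r S hS).toFun x

variable {C} in
theorem Canonical.point_eq {hS : S ∈ T.Ing} {x : maxSpace hD hS}
    {y : (S.functor M).obj C.coalg.V} (h : (C.r S hS).toFun x = y) : C.point hS x = y := h

/-- The truth lemma. -/
theorem Canonical.truth (φ : Fml M T b S) : ∀ (hS : S ∈ T.Ing) (x : maxSpace hD hS),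
    C.point hS x ∈ interp C.coalg φ ↔ φ.toForm ∈ x.1 := by
  induction φ with
  | bot => exact fun hS x => iff_of_false id (x.2.bot_notMem hD hS)
  | imp φ ψ h1 h2 =>
    intro hS x
    rw [(isVal_interp C.coalg _).imp, (x.2.isVal_toForm hD hS).imp, h1, h2]
  | @atom b k A h =>
    intro hS x
    cases b <;> exact (x.2.atom_mem_iff hD hS (C.r_const k hS x) A _).symm
  | @pr₁ b S₁ S₂ φ h =>
    intro hS x
    obtain ⟨y₁, y₂, e1, e2, e⟩ := C.r_prod S₁ S₂ hS x
    rw [Canonical.point_eq e]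
    refine (h _ y₁).trans ?_
    rw [e1]
    exact Iff.rfl
  | @pr₂ b S₁ S₂ φ h =>
    intro hS x
    obtain ⟨y₁, y₂, e1, e2, e⟩ := C.r_prod S₁ S₂ hS x
    rw [Canonical.point_eq e]
    refine (h _ y₂).trans ?_
    rw [e2]
    exact Iff.rfl
  | @in₁ b S₁ S₂ φ h =>
    intro hS x
    rcases C.r_sum S₁ S₂ hS x with ⟨hb, y, ey, e⟩ | ⟨hb, y, ey, e⟩
    · rw [Canonical.point_eq e]
      refine Iff.trans ?_ ((h (PF.sum_left hS) y).trans ?_)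
      · refine ⟨?_, fun h => Or.inl ⟨_, h, rfl⟩⟩
        rintro (⟨z, hz, he⟩ | ⟨z, he⟩)
        · cases he; exact hz
        · cases he
      · rw [ey]
        exact Iff.rfl
    · rw [Canonical.point_eq e]
      refine iff_of_true (Or.inr ⟨_, rfl⟩) (x.2.in₁_mem hD hS ?_ _)
      rw [(x.2.isVal hD hS).neg, ← x.2.in_bot_iff hD hS, not_not] at hb
      exact hb
  | @in₂ b S₁ S₂ φ h =>
    intro hS x
    rcases C.r_sum S₁ S₂ hS x with ⟨hb, y, ey, e⟩ | ⟨hb, y, ey, e⟩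
    · rw [Canonical.point_eq e]
      refine iff_of_true (Or.inl ⟨_, rfl⟩) (x.2.in₂_mem hD hS ?_ _)
      rwa [(x.2.isVal hD hS).neg, x.2.in_bot_iff hD hS] at hb
    · rw [Canonical.point_eq e]
      refine Iff.trans ?_ ((h (PF.sum_right hS) y).trans ?_)
      · refine ⟨?_, fun h => Or.inr ⟨_, h, rfl⟩⟩
        rintro (⟨z, he⟩ | ⟨z, hz, he⟩)
        · cases he
        · cases he; exact hz
      · rw [ey]
        exact Iff.rfl
  | next φ h =>
    intro hS x
    obtain ⟨y, ey, e⟩ := C.str_eq x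
    rw [Canonical.point_eq (C.r_id x)]
    change C.str.toFun x ∈ interp C.coalg φ ↔ _
    rw [e]
    refine (h T.self_mem y).trans ?_
    rw [ey]
    exact Iff.rfl
  | @box b κ S p q φ h =>
    intro hS x
    -- The truth lemma for ψ says that r_S pulls the interpretation of ψ back to |ψ|, so the clause
    -- for r evaluates it. It is needed for φ and for ¬φ.
    have hφ : ∀ ψ : MForm M T S, (∀ y, C.point (PF.cap_arg hS) y ∈ interp C.coalg ψ ↔
        ψ.toForm ∈ y.1) → capVal (C.point hS x) (event C.coalg ψ) =
        uVal x.1 ψ := fun ψ hψ =>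
      (C.r_cap κ S hS x (event C.coalg ψ) ψ (Set.ext hψ)).unique (x.2.isLUB_uVal hD hS ψ)
    rw [mem_interp_box, ← event_neg, hφ φ (h (PF.cap_arg hS)), hφ (neg φ) fun y => by
      rw [(isVal_interp C.coalg _).neg, (y.2.isVal_toForm hD (PF.cap_arg hS)).neg, h]]
    exact (x.2.box_iff hD hS p q φ).symm
  | @ge b S p φ h =>
    intro hS x
    have hφ : prbVal (C.point hS x) (event C.coalg φ) = pVal x.1 φ :=
      (C.r_prob S hS x (event C.coalg φ) φ (Set.ext (h (PF.prob_arg hS)))).unique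
        (x.2.isLUB_pVal hD hS φ)
    rw [mem_interp_ge, hφ]
    exact (x.2.pGe_iff hD hS p φ).symm

/-- Completeness of the canonical coalgebra. -/
theorem Canonical.complete (hL : IsLindenbaum D) (hS : S ∈ T.Ing) {Γ : Set (Form M T S)}
    {φ : Form M T S} (h : Cons C.coalg S Γ φ) : D S Γ φ :=
  hL.derivable hD hS fun x hx hΓ => by
    have := (C.truth φ hS ⟨x, hx⟩).1 <| h _ fun γ hγ => (C.truth γ hS ⟨x, hx⟩).2 <| by
      rw [toForm_eq_self]
      exact hΓ hγ
    rwa [toForm_eq_self] at this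

end Truth

/-! ### Finality -/

theorem preimage_sumMap_inl {α β α' β' : Type*} (f : α → α') (g : β → β') (U : Set α') :
    Sum.map f g ⁻¹' (Sum.inl '' U ∪ Set.range Sum.inr) =
      Sum.inl '' (f ⁻¹' U) ∪ Set.range Sum.inr := by
  ext (x | x) <;> simp

theorem preimage_sumMap_inr {α β α' β' : Type*} (f : α → α') (g : β → β') (U : Set β') :
    Sum.map f g ⁻¹' (Set.range Sum.inl ∪ Sum.inr '' U) =
      Set.range Sum.inl ∪ Sum.inr '' (g ⁻¹' U) := by
  ext (x | x) <;> simp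

/-- Coalgebra morphisms preserve and reflect truth. -/
theorem interp_hom {A B : Coalg M T} (f : A ⟶ B) (φ : Fml M T b S) :
    interp A φ = ((S.functor M).map f.f).toFun ⁻¹' interp B φ := by
  induction φ with
  | bot => rfl
  | imp φ ψ h1 h2 =>
    simp only [interp, h1, h2]
    rfl
  | atom => rfl
  | pr₁ φ h =>
    simp only [interp, h]
    rfl
  | pr₂ φ h =>
    simp only [interp, h]
    rfl
  | in₁ φ h =>
    simp only [interp, h]
    exact (preimage_sumMap_inl _ _ _).symm
  | in₂ φ h =>
    simp only [interp, h]
    exact (preimage_sumMap_inr _ _ _).symm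
  | next φ h =>
    simp only [interp, h]
    change (A.str ≫ (T.functor M).map f.f).toFun ⁻¹' _ = (f.f ≫ B.str).toFun ⁻¹' _
    rw [f.h]
  | @box b κ S p q φ h =>
    ext g
    have he : event A φ = pre ((S.functor M).map f.f) (event B φ) := Subtype.ext h
    rw [Set.mem_preimage, mem_interp_box, mem_interp_box, he]
    exact Iff.rfl
  | @ge b S p φ h =>
    ext g
    have he : event A φ = pre ((S.functor M).map f.f) (event B φ) := Subtype.ext h
    rw [Set.mem_preimage, mem_interp_ge, mem_interp_ge, he]
    exact Iff.rfl

section Final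

variable (hD : IsDeductionSystem M T D) {A : Coalg M T}
  (hA : ∀ S ∈ T.Ing, ∀ Γ φ, D S Γ φ → Cons A S Γ φ)

/-- The map that sends each point of a coalgebra to its theory. -/
def theoryMap (S : PF K) (hS : S ∈ T.Ing) : (S.functor M).obj A.V ⟶ maxSpace hD hS where
  toFun x := ⟨theory A x, isMaximal_theory (hA S hS) x⟩
  meas := by
    rintro _ ⟨φ, rfl⟩
    have : (fun x => (⟨theory A x, isMaximal_theory (hA S hS) x⟩ : MaxSet D S)) ⁻¹'
        sat D φ.toForm = interp A φ := interp_toForm A φ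
    exact this ▸ interp_mem_alg A φ

variable (C : Canonical hD)

theorem theoryMap_preimage {hS : S ∈ T.Ing} (φ : MForm M T S) :
    (theoryMap hD hA S hS).toFun ⁻¹' sat D φ.toForm = interp A φ := interp_toForm A φ

/-- The functors send the theory map of sort `Id` to the theory maps of their sorts. -/
theorem map_theoryMap (S : PF K) (hS : S ∈ T.Ing) :
    (S.functor M).map (theoryMap hD hA .id T.id_mem) =
      theoryMap hD hA S hS ≫ C.r S hS := by
  induction S with
  | id => exact Unc.Hom.ext (funext fun x => (C.r_id _).symm)
  | const k =>
    refine Unc.Hom.ext <| funext fun x => ?_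
    -- {c} belongs to the theory of x just when x = c, so the clause is the required equation.
    exact C.r_const k hS ((theoryMap hD hA _ hS).toFun x)
  | prod S₁ S₂ h1 h2 =>
    refine Unc.Hom.ext <| funext fun x => ?_
    obtain ⟨y₁, y₂, e1, e2, e⟩ := C.r_prod S₁ S₂ hS ((theoryMap hD hA _ hS).toFun x)
    refine Eq.trans ?_ e.symm
    have k1 : y₁ = (theoryMap hD hA S₁ (PF.prod_left hS)).toFun x.1 := Subtype.ext e1
    have k2 : y₂ = (theoryMap hD hA S₂ (PF.prod_right hS)).toFun x.2 := Subtype.ext e2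
    rw [k1, k2]
    exact Prod.ext (congrFun (congrArg Unc.Hom.toFun (h1 (PF.prod_left hS))) x.1)
      (congrFun (congrArg Unc.Hom.toFun (h2 (PF.prod_right hS))) x.2)
  | sum S₁ S₂ h1 h2 =>
    refine Unc.Hom.ext <| funext fun x => ?_
    have hM := ((theoryMap hD hA _ hS).toFun x).2
    rcases C.r_sum S₁ S₂ hS ((theoryMap hD hA _ hS).toFun x) with
      ⟨hb, y, ey, e⟩ | ⟨hb, y, ey, e⟩
    · refine Eq.trans ?_ e.symm
      rw [(hM.isVal hD hS).neg] at hb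
      rcases x with x | x
      · have k : y = (theoryMap hD hA S₁ (PF.sum_left hS)).toFun x := by
          refine Subtype.ext (ey.trans (Set.ext fun φ => ?_))
          refine ⟨?_, fun h => Or.inl ⟨x, h, rfl⟩⟩
          rintro (⟨z, hz, he⟩ | ⟨z, he⟩)
          · cases he; exact hz
          · cases he
        rw [k]
        exact congrArg Sum.inl (congrFun (congrArg Unc.Hom.toFun (h1 (PF.sum_left hS))) x)
      -- A point of the right summand satisfies [in₁]⊥ vacuously, contrary to the choice of summand.
      · exact absurd (Or.inr ⟨x, rfl⟩) hb
    · refine Eq.trans ?_ e.symm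
      rw [(hM.isVal hD hS).neg] at hb
      rcases x with x | x
      · exact absurd (Or.inl ⟨x, rfl⟩) hb
      · have k : y = (theoryMap hD hA S₂ (PF.sum_right hS)).toFun x := by
          refine Subtype.ext (ey.trans (Set.ext fun φ => ?_))
          refine ⟨?_, fun h => Or.inr ⟨x, h, rfl⟩⟩
          rintro (⟨z, he⟩ | ⟨z, hz, he⟩)
          · cases he
          · cases he; exact hz
        rw [k]
        exact congrArg Sum.inr (congrFun (congrArg Unc.Hom.toFun (h2 (PF.sum_right hS))) x)
  | cap κ S h =>
    refine Unc.Hom.ext <| funext fun g => Subtype.ext <| funext fun U => ?_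
    obtain ⟨φ, hφ⟩ := (C.r S (PF.cap_arg hS)).meas U.1 U.2
    -- Both values are least upper bounds of the q for which g satisfies U_{≥q} φ. For the
    -- push-forward of g the bound is attained, at the measure of φ itself.
    refine IsLUB.unique ?_ (C.r_cap κ S hS ((theoryMap hD hA _ hS).toFun g) U φ hφ)
    have he : pre ((S.functor M).map (theoryMap hD hA .id T.id_mem)) U = event A φ := by
      refine Subtype.ext ?_
      change ((S.functor M).map (theoryMap hD hA .id T.id_mem)).toFun ⁻¹' U.1 = interp A φ
      rw [h (PF.cap_arg hS), ← theoryMap_preimage hD hA (hS := PF.cap_arg hS) φ, ← hφ]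
      rfl
    change IsLUB _ (capVal g (pre ((S.functor M).map (theoryMap hD hA .id T.id_mem)) U))
    rw [he]
    refine ⟨?_, fun t ht => ht ⟨⟨capVal g (event A φ), (isMeas_capVal g).nonneg _,
      (isMeas_capVal g).le_one _⟩, mem_interp_uGe.2 le_rfl, rfl⟩⟩
    rintro _ ⟨q, hq, rfl⟩
    exact mem_interp_uGe.1 hq
  | prob S h =>
    refine Unc.Hom.ext <| funext fun g => Subtype.ext <| funext fun U => ?_
    obtain ⟨φ, hφ⟩ := (C.r S (PF.prob_arg hS)).meas U.1 U.2
    refine IsLUB.unique ?_ (C.r_prob S hS ((theoryMap hD hA _ hS).toFun g) U φ hφ)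
    have he : pre ((S.functor M).map (theoryMap hD hA .id T.id_mem)) U = event A φ := by
      refine Subtype.ext ?_
      change ((S.functor M).map (theoryMap hD hA .id T.id_mem)).toFun ⁻¹' U.1 = interp A φ
      rw [h (PF.prob_arg hS), ← theoryMap_preimage hD hA (hS := PF.prob_arg hS) φ, ← hφ]
      rfl
    change IsLUB _ (prbVal g (pre ((S.functor M).map (theoryMap hD hA .id T.id_mem)) U))
    rw [he]
    refine ⟨?_, fun t ht => ht ⟨⟨prbVal g (event A φ), (isProb_prbVal g).nonneg _,
      (isProb_prbVal g).le_one _⟩, mem_interp_pGe.2 le_rfl, rfl⟩⟩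
    rintro _ ⟨q, hq, rfl⟩
    exact mem_interp_pGe.1 hq

/-- The theory map as a coalgebra morphism to the canonical coalgebra. -/
def theoryHom : A ⟶ C.coalg where
  f := theoryMap hD hA .id T.id_mem
  h := by
    -- At the sort T the theory maps commute with r_T, and the theory of α(x) is [next]⁻ of the
    -- theory of x; together these give the coalgebra square.
    refine (congrArg (A.str ≫ ·) (map_theoryMap hD hA C T T.self_mem)).trans ?_
    refine Unc.Hom.ext <| funext fun x => ?_
    obtain ⟨y, ey, e⟩ := C.str_eq ((theoryMap hD hA .id T.id_mem).toFun x)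
    refine Eq.trans ?_ e.symm
    have k : y = (theoryMap hD hA T T.self_mem).toFun (A.str.toFun x) := Subtype.ext ey
    rw [k]
    rfl

/-- A coalgebra morphism to the canonical coalgebra sends each point to its theory. -/
theorem hom_eq_theoryHom (f : A ⟶ C.coalg) : f = theoryHom hD hA C := by
  refine Endofunctor.Coalgebra.Hom.ext <| Unc.Hom.ext <| funext fun x =>
    Subtype.ext <| Set.ext fun φ => ?_
  have h := C.truth φ T.id_mem (f.f.toFun x)
  rw [toForm_eq_self] at h
  -- The truth lemma reads membership of φ in f(x) as truth at f(x), and morphisms preserve and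
  -- reflect truth; so f(x) is the theory of x.
  have he : C.point T.id_mem (f.f.toFun x) ∈ interp C.coalg φ ↔ x ∈ interp A φ := by
    rw [interp_hom f φ]
    exact iff_of_eq (congrArg (· ∈ interp C.coalg φ) (C.r_id _))
  exact h.symm.trans he

end Final

end CanonicalCoalgebra

end UncLogic

end

/-! ### The main theorem -/

theorem mainTheorem4 {K : Type u} (M : K → Unc.{u}) (T : PF K) :
    -- soundness of the axioms and rules
    ((∀ A : Coalg M T, IsDeductionSystem M T (Cons A)) ∧
      IsDeductionSystem M T (Derivable M T) ∧ IsSound (Derivable M T)) ∧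
    -- semantic consequence is a (sound) Lindenbaum system
    (IsDeductionSystem M T (SemCons M T) ∧ IsLindenbaum (SemCons M T)) ∧
    -- canonical coalgebras: construction, completeness, finality, equivalence
    ∀ (D : Entailment M T) (hD : IsDeductionSystem M T D), IsLindenbaum D →
      ∃ C : Canonical hD, (∀ C' : Canonical hD, C' = C) ∧
        (∀ S ∈ T.Ing, ∀ (Γ : Set (Form M T S)) (φ : Form M T S),
          Cons C.coalg S Γ φ → D S Γ φ) ∧
        (∀ A : Coalg M T, (∀ S ∈ T.Ing, ∀ Γ φ, D S Γ φ → Cons A S Γ φ) →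
          Nonempty (Unique (A ⟶ C.coalg))) ∧
        (IsSound D →
          Nonempty (Limits.IsTerminal C.coalg) ∧
          ∀ S ∈ T.Ing, ∀ (Γ : Set (Form M T S)) (φ : Form M T S),
            List.TFAE [SemCons M T S Γ φ, Cons C.coalg S Γ φ, D S Γ φ]) := by
  refine ⟨⟨isDeductionSystem_cons, isDeductionSystem_derivable M T, isSound_derivable M T⟩,
    ⟨isDeductionSystem_semCons M T, isLindenbaum_semCons M T⟩, fun D hD hL => ?_⟩
  let C := canonical hD hL
  have hc : ∀ S ∈ T.Ing, ∀ (Γ : Set (Form M T S)) (φ : Form M T S),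
      Cons C.coalg S Γ φ → D S Γ φ := fun S hS Γ φ h => C.complete hL hS h
  refine ⟨C, fun C' => C'.unique C, hc,
    fun A hA => ⟨⟨⟨theoryHom hD hA C⟩, hom_eq_theoryHom hD hA C⟩⟩, fun hs => ⟨?_, ?_⟩⟩
  -- Soundness makes every coalgebra a model of D, so the unique morphisms exist from all of them.
  · have hA : ∀ A : Coalg M T, ∀ S ∈ T.Ing, ∀ Γ φ, D S Γ φ → Cons A S Γ φ :=
      fun A S hS Γ φ h => hs S hS Γ φ h A
    exact ⟨Limits.IsTerminal.ofUniqueHom (fun A => theoryHom hD (hA A) C)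
      fun A f => hom_eq_theoryHom hD (hA A) C f⟩
  · intro S hS Γ φ
    tfae_have 1 → 2 := fun h => h C.coalg
    tfae_have 2 → 3 := hc S hS Γ φ
    tfae_have 3 → 1 := hs S hS Γ φ
    tfae_finish
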